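/- **Setting.** Let $X$ be a real Banach space and let $A:D(A)\subset X\to X$ be the generator of a semigroup $(S(t))_{t\ge 0}$ of bounded injective linear operators on $X$, with $S(0)=I$ (no strong continuity at $t=0$ is required; generator means that $(\lambda-A)^{-1}=\int_0^\infty e^{-\lambda t}S(t)\,dt$ for all large real $\lambda$). For $\lambda\in[0,2)$ let $X_\lambda\subseteq X$ be Banach spaces with $X_0=X$, $X_1=D(A)$, such that $X_\lambda$ is continuously embedded into $X_\beta$ if $\beta<\lambda$. Assume that for all $0\le\zeta\le\lambda<2$, all $0\le\nu<\mu\le1$ and all $T>0$ there are positive constants $L=L_{\zeta,\lambda,T}$ and $C=C_{\mu,\nu,T}$ with $$\|S(t)\|_{\mathscr L(X_\zeta,X_\lambda)}\le L\,t^{\zeta-\lambda},\qquad \|S(t)-I\|_{\mathscr L(X_\mu,X_\nu)}\le C\,t^{\mu-\nu},\qquad t\in(0,T].$$ **Notation.** For $a<b$ let $[a,b]^2_<=\{(s,t):a\le s\le t\le b\}$ and $(a,b]^2_<=\{(s,t):a<s\le t\le b\}$. For a Banach space $F$, $\beta\ge0$ and $\gamma\ge 0$ let * $\mathscr C_{-\gamma}((a,b];F)$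 be the set of continuous $f:(a,b]\to F$ with $\sup_{t}(t-a)^\gamma\|f(t)\|_F<\infty$, and $C_b((a,b];F)=\mathscr C_0((a,b];F)$; * $\mathscr C^\beta([a,b]^2_<;F)$ be the set of continuous $f:[a,b]^2_<\to F$ with $f(s,s)=0$ for all $s$ and $\sup_{a\le s<t\le b}(t-s)^{-\beta}\|f(s,t)\|_F<\infty$; * $\mathscr C^\beta_{-\gamma}((a,b]^2_<;F)$ be the set of continuous $f:(a,b]^2_<\to F$ with $f(s,s)=0$ for all $s$ and $\sup_{a<s<t\le b}(s-a)^\gamma(t-s)^{-\beta}\|f(s,t)\|_F<\infty$. Set $(\hat\delta_1f)(s,t)=f(t)-S(t-s)f(s)$, $(\hat\delta_2M)(r,s,t)=M(r,t)-M(s,t)-S(t-s)M(r,s)$ and $(\delta_{S,2}g)(r,s,t)=-g(s,t)+S(s-r)\big(g(r,t)-g(r,s)\big)$. **Convolution integral.** Let $\eta\in(0,1)$ and $x\in C^\eta([0,1])$ be real-valued, and let $\varphi:[0,1]\to X$. The convolution integral $\mathscr I_{S,\varphi}(s,t)=\int_s^tS(t-r)\varphi(r)\,dx(r)$ is called well defined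 on $[0,1]^2_<$ if, for some $0\le\beta'\le\alpha'<2$ with $\alpha'-\beta'<1$, $\rho\in(1-\eta,1)$ and $\gamma\in[0,\eta\wedge(\rho+\eta+\beta'-\alpha'))$, one has $\varphi\in\mathscr C_{-\gamma}((0,1];X_{\alpha'})$ and $\hat\delta_1\varphi\in\mathscr C^{\rho}_{-\gamma}((0,1]^2_<;X_{\beta'})$. In that case it is defined by $$\mathscr I_{S,\varphi}(s,t)=S(t-s)g(s,t)-M(s,t),\quad 0<s\le t\le1,\qquad g(s,t)=(x(t)-x(s))\varphi(s),$$ and by continuous extension to $[0,1]^2_<$, where $M$ is the unique function on $(0,1]^2_<$ which belongs to $\mathscr C^{\eta+\rho-\varepsilon}([\tau,1]^2_<;X_{\beta'+\varepsilon})$ for all $\tau\in(0,1)$ and all $\varepsilon\in[0,1)$ with $\beta'+\varepsilon<2$, and satisfies $(\hat\delta_2M)(r,s,t)=S(t-s)(\delta_{S,2}g)(r,s,t)$ for $0<r\le s\le t\le1$. (This does not depend on the choice of $\alpha',\beta',\rho,\gamma$.) **Theorem.** Let $x\in C^\eta([0,1])$ be real-valued with $\eta\in(1/2,1)$. Let $\sigma:X\to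 X$ be Gâteaux differentiable, with Gâteaux derivative $\sigma':X\to\mathscr L(X)$ bounded and Lipschitz continuous on bounded sets (so that $\sigma$ is Lipschitz continuous on $X$). Let $\alpha\in(0,1)$ be such that $\eta+\alpha>1$, and assume that $\sigma$ maps $X_\alpha$ into itself and is Lipschitz continuous as a map from $X_\alpha$ into itself. Let $\theta\in[0,\alpha]$ with $\eta>2\alpha-\theta$, and let $\psi\in X_\theta$. Then the problem $dy=Ay\,dt+\sigma(y)\,dx$, $y(0)=\psi$, has a unique mild solution, i.e. there is exactly one function $y:[0,1]\to X$ such that $\mathscr I_{S,\sigma\circ y}$ is well defined on $[0,1]^2_<$ and $$y(t)=S(t)\psi+\int_0^tS(t-r)\sigma(y(r))\,dx(r),\qquad t\in[0,1].$$ Moreover $y$ belongs to $Y^\alpha_{\theta-\alpha}(0,1)$, that is, $y\in\mathscr C_{-(\alpha-\theta)}((0,1];X_\alpha)\cap C_b((0,1];X)$ and $\hat\delta_1y\in\mathscr C^\alpha([0,1]^2_<;X_\alpha)$. (The case $\theta=0$, i.e. $\psi\in X$, is allowed if $\eta>2\alpha$.) -/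

import Mathlib

open Set MeasureTheory

namespace YoungEvolution

/-! ### Function spaces

`F` is a Banach space.  Functions are total on `ℝ` or `ℝ × ℝ`, and only their values on the
indicated interval or triangle matter. -/

/-- The triangle `(a,b]²_< = {(s,t) : a < s ≤ t ≤ b}`. -/
def openTri (a b : ℝ) : Set (ℝ × ℝ) := {p | a < p.1 ∧ p.1 ≤ p.2 ∧ p.2 ≤ b}

/-- The triangle `[a,b]²_< = {(s,t) : a ≤ s ≤ t ≤ b}`. -/
def closedTri (a b : ℝ) : Set (ℝ × ℝ) := {p | a ≤ p.1 ∧ p.1 ≤ p.2 ∧ p.2 ≤ b}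

/-- `𝒞_{-γ}((a,b]; F)`: continuous `f` with `sup_{t ∈ (a,b]} (t-a)^γ ‖f(t)‖ < ∞`. -/
def SingC {F : Type*} [NormedAddCommGroup F] (γ a b : ℝ) (f : ℝ → F) : Prop :=
  ContinuousOn f (Ioc a b) ∧ ∃ C : ℝ, ∀ t ∈ Ioc a b, (t - a) ^ γ * ‖f t‖ ≤ C

/-- `𝒞^β([a,b]²_<; F)`: continuous `f` vanishing on the diagonal, with
`sup_{a ≤ s < t ≤ b} ‖f(s,t)‖ / (t-s)^β < ∞`. -/
def HolderTri {F : Type*} [NormedAddCommGroup F] (β a b : ℝ) (f : ℝ × ℝ → F) : Prop :=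
  ContinuousOn f (closedTri a b) ∧ (∀ s ∈ Icc a b, f (s, s) = 0) ∧
    ∃ C : ℝ, ∀ s t : ℝ, a ≤ s → s < t → t ≤ b → ‖f (s, t)‖ / (t - s) ^ β ≤ C

/-- `𝒞^β_{-γ}((a,b]²_<; F)`: continuous `f` vanishing on the diagonal, with
`sup_{a < s < t ≤ b} (s-a)^γ ‖f(s,t)‖ / (t-s)^β < ∞`. -/
def SingHolderTri {F : Type*} [NormedAddCommGroup F] (β γ a b : ℝ) (f : ℝ × ℝ → F) : Prop :=
  ContinuousOn f (openTri a b) ∧ (∀ s ∈ Ioc a b, f (s, s) = 0) ∧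
    ∃ C : ℝ, ∀ s t : ℝ, a < s → s < t → t ≤ b → (s - a) ^ γ * (‖f (s, t)‖ / (t - s) ^ β) ≤ C

/-- For `F` embedded in `X` by `j`: the `X`-valued function `f` takes values in `F` on `D` and,
as an `F`-valued function, it has property `P`. -/
def ValuedIn {T F X : Type*} (j : F → X) (D : Set T) (P : (T → F) → Prop) (f : T → X) : Prop :=
  ∃ g : T → F, P g ∧ ∀ p ∈ D, j (g p) = f p

/-! ### Semigroups and scales of spaces -/

section

variable {X : Type*} [NormedAddCommGroup X] [NormedSpace ℝ X]

/-- `u` belongs to the space `F` (embedded in `X` by `j`) and its norm there is at most `c`. -/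
def NormLE {F : Type*} [NormedAddCommGroup F] [NormedSpace ℝ F] (j : F →L[ℝ] X) (u : X) (c : ℝ) :
    Prop :=
  ∃ z : F, j z = u ∧ ‖z‖ ≤ c

/-- Semigroups of bounded operators; only the values `S t` with `t ≥ 0` matter.
No continuity at `t = 0` is required. -/
structure IsSemigroup (S : ℝ → X →L[ℝ] X) : Prop where
  zero : S 0 = ContinuousLinearMap.id ℝ X
  add : ∀ s t : ℝ, 0 ≤ s → 0 ≤ t → S (s + t) = (S s).comp (S t)

/-- `A` is the generator of `S`: for large real `l` the resolvent `(l - A)⁻¹` exists and is the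
Laplace transform of `S` at `l`.  (The usual notion for semigroups which need not be strongly
continuous at `0`; for strongly continuous ones it is the classical infinitesimal generator.) -/
def IsGenerator (S : ℝ → X →L[ℝ] X) (A : X →ₗ.[ℝ] X) : Prop :=
  ∃ w : ℝ, ∀ l : ℝ, w < l →
    (∀ u : X, IntegrableOn (fun t : ℝ => Real.exp (-l * t) • S t u) (Ioi 0)) ∧
    (∀ u : X, ∃ v : A.domain,
      (v : X) = ∫ t in Ioi (0 : ℝ), Real.exp (-l * t) • S t u ∧ l • (v : X) - A v = u) ∧
    (∀ v : A.domain,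
      ∫ t in Ioi (0 : ℝ), Real.exp (-l * t) • S t (l • (v : X) - A v) = v)

variable {E : ℝ → Type*} [∀ l, NormedAddCommGroup (E l)] [∀ l, NormedSpace ℝ (E l)]

/-- `E l`, for `l ∈ [0,2)`, is the intermediate space `X_l`, realized inside `X` by the injective
map `ι l`; nothing is required of the other indices. -/
structure IsSmoothingScale (S : ℝ → X →L[ℝ] X) (A : X →ₗ.[ℝ] X) (ι : ∀ l : ℝ, E l →L[ℝ] X) :
    Prop where
  semigroup : IsSemigroup S
  generator : IsGenerator S A
  injective_ι : ∀ l : ℝ, 0 ≤ l → l < 2 → Function.Injective (ι l)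
  /-- `X_0 = X`, with the same norm. -/
  zero_isometry : ∀ z : E 0, ‖ι 0 z‖ = ‖z‖
  zero_surjective : Function.Surjective (ι 0)
  /-- `X_1 = D(A)`. -/
  one : range (ι 1) = (A.domain : Set X)
  /-- `X_l` is continuously embedded into `X_b` if `b < l`. -/
  embedding : ∀ b l : ℝ, 0 ≤ b → b < l → l < 2 →
    ∃ K : ℝ, 0 < K ∧ ∀ z : E l, NormLE (ι b) (ι l z) (K * ‖z‖)
  /-- `‖S(t)‖_{L(X_z, X_l)} ≤ L t^{-l+z}` for `t ∈ (0,T]`. -/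
  smoothing : ∀ z l T : ℝ, 0 ≤ z → z ≤ l → l < 2 → 0 < T →
    ∃ L : ℝ, 0 < L ∧ ∀ t ∈ Ioc 0 T, ∀ u : E z,
      NormLE (ι l) (S t (ι z u)) (L * t ^ (-l + z) * ‖u‖)
  /-- `‖S(t) - I‖_{L(X_m, X_n)} ≤ C t^{m-n}` for `t ∈ (0,T]`. -/
  approx : ∀ m n T : ℝ, 0 ≤ n → n < m → m ≤ 1 → 0 < T →
    ∃ C : ℝ, 0 < C ∧ ∀ t ∈ Ioc 0 T, ∀ u : E m,
      NormLE (ι n) (S t (ι m u) - ι m u) (C * t ^ (m - n) * ‖u‖)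
  injective_S : ∀ t : ℝ, 0 ≤ t → Function.Injective (S t)

/-! ### Increments and the singular convolution integral -/

/-- `(δ̂₁ f)(s,t) = f(t) - S(t-s) f(s)`. -/
def dhat₁ (S : ℝ → X →L[ℝ] X) (f : ℝ → X) (p : ℝ × ℝ) : X :=
  f p.2 - S (p.2 - p.1) (f p.1)

/-- `(δ̂₂ f)(r,s,t) = f(r,t) - f(s,t) - S(t-s) f(r,s)`. -/
def dhat₂ (S : ℝ → X →L[ℝ] X) (f : ℝ × ℝ → X) (r s t : ℝ) : X :=
  f (r, t) - f (s, t) - S (t - s) (f (r, s))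

/-- `(δ_{S,2} f)(r,s,t) = -f(s,t) + S(s-r) (f(r,t) - f(r,s))`. -/
def dS₂ (S : ℝ → X →L[ℝ] X) (f : ℝ × ℝ → X) (r s t : ℝ) : X :=
  -f (s, t) + S (s - r) (f (r, t) - f (r, s))

/-- The germ `g(s,t) = (x(t) - x(s)) φ(s)`. -/
def germ (x : ℝ → ℝ) (φ : ℝ → X) (p : ℝ × ℝ) : X := (x p.2 - x p.1) • φ p.1

/-- `M` is the function which the sewing map attaches to the germ `g` on `(a,b]²_<`: it lies in
`𝒞^{μ-ε}([a+τ,b]²_<; X_{β+ε})` for all `ε ∈ [0,1)` and `τ ∈ (0,b-a)` (as far as `X_{β+ε}` is in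
the scale), and `(δ̂₂ M)(r,s,t) = S(t-s) (δ_{S,2} g)(r,s,t)`.
For `μ > 1` there is at most one such `M` on `(a,b]²_<`. -/
structure IsSewing (S : ℝ → X →L[ℝ] X) (ι : ∀ l : ℝ, E l →L[ℝ] X) (μ β a b : ℝ)
    (g M : ℝ × ℝ → X) : Prop where
  regular : ∀ ε τ : ℝ, 0 ≤ ε → ε < 1 → β + ε < 2 → 0 < τ → τ < b - a →
    ValuedIn (ι (β + ε)) (closedTri (a + τ) b) (HolderTri (μ - ε) (a + τ) b) M
  dhat : ∀ r s t : ℝ, a < r → r ≤ s → s ≤ t → t ≤ b →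
    dhat₂ S M r s t = S (t - s) (dS₂ S g r s t)

/-- The conditions on `φ : (a,b] → X`, for given parameters, under which its convolution integral
against an `η`-Hölder path is defined. -/
structure Admissible (S : ℝ → X →L[ℝ] X) (ι : ∀ l : ℝ, E l →L[ℝ] X) (η a b α β ρ γ : ℝ)
    (φ : ℝ → X) : Prop where
  alpha_lt : α < 2
  beta_nonneg : 0 ≤ β
  beta_le : β ≤ α
  sub_lt : α - β < 1
  rho_gt : 1 - η < ρ
  rho_lt : ρ < 1
  gamma_nonneg : 0 ≤ γ
  gamma_lt : γ < min η (ρ + η + β - α)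
  mem : ValuedIn (ι α) (Ioc a b) (SingC γ a b) φ
  dhat_mem : ValuedIn (ι β) (openTri a b) (SingHolderTri ρ γ a b) (dhat₁ S φ)

/-- The convolution integral `∫_s^t S(t-r) φ(r) dx(r)` is well defined for `(s,t) ∈ [a,b]²_<` and
equal to `k(s,t)`: `φ` is admissible for some choice of the parameters, one has
`k(s,t) = S(t-s) g(s,t) - M(s,t)` for `a < s ≤ t ≤ b`, where `g(s,t) = (x(t) - x(s)) φ(s)` and `M`
is given by the sewing map, and `k` on `[a,b]²_<` is the continuous extension.
(`k` is unique on `[a,b]²_<`, and does not depend on the parameters.) -/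
def IsConvInt (S : ℝ → X →L[ℝ] X) (ι : ∀ l : ℝ, E l →L[ℝ] X) (η : ℝ) (x : ℝ → ℝ) (a b : ℝ)
    (φ : ℝ → X) (k : ℝ × ℝ → X) : Prop :=
  ∃ α β ρ γ : ℝ, Admissible S ι η a b α β ρ γ φ ∧
    (∃ M : ℝ × ℝ → X, IsSewing S ι (η + ρ) β a b (germ x φ) M ∧
      ∀ p ∈ openTri a b, k p = S (p.2 - p.1) (germ x φ p) - M p) ∧
    ContinuousOn k (closedTri a b)

/-! ### The equation -/

/-- `y : [0,1] → X` is a mild solution of `dy = Ay dt + σ(y) dx`, `y(0) = ψ`: the convolution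
integral of `σ ∘ y` is well defined on `[0,1]²_<` and
`y(t) = S(t)ψ + ∫_0^t S(t-r) σ(y(r)) dx(r)` for all `t ∈ [0,1]`. -/
def IsMildSolution (S : ℝ → X →L[ℝ] X) (ι : ∀ l : ℝ, E l →L[ℝ] X) (η : ℝ) (x : ℝ → ℝ)
    (σ : X → X) (ψ : X) (y : ℝ → X) : Prop :=
  ∃ k : ℝ × ℝ → X, IsConvInt S ι η x 0 1 (σ ∘ y) k ∧
    ∀ t ∈ Icc (0 : ℝ) 1, y t = S t ψ + k (0, t)

/-- The space `Y^α_{-γ}(0,1)`: `f ∈ 𝒞_{-γ}((0,1]; X_α) ∩ C_b((0,1]; X)` and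
`δ̂₁ f ∈ 𝒞^α([0,1]²_<; X_α)`. -/
structure MemY (S : ℝ → X →L[ℝ] X) (ι : ∀ l : ℝ, E l →L[ℝ] X) (α γ : ℝ) (f : ℝ → X) : Prop where
  sing : ValuedIn (ι α) (Ioc 0 1) (SingC γ 0 1) f
  bdd : SingC 0 0 1 f
  dhat : ValuedIn (ι α) (closedTri 0 1) (HolderTri α 0 1) (dhat₁ S f)

/-- `σ'` is the Gâteaux derivative of `σ`, it is bounded, and it is Lipschitz continuous on
bounded sets. -/
structure HasNiceGateauxDeriv (σ : X → X) (σ' : X → X →L[ℝ] X) : Prop where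
  deriv : ∀ u h : X, HasLineDerivAt ℝ σ (σ' u h) u h
  bounded : ∃ C : ℝ, ∀ u : X, ‖σ' u‖ ≤ C
  lipschitz : ∀ R : ℝ, 0 < R → ∃ C : ℝ, ∀ u v : X, ‖u‖ ≤ R → ‖v‖ ≤ R → ‖σ' u - σ' v‖ ≤ C * ‖u - v‖

/-- `σ` maps the subspace `F` of `X` (embedded by `j`) into itself and is Lipschitz continuous
there for the norm of `F`. -/
def LipschitzOnSubspace {F : Type*} [NormedAddCommGroup F] [NormedSpace ℝ F] (j : F →L[ℝ] X)
    (σ : X → X) : Prop :=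
  ∃ τ : F → F, (∀ z : F, j (τ z) = σ (j z)) ∧ ∃ C : ℝ, ∀ u v : F, ‖τ u - τ v‖ ≤ C * ‖u - v‖

end

end YoungEvolution

open YoungEvolution

set_option linter.unusedSectionVars false
namespace YoungEvolution

/-! ### Membership with a norm bound -/

section NormLE

variable {X : Type*} [NormedAddCommGroup X] [NormedSpace ℝ X]
  {F : Type*} [NormedAddCommGroup F] [NormedSpace ℝ F] {j : F →L[ℝ] X} {u v : X} {c d : ℝ}

/-! Fix the final time T. The convolution integral up to T is the Young integral of r ↦ S(T-r)φ(r):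
the germ (x(u)-x(r))S(T-r)φ(r) has the additivity defect (x(t)-x(u))S(T-u)(φ(u)-S(u-s)φ(s)), in
which only the mild increment of φ appears. If mild increments are α-Hölder, η+α>1 makes the dyadic
sums converge. Endpoint singularities are handled by bounding the defect by (t-s)^κ(P(t)-P(s)) with
κ=η+α-1 and P increasing: each halving gains 2^(-κ), while the increments of P telescope. A multiple
of (t-a)^(1-α) as P absorbs a blow-up of φ at the initial time a (`exists_convGerm_le`), and a
multiple of -(T-t)^(1-l) absorbs the smoothing singularity of S(T-t) into X_l, l<1
(`exists_convInt_sub_germ_normLE`).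

The equation is solved in `SolClass`, the class natural for data merely in X, so θ plays no role
there and only α<η matters (a consequence of 2α-θ<η and θ≤α). For the weight e^(t/δ) the convolution
integral has norm O(δ^(η-α)) on this class (`exists_solClass_convInt`). Linear growth of σ gives a
ball that is mapped into itself. On that ball σ is Lipschitz for the class by a four-point estimate,
which needs σ' Lipschitz on bounded sets; small δ then gives a contraction.

The dependence on θ is recovered afterwards (`exists_regular`). The solution has size t^(-(α-θ)) in
X_α. Put back into the equation, this gives the integral over [s,t] the order (t-s)^(η-α+θ) in X_α
when t≤2s, and summing over halvings that accumulate at s removes the restriction. Since η>2α-θ,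
this exponent exceeds α.

For uniqueness (`exists_solClass_of_isMildSolution`), the sewing map alone shows that any mild
solution lies in the class on [τ,1] for each τ>0, with constants depending on τ. The equation
restarted at τ, together with linear growth, improves these to constants uniform in τ. Letting τ→0
puts the solution in the class on [0,1], where fixed points are unique. -/

theorem NormLE.nonneg (h : NormLE j u c) : 0 ≤ c := by
  obtain ⟨z, -, hz⟩ := h
  exact (norm_nonneg z).trans hz

theorem NormLE.mono (h : NormLE j u c) (hcd : c ≤ d) : NormLE j u d := by
  obtain ⟨z, hz, hc⟩ := h
  exact ⟨z, hz, hc.trans hcd⟩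

theorem NormLE.mem (h : NormLE j u c) : u ∈ range j := by
  obtain ⟨z, hz, -⟩ := h
  exact ⟨z, hz⟩

theorem NormLE.add (hu : NormLE j u c) (hv : NormLE j v d) : NormLE j (u + v) (c + d) := by
  obtain ⟨z, rfl, hz⟩ := hu
  obtain ⟨w, rfl, hw⟩ := hv
  exact ⟨z + w, by simp, (norm_add_le z w).trans (add_le_add hz hw)⟩

theorem NormLE.sub (hu : NormLE j u c) (hv : NormLE j v d) : NormLE j (u - v) (c + d) := by
  obtain ⟨z, rfl, hz⟩ := hu
  obtain ⟨w, rfl, hw⟩ := hv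
  exact ⟨z - w, by simp, (norm_sub_le z w).trans (add_le_add hz hw)⟩

theorem NormLE.neg (hu : NormLE j u c) : NormLE j (-u) c := by
  obtain ⟨z, rfl, hz⟩ := hu
  exact ⟨-z, by simp, by simpa using hz⟩

theorem NormLE.smul (hu : NormLE j u c) (r : ℝ) : NormLE j (r • u) (|r| * c) := by
  obtain ⟨z, rfl, hz⟩ := hu
  refine ⟨r • z, by simp, ?_⟩
  rw [norm_smul, Real.norm_eq_abs]
  gcongr

theorem NormLE.zero (hc : 0 ≤ c) : NormLE j (0 : X) c := ⟨0, by simp, by simpa using hc⟩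

theorem NormLE.of_mem (h : u ∈ range j) : ∃ c, NormLE j u c := by
  obtain ⟨z, hz⟩ := h
  exact ⟨‖z‖, z, hz, le_rfl⟩

theorem normLE_id : NormLE (ContinuousLinearMap.id ℝ X) u c ↔ ‖u‖ ≤ c := by
  constructor
  · rintro ⟨z, rfl, hz⟩
    exact hz
  · exact fun h => ⟨u, rfl, h⟩

theorem NormLE.norm_le (h : NormLE j u c) : ‖u‖ ≤ ‖j‖ * c := by
  obtain ⟨z, rfl, hz⟩ := h
  exact (j.le_opNorm z).trans (by gcongr)

/-- Injectivity of j fixes the preimage, so a single vector satisfies all the bounds and hence their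
limit. -/
theorem NormLE.of_tendsto (hj : Function.Injective j) {ι : Type*} {l : Filter ι} [l.NeBot]
    {f : ι → ℝ} (hf : Filter.Tendsto f l (nhds c)) (h : ∀ᶠ i in l, NormLE j u (f i)) :
    NormLE j u c := by
  obtain ⟨i, hi⟩ := h.exists
  obtain ⟨z, hz, -⟩ := hi
  refine ⟨z, hz, ge_of_tendsto hf ?_⟩
  filter_upwards [h] with i hi
  obtain ⟨w, hw, hwc⟩ := hi
  rwa [← hj (hw.trans hz.symm)]

/-- The preimages form an absolutely convergent series in the complete space F, and j is continuous.
This is how sewing bounds in X are upgraded to bounds in X_l. -/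
theorem NormLE.tsum [CompleteSpace F] {u : ℕ → X} {c : ℕ → ℝ} (h : ∀ n, NormLE j (u n) (c n))
    (hc : Summable c) : Summable u ∧ NormLE j (∑' n, u n) (∑' n, c n) := by
  choose z hz hzc using h
  have hs : Summable z := Summable.of_norm_bounded hc hzc
  have hsum := (j.hasSum hs.hasSum)
  have e : (fun n => j (z n)) = u := funext hz
  have hsum' : HasSum u (j (∑' n, z n)) := by
    rw [← e]; exact hsum
  exact ⟨hsum'.summable, _, hsum'.tsum_eq.symm, tsum_of_norm_bounded hc.hasSum hzc⟩

/-- The inverse of an injection, extended by an arbitrary value outside the range. -/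
noncomputable def lift (j : F →L[ℝ] X) : X → F := Function.invFun j

theorem apply_lift (h : u ∈ range j) : j (lift j u) = u := Function.invFun_eq h

theorem norm_lift_le (hj : Function.Injective j) (h : NormLE j u c) : ‖lift j u‖ ≤ c := by
  obtain ⟨z, rfl, hz⟩ := h
  rwa [lift, Function.leftInverse_invFun hj z]

theorem norm_lift_sub_le (hj : Function.Injective j) (hu : u ∈ range j) (hv : v ∈ range j)
    (h : NormLE j (u - v) c) : ‖lift j u - lift j v‖ ≤ c := by
  obtain ⟨z, rfl⟩ := hu
  obtain ⟨w, rfl⟩ := hv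
  obtain ⟨y, hy, hyc⟩ := h
  rw [lift, Function.leftInverse_invFun hj z, Function.leftInverse_invFun hj w]
  rw [← map_sub] at hy
  rwa [← hj hy]

end NormLE

/-! ### Real powers -/

/-- Concavity of the power, in the form of Bernoulli's inequality at s/t. It dominates a singular
factor t^(p-1)(t-s) by an increment of an increasing function, which can be summed over partitions.
-/
theorem rpow_sub_rpow_ge {p s t : ℝ} (hp : 0 < p) (hp1 : p ≤ 1) (hs : 0 ≤ s)
    (ht : 0 < t) : p * (t - s) * t ^ (p - 1) ≤ t ^ p - s ^ p := by
  have h := rpow_one_add_le_one_add_mul_self (s := (s - t) / t)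
    (by rw [le_div_iff₀ ht]; linarith) hp.le hp1
  have e : 1 + (s - t) / t = s / t := by field_simp; ring
  rw [e, Real.div_rpow hs ht.le, div_le_iff₀ (by positivity)] at h
  have e2 : t ^ (p - 1) = t ^ p / t := Real.rpow_sub_one ht.ne' p
  rw [e2]
  have e3 : (1 + p * ((s - t) / t)) * t ^ p = t ^ p - p * (t - s) * (t ^ p / t) := by
    field_simp; ring
  rw [e3] at h
  linarith

theorem rpow_sub_rpow_le {p s t : ℝ} (hp : 0 ≤ p) (hp1 : p ≤ 1) (hs : 0 ≤ s) (hst : s ≤ t) :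
    t ^ p - s ^ p ≤ (t - s) ^ p := by
  have h := Real.rpow_add_le_add_rpow hs (sub_nonneg.2 hst) hp hp1
  rw [add_sub_cancel] at h
  linarith

theorem rpow_le_one_of_mem {p t : ℝ} (hp : 0 ≤ p) (ht : 0 ≤ t) (ht1 : t ≤ 1) : t ^ p ≤ 1 :=
  Real.rpow_le_one ht ht1 hp

theorem one_le_rpow_neg {p t : ℝ} (hp : 0 ≤ p) (ht : 0 < t) (ht1 : t ≤ 1) : 1 ≤ t ^ (-p) :=
  Real.one_le_rpow_of_pos_of_le_one_of_nonpos ht ht1 (by linarith)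

theorem rpow_anti {p q t : ℝ} (ht : 0 < t) (ht1 : t ≤ 1) (h : q ≤ p) : t ^ p ≤ t ^ q :=
  Real.rpow_le_rpow_of_exponent_ge ht ht1 h

theorem half_rpow_neg_le {p t : ℝ} (hp2 : p ≤ 1) (ht : 0 < t) :
    (t / 2) ^ (-p) ≤ 2 * t ^ (-p) := by
  rw [Real.div_rpow ht.le (by norm_num), Real.rpow_neg (by norm_num : (0:ℝ) ≤ 2), div_inv_eq_mul,
    mul_comm]
  have : (2:ℝ) ^ p ≤ 2 ^ (1:ℝ) := Real.rpow_le_rpow_of_exponent_le (by norm_num) hp2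
  rw [Real.rpow_one] at this
  gcongr

/-! ### Sewing along dyadic partitions -/

section Sewing

open Filter Topology

variable {X : Type*} [NormedAddCommGroup X] [NormedSpace ℝ X]
  {F : Type*} [NormedAddCommGroup F] [NormedSpace ℝ F]

/-- The sum of the germ `G` over the partition of `[s,t]` into `2 ^ n` equal intervals. -/
noncomputable def dyadicSum (G : ℝ → ℝ → X) : ℕ → ℝ → ℝ → X
  | 0, s, t => G s t
  | n + 1, s, t => dyadicSum G n s ((s + t) / 2) + dyadicSum G n ((s + t) / 2) t

/-- The limit of the dyadic sums. -/
noncomputable def sew (G : ℝ → ℝ → X) (s t : ℝ) : X :=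
  G s t + ∑' n, (dyadicSum G (n + 1) s t - dyadicSum G n s t)

/-- Both halves of an interval carry the factor 2^(-κ) from the length, and their increments of P
add up to that of the whole. Neither monotonicity nor regularity of P is needed. -/
theorem dyadicSum_diff {j : F →L[ℝ] X} {G : ℝ → ℝ → X} {P : ℝ → ℝ} {κ a b : ℝ}
    (hG : ∀ s t, a ≤ s → s ≤ t → t ≤ b →
      NormLE j (G s ((s + t) / 2) + G ((s + t) / 2) t - G s t) ((t - s) ^ κ * (P t - P s)))
    (n : ℕ) {s t : ℝ} (hs : a ≤ s) (hst : s ≤ t) (ht : t ≤ b) :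
    NormLE j (dyadicSum G (n + 1) s t - dyadicSum G n s t)
      (((1 / 2 : ℝ) ^ κ) ^ n * ((t - s) ^ κ * (P t - P s))) := by
  induction n generalizing s t with
  | zero => simpa [dyadicSum] using hG s t hs hst ht
  | succ n ih =>
    have h1 := ih (s := s) (t := (s + t) / 2) hs (by linarith) (by linarith)
    have h2 := ih (s := (s + t) / 2) (t := t) (by linarith) (by linarith) ht
    have e1 : ((s + t) / 2 - s) ^ κ = (1 / 2 : ℝ) ^ κ * (t - s) ^ κ := by
      rw [← Real.mul_rpow (by norm_num) (by linarith)]; congr 1; ring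
    have e2 : (t - (s + t) / 2) ^ κ = (1 / 2 : ℝ) ^ κ * (t - s) ^ κ := by
      rw [← Real.mul_rpow (by norm_num) (by linarith)]; congr 1; ring
    rw [e1] at h1
    rw [e2] at h2
    have h := h1.add h2
    convert h using 1
    · change (dyadicSum G (n + 1) s _ + dyadicSum G (n + 1) _ t) -
        (dyadicSum G n s _ + dyadicSum G n _ t) = _
      abel
    · ring

theorem half_rpow_lt_one {κ : ℝ} (hκ : 0 < κ) : (1 / 2 : ℝ) ^ κ < 1 :=
  Real.rpow_lt_one (by norm_num) (by norm_num) hκ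

theorem sew_sub_germ [CompleteSpace F] {j : F →L[ℝ] X} {G : ℝ → ℝ → X} {P : ℝ → ℝ} {κ a b : ℝ}
    (hκ : 0 < κ)
    (hG : ∀ s t, a ≤ s → s ≤ t → t ≤ b →
      NormLE j (G s ((s + t) / 2) + G ((s + t) / 2) t - G s t) ((t - s) ^ κ * (P t - P s)))
    {s t : ℝ} (hs : a ≤ s) (hst : s ≤ t) (ht : t ≤ b) :
    Tendsto (fun n => dyadicSum G n s t) atTop (𝓝 (sew G s t)) ∧
      NormLE j (sew G s t - G s t)
        ((1 - (1 / 2 : ℝ) ^ κ)⁻¹ * ((t - s) ^ κ * (P t - P s))) := by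
  have hg := summable_geometric_of_lt_one (by positivity) (half_rpow_lt_one hκ)
  have h := NormLE.tsum (fun n => dyadicSum_diff hG n hs hst ht) (hg.mul_right _)
  rw [tsum_mul_right, tsum_geometric_of_lt_one (by positivity) (half_rpow_lt_one hκ)] at h
  refine ⟨?_, by simpa [sew] using h.2⟩
  have h1 := h.1.hasSum.tendsto_sum_nat
  simp_rw [Finset.sum_range_sub (fun n => dyadicSum G n s t)] at h1
  have h2 := h1.const_add (G s t)
  simpa [dyadicSum, sew] using h2

theorem dyadicSum_map {G G' : ℝ → ℝ → X} {T : X →L[ℝ] X} {a b : ℝ}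
    (h : ∀ s t, a ≤ s → s ≤ t → t ≤ b → G' s t = T (G s t)) (n : ℕ) {s t : ℝ} (hs : a ≤ s)
    (hst : s ≤ t) (ht : t ≤ b) : dyadicSum G' n s t = T (dyadicSum G n s t) := by
  induction n generalizing s t with
  | zero => exact h s t hs hst ht
  | succ n ih =>
    rw [dyadicSum, dyadicSum, map_add, ih hs (by linarith) (by linarith),
      ih (by linarith) (by linarith) ht]

theorem dyadicSum_sub (G G' : ℝ → ℝ → X) (n : ℕ) (s t : ℝ) :
    dyadicSum (fun r u => G r u - G' r u) n s t = dyadicSum G n s t - dyadicSum G' n s t := by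
  induction n generalizing s t with
  | zero => rfl
  | succ n ih => rw [dyadicSum, dyadicSum, dyadicSum, ih, ih]; abel

/-- Level n+1 on an interval is the sum of the levels n on its halves; pass to the limit. -/
theorem sew_midpoint [CompleteSpace X] {G : ℝ → ℝ → X} {P : ℝ → ℝ} {κ a b : ℝ} (hκ : 0 < κ)
    (hG : ∀ s t, a ≤ s → s ≤ t → t ≤ b →
      ‖G s ((s + t) / 2) + G ((s + t) / 2) t - G s t‖ ≤ (t - s) ^ κ * (P t - P s))
    {s t : ℝ} (hs : a ≤ s) (hst : s ≤ t) (ht : t ≤ b) :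
    sew G s t = sew G s ((s + t) / 2) + sew G ((s + t) / 2) t := by
  simp_rw [← normLE_id] at hG
  have h0 := (sew_sub_germ hκ hG hs hst ht).1
  have h1 := (sew_sub_germ hκ hG hs (by linarith : s ≤ (s + t) / 2) (by linarith)).1
  have h2 := (sew_sub_germ hκ hG (by linarith) (by linarith : (s + t) / 2 ≤ t) ht).1
  have h3 := (tendsto_add_atTop_iff_nat 1).2 h0
  exact tendsto_nhds_unique h3 (h1.add h2)

/-- Splitting n times improves the bound by 2^(-nκ), because the increments of P telescope. This is
the uniqueness principle of sewing. -/
theorem eq_zero_of_midpoint {D : ℝ → ℝ → X} {P : ℝ → ℝ} {κ a b : ℝ} (hκ : 0 < κ)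
    (hD : ∀ s t, a ≤ s → s ≤ t → t ≤ b → D s t = D s ((s + t) / 2) + D ((s + t) / 2) t)
    (hP : ∀ s t, a ≤ s → s ≤ t → t ≤ b → ‖D s t‖ ≤ (t - s) ^ κ * (P t - P s))
    {s t : ℝ} (hs : a ≤ s) (hst : s ≤ t) (ht : t ≤ b) : D s t = 0 := by
  have key : ∀ (n : ℕ) (s t : ℝ), a ≤ s → s ≤ t → t ≤ b →
      ‖D s t‖ ≤ ((1 / 2 : ℝ) ^ κ) ^ n * ((t - s) ^ κ * (P t - P s)) := by
    intro n
    induction n with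
    | zero => intro s t hs hst ht; simpa using hP s t hs hst ht
    | succ n ih =>
      intro s t hs hst ht
      have h1 := ih s ((s + t) / 2) hs (by linarith) (by linarith)
      have h2 := ih ((s + t) / 2) t (by linarith) (by linarith) ht
      have e1 : ((s + t) / 2 - s) ^ κ = (1 / 2 : ℝ) ^ κ * (t - s) ^ κ := by
        rw [← Real.mul_rpow (by norm_num) (by linarith)]; congr 1; ring
      have e2 : (t - (s + t) / 2) ^ κ = (1 / 2 : ℝ) ^ κ * (t - s) ^ κ := by
        rw [← Real.mul_rpow (by norm_num) (by linarith)]; congr 1; ring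
      rw [e1] at h1
      rw [e2] at h2
      rw [hD s t hs hst ht]
      refine (norm_add_le _ _).trans ((add_le_add h1 h2).trans (le_of_eq ?_))
      ring
  have hlim : Tendsto (fun n : ℕ => ((1 / 2 : ℝ) ^ κ) ^ n * ((t - s) ^ κ * (P t - P s))) atTop
      (𝓝 0) := by
    simpa using (tendsto_pow_atTop_nhds_zero_of_lt_one (by positivity)
      (half_rpow_lt_one hκ)).mul_const ((t - s) ^ κ * (P t - P s))
  exact norm_le_zero_iff.1 (ge_of_tendsto' hlim fun n => key n s t hs hst ht)

/-! ### Additivity of the sewn function: from midpoints to rational ratios, then to all points by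
continuity. -/

theorem sum_range_two_mul (g : ℕ → X) (k : ℕ) :
    ∑ i ∈ Finset.range (2 * k), g i = ∑ i ∈ Finset.range k, (g (2 * i) + g (2 * i + 1)) := by
  induction k with
  | zero => simp
  | succ k ih =>
    rw [Finset.sum_range_succ, ← ih, show 2 * (k + 1) = 2 * k + 1 + 1 by ring,
      Finset.sum_range_succ, Finset.sum_range_succ, add_assoc]

/-- The sum of `H` over the partition of `[s,t]` into `k` equal intervals. -/
noncomputable def equiSum (H : ℝ → ℝ → X) (k : ℕ) (s t : ℝ) : X :=
  ∑ i ∈ Finset.range k, H (s + i * ((t - s) / k)) (s + (i + 1 : ℕ) * ((t - s) / k))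

/-- The partition into 2k equal intervals can be grouped into consecutive pairs, or into a first and
a second half. -/
theorem equiSum_midpoint {H : ℝ → ℝ → X} {a b : ℝ}
    (hH : ∀ s t, a ≤ s → s ≤ t → t ≤ b → H s t = H s ((s + t) / 2) + H ((s + t) / 2) t)
    {k : ℕ} (hk : 0 < k) {s t : ℝ} (hs : a ≤ s) (hst : s ≤ t) (ht : t ≤ b) :
    equiSum H k s t = equiSum H k s ((s + t) / 2) + equiSum H k ((s + t) / 2) t := by
  have hk' : (0 : ℝ) < k := by exact_mod_cast hk
  set g : ℕ → X := fun i => H (s + i * ((t - s) / (2 * k))) (s + (i + 1 : ℕ) * ((t - s) / (2 * k)))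
    with hg
  have e1 : equiSum H k s ((s + t) / 2) = ∑ i ∈ Finset.range k, g i := by
    refine Finset.sum_congr rfl fun i _ => ?_
    simp only [hg]
    congr 1 <;> (field_simp; ring)
  have e2 : equiSum H k ((s + t) / 2) t = ∑ i ∈ Finset.range k, g (k + i) := by
    refine Finset.sum_congr rfl fun i _ => ?_
    simp only [hg]
    push_cast
    congr 1 <;> (field_simp; ring)
  rw [e1, e2, ← Finset.sum_range_add, ← two_mul, sum_range_two_mul]
  refine Finset.sum_congr rfl fun i hi => ?_
  have hi' : (i : ℝ) + 1 ≤ k := by exact_mod_cast Finset.mem_range.1 hi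
  have hd : 0 ≤ (t - s) / k := div_nonneg (by linarith) hk'.le
  have hdk : (t - s) / k * k = t - s := by field_simp
  have h0 : (0 : ℝ) ≤ i := by positivity
  have := hH (s + i * ((t - s) / k)) (s + (i + 1 : ℕ) * ((t - s) / k)) (by nlinarith)
    (by push_cast; nlinarith) (by push_cast; nlinarith)
  rw [this]
  simp only [hg]
  push_cast
  congr 2 <;> (field_simp <;> ring)

/-- The partition points are added one at a time, each at the cost of one defect. The linear growth
in k is harmless, since k stays fixed when this is used. -/
theorem norm_equiSum_sub {G : ℝ → ℝ → X} {P : ℝ → ℝ} {κ a b : ℝ} (hκ : 0 ≤ κ)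
    (hP : MonotoneOn P (Icc a b))
    (hG : ∀ s u t, a ≤ s → s ≤ u → u ≤ t → t ≤ b →
      ‖G s u + G u t - G s t‖ ≤ (t - s) ^ κ * (P t - P s))
    {k : ℕ} (hk : 0 < k) {s t : ℝ} (hs : a ≤ s) (hst : s ≤ t) (ht : t ≤ b) :
    ‖equiSum G k s t - G s t‖ ≤ (k + 1) * ((t - s) ^ κ * (P t - P s)) := by
  have hk' : (0 : ℝ) < k := by exact_mod_cast hk
  have hd : 0 ≤ (t - s) / k := div_nonneg (by linarith) hk'.le
  have hdk : k * ((t - s) / k) = t - s := by field_simp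
  have key : ∀ j : ℕ, j ≤ k → ‖∑ i ∈ Finset.range j, G (s + i * ((t - s) / k))
      (s + (i + 1 : ℕ) * ((t - s) / k)) - G s (s + j * ((t - s) / k))‖ ≤
      (j + 1) * ((t - s) ^ κ * (P t - P s)) := by
    intro j
    induction j with
    | zero =>
      intro _
      have h := hG s s s hs le_rfl le_rfl (hst.trans ht)
      have h2 : (0 : ℝ) ≤ (t - s) ^ κ * (P t - P s) :=
        (norm_nonneg _).trans (hG s s t hs le_rfl hst ht)
      simp only [add_sub_cancel_right, sub_self, mul_zero] at h
      simpa using h.trans h2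
    | succ j ih =>
      intro hj
      have hjk : ((j + 1 : ℕ) : ℝ) ≤ k := by exact_mod_cast hj
      have h0 : (0 : ℝ) ≤ j := by positivity
      have hle : s + (j + 1 : ℕ) * ((t - s) / k) ≤ t := by nlinarith
      have hle2 : s ≤ s + j * ((t - s) / k) := by nlinarith
      have hle3 : s + j * ((t - s) / k) ≤ s + (j + 1 : ℕ) * ((t - s) / k) := by
        push_cast; nlinarith
      have h1 := ih (by omega)
      have h2 := hG s (s + j * ((t - s) / k)) (s + (j + 1 : ℕ) * ((t - s) / k)) hs hle2 hle3
        (hle.trans ht)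
      have h3 : (s + (j + 1 : ℕ) * ((t - s) / k) - s) ^ κ *
          (P (s + (j + 1 : ℕ) * ((t - s) / k)) - P s) ≤ (t - s) ^ κ * (P t - P s) := by
        have m1 : s + (j + 1 : ℕ) * ((t - s) / k) ∈ Icc a b :=
          ⟨hs.trans (hle2.trans hle3), hle.trans ht⟩
        have p1 := hP ⟨hs, hst.trans ht⟩ m1 (hle2.trans hle3)
        have p2 := hP m1 ⟨hs.trans hst, ht⟩ hle
        refine mul_le_mul ?_ (by linarith) (by linarith) (Real.rpow_nonneg (by linarith) _)
        exact Real.rpow_le_rpow (by linarith) (by linarith) hκ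
      rw [Finset.sum_range_succ]
      have e : ∀ A B C D : X, A + B - D = (A - C) + (C + B - D) := by intros; abel
      rw [e _ _ (G s (s + j * ((t - s) / k)))]
      refine (norm_add_le _ _).trans ((add_le_add h1 (h2.trans h3)).trans (le_of_eq ?_))
      push_cast
      ring
  have h := key k le_rfl
  rwa [hdk, add_sub_cancel] at h

/-- The difference of the two sides is midpoint additive and of the order (t-s)^κ(P(t)-P(s)), so it
vanishes by uniqueness. -/
theorem equiSum_sew [CompleteSpace X] {G : ℝ → ℝ → X} {P : ℝ → ℝ} {κ a b : ℝ} (hκ : 0 < κ)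
    (hP : MonotoneOn P (Icc a b))
    (hG : ∀ s u t, a ≤ s → s ≤ u → u ≤ t → t ≤ b →
      ‖G s u + G u t - G s t‖ ≤ (t - s) ^ κ * (P t - P s))
    {k : ℕ} (hk : 0 < k) {s t : ℝ} (hs : a ≤ s) (hst : s ≤ t) (ht : t ≤ b) :
    equiSum (sew G) k s t = sew G s t := by
  have hk' : (0 : ℝ) < k := by exact_mod_cast hk
  have hGm : ∀ s t, a ≤ s → s ≤ t → t ≤ b →
      ‖G s ((s + t) / 2) + G ((s + t) / 2) t - G s t‖ ≤ (t - s) ^ κ * (P t - P s) :=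
    fun s t hs hst ht => hG s _ t hs (by linarith) (by linarith) ht
  have hmid := fun s t (hs : a ≤ s) (hst : s ≤ t) (ht : t ≤ b) => sew_midpoint hκ hGm hs hst ht
  have hGid := hGm
  simp_rw [← normLE_id] at hGid
  set c := (1 - (1 / 2 : ℝ) ^ κ)⁻¹ with hc
  have hc0 : 0 ≤ c := inv_nonneg.2 (sub_nonneg.2 (half_rpow_lt_one hκ).le)
  have hbd : ∀ s t, a ≤ s → s ≤ t → t ≤ b →
      ‖sew G s t - G s t‖ ≤ c * ((t - s) ^ κ * (P t - P s)) :=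
    fun s t hs hst ht => normLE_id.1 (sew_sub_germ hκ hGid hs hst ht).2
  -- The three parts of the constant: k pieces at c each for sewn function against germ, k+1 for
  -- germ sum against germ, and c for the whole interval.
  have h := eq_zero_of_midpoint (D := fun s t => equiSum (sew G) k s t - sew G s t)
    (P := fun t => (k * c + (k + 1) + c) * P t) (a := a) (b := b) hκ ?_ ?_ hs hst ht
  · exact sub_eq_zero.1 h
  · intro s t hs hst ht
    rw [equiSum_midpoint hmid hk hs hst ht, hmid s t hs hst ht]
    abel
  · intro s t hs hst ht
    have hd : 0 ≤ (t - s) / k := div_nonneg (by linarith) hk'.le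
    have hdk : k * ((t - s) / k) = t - s := by field_simp
    set W := (t - s) ^ κ * (P t - P s) with hW
    have h1 : ‖equiSum (sew G) k s t - equiSum G k s t‖ ≤ k * (c * W) := by
      rw [equiSum, equiSum, ← Finset.sum_sub_distrib]
      refine (norm_sum_le _ _).trans ?_
      have : ∀ i ∈ Finset.range k, ‖sew G (s + i * ((t - s) / k)) (s + (i + 1 : ℕ) * ((t - s) / k))
          - G (s + i * ((t - s) / k)) (s + (i + 1 : ℕ) * ((t - s) / k))‖ ≤ c * W := by
        intro i hi
        have hi' : ((i + 1 : ℕ) : ℝ) ≤ k := by exact_mod_cast Finset.mem_range.1 hi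
        have h0 : (0 : ℝ) ≤ i := by positivity
        have l1 : s ≤ s + i * ((t - s) / k) := by nlinarith
        have l2 : s + i * ((t - s) / k) ≤ s + (i + 1 : ℕ) * ((t - s) / k) := by
          push_cast; nlinarith
        have l3 : s + (i + 1 : ℕ) * ((t - s) / k) ≤ t := by nlinarith
        refine (hbd _ _ (hs.trans l1) l2 (l3.trans ht)).trans ?_
        have m1 : s + i * ((t - s) / k) ∈ Icc a b := ⟨hs.trans l1, l2.trans (l3.trans ht)⟩
        have m2 : s + (i + 1 : ℕ) * ((t - s) / k) ∈ Icc a b := ⟨hs.trans (l1.trans l2), l3.trans ht⟩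
        have p1 := hP ⟨hs, hst.trans ht⟩ m1 l1
        have p2 := hP m2 ⟨hs.trans hst, ht⟩ l3
        have p3 := hP m1 m2 l2
        refine mul_le_mul_of_nonneg_left ?_ hc0
        refine mul_le_mul ?_ (by linarith) (by linarith) (Real.rpow_nonneg (by linarith) _)
        exact Real.rpow_le_rpow (by linarith) (by linarith) hκ.le
      refine (Finset.sum_le_sum this).trans (le_of_eq ?_)
      simp
    have h2 := norm_equiSum_sub hκ.le hP hG hk hs hst ht
    have h3 := hbd s t hs hst ht
    have e : equiSum (sew G) k s t - sew G s t = (equiSum (sew G) k s t - equiSum G k s t) +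
        (equiSum G k s t - G s t) - (sew G s t - G s t) := by abel
    rw [e]
    refine (norm_sub_le _ _).trans ((add_le_add ((norm_add_le _ _).trans (add_le_add h1 h2))
      h3).trans (le_of_eq ?_))
    rw [hW]; ring

theorem sew_add_of_rat [CompleteSpace X] {G : ℝ → ℝ → X} {P : ℝ → ℝ} {κ a b : ℝ} (hκ : 0 < κ)
    (hP : MonotoneOn P (Icc a b))
    (hG : ∀ s u t, a ≤ s → s ≤ u → u ≤ t → t ≤ b →
      ‖G s u + G u t - G s t‖ ≤ (t - s) ^ κ * (P t - P s))
    {i k : ℕ} (hi : 0 < i) (hik : i < k) {s t : ℝ} (hs : a ≤ s) (hst : s ≤ t) (ht : t ≤ b) :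
    sew G s t = sew G s (s + i * ((t - s) / k)) + sew G (s + i * ((t - s) / k)) t := by
  obtain ⟨m, rfl⟩ := Nat.exists_eq_add_of_lt hik
  have hk' : (0 : ℝ) < (i + m + 1 : ℕ) := by positivity
  have hi' : (0 : ℝ) < i := by positivity
  set d := (t - s) / (i + m + 1 : ℕ) with hd
  have hd0 : 0 ≤ d := div_nonneg (by linarith) hk'.le
  have hdk : ((i + m + 1 : ℕ) : ℝ) * d = t - s := by rw [hd]; field_simp
  push_cast at hdk
  have hm : (0 : ℝ) ≤ m := by positivity
  have hle : s ≤ s + i * d := by nlinarith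
  have hle2 : s + i * d ≤ t := by nlinarith
  rw [← equiSum_sew hκ hP hG (k := i + m + 1) (by omega) hs hst ht,
    ← equiSum_sew hκ hP hG hi hs hle (hle2.trans ht),
    ← equiSum_sew hκ hP hG (k := m + 1) (by omega) (hs.trans hle) hle2 ht]
  have e : (t - (s + i * d)) / (m + 1 : ℕ) = d := by
    rw [div_eq_iff (by positivity)]; push_cast; linarith
  have e2 : (s + i * d - s) / (i : ℝ) = d := by field_simp; ring
  rw [equiSum, equiSum, equiSum, e, e2, ← hd, add_assoc, Finset.sum_range_add]
  congr 1
  refine Finset.sum_congr rfl fun l _ => ?_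
  push_cast
  congr 1 <;> ring

theorem continuousOn_dyadicSum {G : ℝ → ℝ → X} {a b : ℝ}
    (hc : ContinuousOn (fun p : ℝ × ℝ => G p.1 p.2) (openTri a b)) (n : ℕ) :
    ContinuousOn (fun p : ℝ × ℝ => dyadicSum G n p.1 p.2) (openTri a b) := by
  induction n with
  | zero => exact hc
  | succ n ih =>
    refine ContinuousOn.add
      (ih.comp (f := fun p : ℝ × ℝ => (p.1, (p.1 + p.2) / 2)) (by fun_prop) ?_)
      (ih.comp (f := fun p : ℝ × ℝ => ((p.1 + p.2) / 2, p.2)) (by fun_prop) ?_)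
    · rintro p ⟨h1, h2, h3⟩
      exact ⟨h1, by dsimp only; linarith, by dsimp only; linarith⟩
    · rintro p ⟨h1, h2, h3⟩
      exact ⟨by dsimp only; linarith, by dsimp only; linarith, h3⟩

theorem continuousOn_dyadicSum_left {G : ℝ → ℝ → X} {a b : ℝ}
    (hc : ContinuousOn (fun p : ℝ × ℝ => G p.1 p.2) (openTri a b))
    (hca : ContinuousOn (G a) (Ioc a b)) (n : ℕ) :
    ContinuousOn (fun t => dyadicSum G n a t) (Ioc a b) := by
  induction n with
  | zero => exact hca
  | succ n ih =>
    refine ContinuousOn.add (ih.comp (f := fun t : ℝ => (a + t) / 2) (by fun_prop) ?_)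
      ((continuousOn_dyadicSum hc n).comp (f := fun t : ℝ => ((a + t) / 2, t)) (by fun_prop) ?_)
    · rintro t ⟨h1, h2⟩
      exact ⟨by linarith, by linarith⟩
    · rintro t ⟨h1, h2⟩
      exact ⟨by dsimp only; linarith, by dsimp only; linarith, h2⟩

/-- The correction series is dominated by a geometric one, uniformly up to the left end. Germs with
left endpoint a are treated separately, because the integrand need not be continuous there. -/
theorem continuousOn_sew {G : ℝ → ℝ → X} {P : ℝ → ℝ} {κ a b : ℝ} [CompleteSpace X] (hκ : 0 < κ)
    (hP : MonotoneOn P (Icc a b))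
    (hG : ∀ s u t, a ≤ s → s ≤ u → u ≤ t → t ≤ b →
      ‖G s u + G u t - G s t‖ ≤ (t - s) ^ κ * (P t - P s))
    (hc : ContinuousOn (fun p : ℝ × ℝ => G p.1 p.2) (openTri a b))
    (hca : ContinuousOn (G a) (Ioc a b)) :
    ContinuousOn (fun p : ℝ × ℝ => sew G p.1 p.2) (openTri a b) ∧
      ContinuousOn (fun t => sew G a t) (Ioc a b) := by
  have hGm : ∀ s t, a ≤ s → s ≤ t → t ≤ b →
      NormLE (ContinuousLinearMap.id ℝ X) (G s ((s + t) / 2) + G ((s + t) / 2) t - G s t)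
        ((t - s) ^ κ * (P t - P s)) :=
    fun s t hs hst ht => normLE_id.2 (hG s _ t hs (by linarith) (by linarith) ht)
  have hsum : Summable fun n : ℕ => ((1 / 2 : ℝ) ^ κ) ^ n * ((b - a) ^ κ * (P b - P a)) :=
    (summable_geometric_of_lt_one (by positivity) (half_rpow_lt_one hκ)).mul_right _
  have hbd : ∀ (n : ℕ) (s t : ℝ), a ≤ s → s ≤ t → t ≤ b →
      ‖dyadicSum G (n + 1) s t - dyadicSum G n s t‖ ≤
        ((1 / 2 : ℝ) ^ κ) ^ n * ((b - a) ^ κ * (P b - P a)) := by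
    intro n s t hs hst ht
    refine (normLE_id.1 (dyadicSum_diff hGm n hs hst ht)).trans ?_
    have p1 := hP ⟨le_rfl, hs.trans (hst.trans ht)⟩ ⟨hs, hst.trans ht⟩ hs
    have p2 := hP ⟨hs.trans hst, ht⟩ ⟨hs.trans (hst.trans ht), le_rfl⟩ ht
    have p3 := hP ⟨hs, hst.trans ht⟩ ⟨hs.trans hst, ht⟩ hst
    refine mul_le_mul_of_nonneg_left ?_ (by positivity)
    refine mul_le_mul ?_ (by linarith) (by linarith) (Real.rpow_nonneg (by linarith) _)
    exact Real.rpow_le_rpow (by linarith) (by linarith) hκ.le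
  constructor
  · refine hc.add (continuousOn_tsum (fun n => ?_) hsum ?_)
    · exact (continuousOn_dyadicSum hc (n + 1)).sub (continuousOn_dyadicSum hc n)
    · rintro n p ⟨h1, h2, h3⟩
      exact hbd n p.1 p.2 h1.le h2 h3
  · refine hca.add (continuousOn_tsum (fun n => ?_) hsum ?_)
    · exact (continuousOn_dyadicSum_left hc hca (n + 1)).sub (continuousOn_dyadicSum_left hc hca n)
    · rintro n t ⟨h1, h2⟩
      exact hbd n a t le_rfl h1.le h2

theorem sew_self {G : ℝ → ℝ → X} {s : ℝ} (h : G s s = 0) : sew G s s = 0 := by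
  have : ∀ n, dyadicSum G n s s = 0 := by
    intro n
    induction n with
    | zero => exact h
    | succ n ih => simp [dyadicSum, ih]
  simp [sew, this, h]

/-- Additivity at points of rational ratio extends by continuity in the intermediate point. -/
theorem sew_add [CompleteSpace X] {G : ℝ → ℝ → X} {P : ℝ → ℝ} {κ a b : ℝ} (hκ : 0 < κ)
    (hP : MonotoneOn P (Icc a b))
    (hG : ∀ s u t, a ≤ s → s ≤ u → u ≤ t → t ≤ b →
      ‖G s u + G u t - G s t‖ ≤ (t - s) ^ κ * (P t - P s))
    (hc : ContinuousOn (fun p : ℝ × ℝ => G p.1 p.2) (openTri a b))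
    (hca : ContinuousOn (G a) (Ioc a b))
    {r s t : ℝ} (hr : a ≤ r) (hrs : r ≤ s) (hst : s ≤ t) (ht : t ≤ b) :
    sew G r t = sew G r s + sew G s t := by
  have hG0 : ∀ s, a ≤ s → s ≤ b → G s s = 0 := by
    intro s hs hsb
    simpa using hG s s s hs le_rfl le_rfl hsb
  rcases hrs.eq_or_lt with rfl | hrs
  · rw [sew_self (hG0 r hr (hst.trans ht)), zero_add]
  rcases hst.eq_or_lt with rfl | hst
  · rw [sew_self (hG0 s (hr.trans hrs.le) ht), add_zero]
  obtain ⟨hS1, hS2⟩ := continuousOn_sew hκ hP hG hc hca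
  have hmem : Ioo r t ∈ 𝓝 s := Ioo_mem_nhds hrs hst
  have c1 : ContinuousAt (fun u => sew G r u) s := by
    rcases hr.eq_or_lt with rfl | hr
    · exact (hS2.mono (fun u hu => ⟨hu.1, hu.2.le.trans ht⟩) : ContinuousOn _ (Ioo a t)).continuousAt
        hmem
    · exact (hS1.comp (f := fun u : ℝ => (r, u)) (by fun_prop)
        (fun u hu => ⟨hr, hu.1.le, hu.2.le.trans ht⟩) : ContinuousOn _ (Ioo r t)).continuousAt hmem
  have c2 : ContinuousAt (fun u => sew G u t) s :=
    (hS1.comp (f := fun u : ℝ => (u, t)) (by fun_prop)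
      (fun u hu => ⟨hr.trans_lt hu.1, hu.2.le, ht⟩) : ContinuousOn _ (Ioo r t)).continuousAt hmem
  set l := (s - r) / (t - r) with hl
  have htr : 0 < t - r := by linarith
  have hl0 : 0 < l := div_pos (by linarith) htr
  have hl1 : l < 1 := (div_lt_one htr).2 (by linarith)
  -- Rounding up keeps the numerator positive; convergence to s<t keeps the ratio below 1
  -- eventually.
  have hlim : Tendsto (fun n : ℕ => r + ((⌈l * (n : ℝ)⌉₊ : ℝ) / n) * (t - r)) atTop (𝓝 s) := by
    have h := ((tendsto_nat_ceil_mul_div_atTop (R := ℝ) hl0.le).comp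
      tendsto_natCast_atTop_atTop).mul_const (t - r)
    have h2 := h.const_add r
    have e : r + l * (t - r) = s := by rw [hl]; field_simp; ring
    rw [e] at h2
    exact h2
  have hev : ∀ᶠ n : ℕ in atTop, sew G r t = sew G r (r + ((⌈l * (n : ℝ)⌉₊ : ℝ) / n) * (t - r)) +
      sew G (r + ((⌈l * (n : ℝ)⌉₊ : ℝ) / n) * (t - r)) t := by
    filter_upwards [hlim.eventually hmem, eventually_gt_atTop 0] with n hn hn0
    have hn0' : (0 : ℝ) < n := by exact_mod_cast hn0
    have hi : 0 < ⌈l * (n : ℝ)⌉₊ := Nat.ceil_pos.2 (by positivity)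
    have hik : ⌈l * (n : ℝ)⌉₊ < n := by
      have h1 := hn.2
      have h2 : (⌈l * (n : ℝ)⌉₊ : ℝ) / n * (t - r) < 1 * (t - r) := by linarith
      have h3 := lt_of_mul_lt_mul_right h2 htr.le
      rw [div_lt_one hn0'] at h3
      exact_mod_cast h3
    have := sew_add_of_rat hκ hP hG hi hik hr (hrs.trans hst).le ht
    rw [show r + (⌈l * (n : ℝ)⌉₊ : ℝ) / n * (t - r) = r + ⌈l * (n : ℝ)⌉₊ * ((t - r) / n) by ring]
    exact this
  have h1 := (c1.tendsto.comp hlim).add (c2.tendsto.comp hlim)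
  refine tendsto_nhds_unique (tendsto_const_nhds (x := sew G r t) (f := (atTop : Filter ℕ))) ?_
  exact h1.congr' (hev.mono fun n hn => hn.symm)

end Sewing

/-! ### Consequences of the smoothing estimates -/

section Scale

open Filter Topology

variable {X : Type*} [NormedAddCommGroup X] [NormedSpace ℝ X]
  {E : ℝ → Type*} [∀ l, NormedAddCommGroup (E l)] [∀ l, NormedSpace ℝ (E l)]
  {S : ℝ → X →L[ℝ] X} {A : X →ₗ.[ℝ] X} {ι : ∀ l : ℝ, E l →L[ℝ] X}

theorem IsSemigroup.zero_apply (h : IsSemigroup S) (u : X) : S 0 u = u := by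
  rw [h.zero]; rfl

theorem IsSemigroup.add_apply (h : IsSemigroup S) {s t : ℝ} (hs : 0 ≤ s) (ht : 0 ≤ t) (u : X) :
    S (s + t) u = S s (S t u) := by
  rw [h.add s t hs ht]; rfl

theorem IsSemigroup.comp_apply (h : IsSemigroup S) {r s t : ℝ} (hrs : r ≤ s) (hst : s ≤ t)
    (u : X) : S (t - s) (S (s - r) u) = S (t - r) u := by
  rw [← h.add_apply (by linarith) (by linarith)]; congr 2; ring

namespace IsSmoothingScale

theorem norm_le_of_normLE_zero (hS : IsSmoothingScale S A ι) {u : X} {c : ℝ}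
    (h : NormLE (ι 0) u c) : ‖u‖ ≤ c := by
  obtain ⟨z, rfl, hz⟩ := h
  rwa [hS.zero_isometry]

theorem normLE_zero (hS : IsSmoothingScale S A ι) (u : X) : NormLE (ι 0) u ‖u‖ := by
  obtain ⟨z, rfl⟩ := hS.zero_surjective u
  exact ⟨z, rfl, (hS.zero_isometry z).ge⟩

theorem exists_smoothing_le (hS : IsSmoothingScale S A ι) {z l : ℝ} (hz : 0 ≤ z) (hzl : z ≤ l)
    (hl : l < 2) : ∃ L : ℝ, 0 < L ∧ ∀ t ∈ Ioc (0 : ℝ) 1, ∀ (u : X) (c : ℝ), NormLE (ι z) u c →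
      NormLE (ι l) (S t u) (L * t ^ (z - l) * c) := by
  obtain ⟨L, hL, h⟩ := hS.smoothing z l 1 hz hzl hl one_pos
  refine ⟨L, hL, fun t ht u c hu => ?_⟩
  obtain ⟨w, rfl, hw⟩ := hu
  refine (h t ht w).mono ?_
  have : 0 ≤ t ^ (-l + z) := Real.rpow_nonneg ht.1.le _
  rw [show z - l = -l + z by ring]
  gcongr

theorem exists_smoothing (hS : IsSmoothingScale S A ι) {l : ℝ} (hl0 : 0 ≤ l) (hl : l < 2) :
    ∃ L : ℝ, 0 < L ∧ ∀ t ∈ Ioc (0 : ℝ) 1, ∀ u : X, NormLE (ι l) (S t u) (L * t ^ (-l) * ‖u‖) := by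
  obtain ⟨L, hL, h⟩ := hS.exists_smoothing_le le_rfl hl0 hl
  refine ⟨L, hL, fun t ht u => ?_⟩
  have := h t ht u _ (hS.normLE_zero u)
  rwa [zero_sub] at this

theorem exists_stable (hS : IsSmoothingScale S A ι) {l : ℝ} (hl0 : 0 ≤ l) (hl : l < 2) :
    ∃ L : ℝ, 1 ≤ L ∧ ∀ t ∈ Icc (0 : ℝ) 1, ∀ (u : X) (c : ℝ), NormLE (ι l) u c →
      NormLE (ι l) (S t u) (L * c) := by
  obtain ⟨L, hL, h⟩ := hS.exists_smoothing_le hl0 le_rfl hl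
  refine ⟨max L 1, le_max_right _ _, fun t ht u c hu => ?_⟩
  have hc := hu.nonneg
  rcases ht.1.eq_or_lt with rfl | ht0
  · rw [hS.semigroup.zero_apply]
    exact hu.mono (le_mul_of_one_le_left hc (le_max_right _ _))
  · refine (h t ⟨ht0, ht.2⟩ u c hu).mono ?_
    rw [sub_self, Real.rpow_zero, mul_one]
    gcongr
    exact le_max_left _ _

theorem exists_bound (hS : IsSmoothingScale S A ι) :
    ∃ L : ℝ, 1 ≤ L ∧ ∀ t ∈ Icc (0 : ℝ) 1, ∀ u : X, ‖S t u‖ ≤ L * ‖u‖ := by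
  obtain ⟨L, hL, h⟩ := hS.exists_stable le_rfl (by norm_num : (0 : ℝ) < 2)
  exact ⟨L, hL, fun t ht u => hS.norm_le_of_normLE_zero (h t ht u _ (hS.normLE_zero u))⟩

theorem exists_approx (hS : IsSmoothingScale S A ι) {m : ℝ} (hm : 0 < m) (hm1 : m ≤ 1) :
    ∃ C : ℝ, 0 < C ∧ ∀ t ∈ Icc (0 : ℝ) 1, ∀ (u : X) (c : ℝ), NormLE (ι m) u c →
      ‖S t u - u‖ ≤ C * t ^ m * c := by
  obtain ⟨C, hC, h⟩ := hS.approx m 0 1 le_rfl hm hm1 one_pos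
  refine ⟨C, hC, fun t ht u c hu => ?_⟩
  have hc := hu.nonneg
  rcases ht.1.eq_or_lt with rfl | ht0
  · rw [hS.semigroup.zero_apply, sub_self, norm_zero, Real.zero_rpow hm.ne']
    simp
  · obtain ⟨w, rfl, hw⟩ := hu
    refine (hS.norm_le_of_normLE_zero (h t ⟨ht0, ht.2⟩ w)).trans ?_
    have : 0 ≤ t ^ m := Real.rpow_nonneg ht.1 _
    rw [sub_zero]
    gcongr

theorem exists_embedding (hS : IsSmoothingScale S A ι) {b l : ℝ} (hb : 0 ≤ b) (hbl : b ≤ l)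
    (hl : l < 2) : ∃ K : ℝ, 0 < K ∧ ∀ (u : X) (c : ℝ), NormLE (ι l) u c →
      NormLE (ι b) u (K * c) := by
  rcases hbl.eq_or_lt with rfl | hbl
  · exact ⟨1, one_pos, fun u c hu => by rwa [one_mul]⟩
  · obtain ⟨K, hK, h⟩ := hS.embedding b l hb hbl hl
    refine ⟨K, hK, fun u c hu => ?_⟩
    obtain ⟨z, rfl, hz⟩ := hu
    exact (h z).mono (by gcongr)

/-- For `t > 0`, `t ↦ S(t)u` is Lipschitz continuous into every space of the scale. -/
theorem exists_lipschitz (hS : IsSmoothingScale S A ι) {l : ℝ} (hl0 : 0 ≤ l) (hl : l < 2) :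
    ∃ C : ℝ, 0 < C ∧ ∀ s t : ℝ, 0 < s → s ≤ t → t ≤ 1 → ∀ u : X,
      NormLE (ι l) (S t u - S s u) (C * (s / 2) ^ (-l) * (s / 2) ^ (-1 : ℝ) * (t - s) * ‖u‖) := by
  obtain ⟨L, hL, h⟩ := hS.exists_smoothing hl0 hl
  obtain ⟨L1, hL1, h1⟩ := hS.exists_smoothing zero_le_one (by norm_num : (1 : ℝ) < 2)
  obtain ⟨C, hC, h2⟩ := hS.exists_approx one_pos le_rfl
  refine ⟨L * C * L1, by positivity, fun s t hs hst ht u => ?_⟩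
  -- One half of the time s lifts u into X_1, where S(t-s)-I is Lipschitz into X; the other half
  -- lifts the result to X_l.
  have e : S t u - S s u = S (s / 2) (S (t - s) (S (s / 2) u) - S (s / 2) u) := by
    rw [map_sub, ← hS.semigroup.add_apply (by linarith) (by linarith),
      ← hS.semigroup.add_apply (by linarith) (by linarith),
      ← hS.semigroup.add_apply (by linarith) (by linarith)]
    congr 3 <;> ring
  rw [e]
  have a1 := h1 (s / 2) ⟨by linarith, by linarith⟩ u
  have a2 := h2 (t - s) ⟨by linarith, by linarith⟩ _ _ a1
  rw [Real.rpow_one] at a2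
  refine (h (s / 2) ⟨by linarith, by linarith⟩ _).mono ?_
  have : 0 ≤ (s / 2) ^ (-l) := Real.rpow_nonneg (by linarith) _
  calc L * (s / 2) ^ (-l) * ‖S (t - s) (S (s / 2) u) - S (s / 2) u‖
      ≤ L * (s / 2) ^ (-l) * (C * (t - s) * (L1 * (s / 2) ^ (-1 : ℝ) * ‖u‖)) := by gcongr
    _ = _ := by ring

/-- Joint continuity of `(t,u) ↦ S(t)u` into `X_l` for `t > 0`. -/
theorem eventually_normLE (hS : IsSmoothingScale S A ι) {l : ℝ} (hl0 : 0 ≤ l) (hl : l < 2)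
    {T : Type*} {𝓕 : Filter T} {τ : T → ℝ} {f : T → X} {t₀ : ℝ} {u₀ : X} (ht₀ : 0 < t₀)
    (hτ : Tendsto τ 𝓕 (𝓝 t₀)) (hτ1 : ∀ᶠ p in 𝓕, τ p ≤ 1) (ht1 : t₀ ≤ 1)
    (hf : Tendsto f 𝓕 (𝓝 u₀)) {e : ℝ} (he : 0 < e) :
    ∀ᶠ p in 𝓕, NormLE (ι l) (S (τ p) (f p) - S t₀ u₀) e := by
  obtain ⟨L, hL, h⟩ := hS.exists_smoothing hl0 hl
  obtain ⟨C, hC, h2⟩ := hS.exists_lipschitz hl0 hl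
  set q := t₀ / 2 with hq
  have hq0 : 0 < q := by rw [hq]; linarith
  set M := C * (q / 2) ^ (-l) * (q / 2) ^ (-1 : ℝ) with hM
  have hM0 : 0 ≤ M := by positivity
  have hlim : Tendsto (fun p => L * q ^ (-l) * ‖f p - u₀‖ + M * |τ p - t₀| * ‖u₀‖) 𝓕 (𝓝 0) := by
    have a1 : Tendsto (fun p => ‖f p - u₀‖) 𝓕 (𝓝 0) := tendsto_iff_norm_sub_tendsto_zero.1 hf
    have a2 : Tendsto (fun p => |τ p - t₀|) 𝓕 (𝓝 0) := by
      simpa using (tendsto_iff_norm_sub_tendsto_zero.1 hτ)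
    simpa using (a1.const_mul (L * q ^ (-l))).add ((a2.const_mul M).mul_const ‖u₀‖)
  filter_upwards [hlim.eventually (gt_mem_nhds he), hτ.eventually (lt_mem_nhds (show q < t₀ by
    rw [hq]; linarith)), hτ1] with p hp hqp hp1
  have e1 : S (τ p) (f p) - S t₀ u₀ = S (τ p) (f p - u₀) + (S (τ p) u₀ - S t₀ u₀) := by
    rw [map_sub]; abel
  rw [e1]
  refine ((NormLE.add (c := L * q ^ (-l) * ‖f p - u₀‖) (d := M * |τ p - t₀| * ‖u₀‖) ?_ ?_).mono hp.le)
  · refine (h (τ p) ⟨hq0.trans hqp, hp1⟩ _).mono ?_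
    have : τ p ^ (-l) ≤ q ^ (-l) := Real.rpow_le_rpow_of_nonpos hq0 hqp.le (by linarith)
    gcongr
  · have key : ∀ s t : ℝ, q ≤ s → s ≤ t → t ≤ 1 →
        NormLE (ι l) (S t u₀ - S s u₀) (M * |t - s| * ‖u₀‖) := by
      intro s t hs hst ht
      refine (h2 s t (hq0.trans_le hs) hst ht u₀).mono ?_
      rw [abs_of_nonneg (sub_nonneg.2 hst), hM]
      have b1 : (s / 2) ^ (-l) ≤ (q / 2) ^ (-l) :=
        Real.rpow_le_rpow_of_nonpos (by linarith) (by linarith) (by linarith)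
      have b2 : (s / 2) ^ (-1 : ℝ) ≤ (q / 2) ^ (-1 : ℝ) :=
        Real.rpow_le_rpow_of_nonpos (by linarith) (by linarith) (by linarith)
      have : 0 ≤ t - s := by linarith
      gcongr
      exact Real.rpow_nonneg (by linarith) _
    rcases le_total (τ p) t₀ with hle | hle
    · have := (key (τ p) t₀ hqp.le hle ht1).neg
      rwa [neg_sub, abs_sub_comm] at this
    · exact key t₀ (τ p) (by rw [hq]; linarith) hle hp1

theorem tendsto_semigroup (hS : IsSmoothingScale S A ι)
    {T : Type*} {𝓕 : Filter T} {τ : T → ℝ} {f : T → X} {t₀ : ℝ} {u₀ : X} (ht₀ : 0 < t₀)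
    (hτ : Tendsto τ 𝓕 (𝓝 t₀)) (hτ1 : ∀ᶠ p in 𝓕, τ p ≤ 1) (ht1 : t₀ ≤ 1)
    (hf : Tendsto f 𝓕 (𝓝 u₀)) : Tendsto (fun p => S (τ p) (f p)) 𝓕 (𝓝 (S t₀ u₀)) := by
  rw [Metric.tendsto_nhds]
  intro e he
  filter_upwards [hS.eventually_normLE le_rfl (by norm_num) ht₀ hτ hτ1 ht1 hf (half_pos he)]
    with p hp
  rw [dist_eq_norm]
  exact (hS.norm_le_of_normLE_zero hp).trans_lt (by linarith)

end IsSmoothingScale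

/-- Continuity at `p₀` within `D`, for the norm of the space embedded by `j`. -/
def NormLEContAt {T F : Type*} [TopologicalSpace T] [NormedAddCommGroup F] [NormedSpace ℝ F]
    (j : F →L[ℝ] X) (D : Set T) (f : T → X) (p₀ : T) : Prop :=
  ∀ e : ℝ, 0 < e → ∀ᶠ p in 𝓝[D] p₀, NormLE j (f p - f p₀) e

theorem NormLEContAt.sub {T F : Type*} [TopologicalSpace T] [NormedAddCommGroup F]
    [NormedSpace ℝ F] {j : F →L[ℝ] X} {D : Set T} {f g : T → X} {p₀ : T}
    (hf : NormLEContAt j D f p₀) (hg : NormLEContAt j D g p₀) :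
    NormLEContAt j D (fun p => f p - g p) p₀ := by
  intro e he
  filter_upwards [hf _ (half_pos he), hg _ (half_pos he)] with p h1 h2
  convert h1.sub h2 using 1
  · abel
  · ring

theorem NormLEContAt.continuousWithinAt {T F : Type*} [TopologicalSpace T] [NormedAddCommGroup F]
    [NormedSpace ℝ F] {j : F →L[ℝ] X} {D : Set T} {f : T → X} {p₀ : T}
    (hf : NormLEContAt j D f p₀) : ContinuousWithinAt f D p₀ := by
  rw [ContinuousWithinAt, Metric.tendsto_nhds]
  intro e he
  filter_upwards [hf (e / (‖j‖ + 1)) (by positivity)] with p hp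
  rw [dist_eq_norm]
  refine hp.norm_le.trans_lt ?_
  rw [mul_div_assoc', div_lt_iff₀ (by positivity)]
  nlinarith [norm_nonneg j]

theorem continuousOn_lift {T F : Type*} [TopologicalSpace T] [NormedAddCommGroup F]
    [NormedSpace ℝ F] {j : F →L[ℝ] X} (hj : Function.Injective j) {D : Set T} {f : T → X}
    (hmem : ∀ p ∈ D, f p ∈ range j) (hf : ∀ p ∈ D, NormLEContAt j D f p) :
    ContinuousOn (fun p => lift j (f p)) D := by
  intro p₀ hp₀
  rw [ContinuousWithinAt, Metric.tendsto_nhds]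
  intro e he
  filter_upwards [hf p₀ hp₀ _ (half_pos he), self_mem_nhdsWithin] with p hp hpD
  rw [dist_eq_norm]
  exact (norm_lift_sub_le hj (hmem p hpD) (hmem p₀ hp₀) hp).trans_lt (by linarith)

/-- A function whose mild increments are Hölder continuous in `X_l` is continuous in `X_l` to the
right of the base point. -/
theorem IsSmoothingScale.contAt_of_increments (hS : IsSmoothingScale S A ι) {l : ℝ} (hl0 : 0 ≤ l)
    (hl : l < 2) {g : ℝ → X} {a b C p : ℝ} (ha : 0 ≤ a) (hb : b ≤ 1) (hp : 0 < p)
    (hg : ∀ s t, a ≤ s → s < t → t ≤ b →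
      NormLE (ι l) (g t - S (t - s) (g s)) (C * (t - s) ^ p)) {t₀ : ℝ} (ht₀ : t₀ ∈ Ioc a b) :
    NormLEContAt (ι l) (Icc a b) g t₀ := by
  intro e he
  have hlim : Tendsto (fun r : ℝ => C * (2 * (t₀ - r)) ^ p) (𝓝[<] t₀) (𝓝 0) := by
    have : ContinuousAt (fun r : ℝ => C * (2 * (t₀ - r)) ^ p) t₀ :=
      ContinuousAt.mul continuousAt_const (ContinuousAt.rpow_const (by fun_prop) (Or.inr hp.le))
    have h := this.tendsto
    simp only [sub_self, mul_zero, Real.zero_rpow hp.ne'] at h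
    exact h.mono_left nhdsWithin_le_nhds
  have hev : ∀ᶠ r in 𝓝[<] t₀, a < r ∧ r < t₀ ∧ C * (2 * (t₀ - r)) ^ p < e / 3 := by
    filter_upwards [hlim.eventually (gt_mem_nhds (show (0:ℝ) < e / 3 by linarith)),
      nhdsWithin_le_nhds (lt_mem_nhds ht₀.1), self_mem_nhdsWithin] with r h1 h2 h3
    exact ⟨h2, h3, h1⟩
  obtain ⟨r, har, hrt, hr⟩ := hev.exists
  have hC : 0 ≤ C := by
    have h1 := (hg r t₀ har.le hrt ht₀.2).nonneg
    exact nonneg_of_mul_nonneg_left h1 (Real.rpow_pos_of_pos (by linarith) _)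
  have hcont := hS.eventually_normLE hl0 hl (𝓕 := 𝓝[Icc a b] t₀) (τ := fun t => t - r)
    (f := fun _ => g r) (t₀ := t₀ - r) (u₀ := g r) (by linarith)
    ((tendsto_id.sub_const r).mono_left nhdsWithin_le_nhds)
    (by filter_upwards [self_mem_nhdsWithin] with t ht; linarith [ht.2]) (by linarith [ht₀.2])
    tendsto_const_nhds (show (0:ℝ) < e / 3 by linarith)
  have hnear : ∀ᶠ t in 𝓝[Icc a b] t₀, r < t ∧ t - r < 2 * (t₀ - r) :=
    nhdsWithin_le_nhds ((lt_mem_nhds hrt).and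
      ((gt_mem_nhds (show t₀ < 2 * t₀ - r by linarith)).mono fun t ht => by linarith))
  filter_upwards [hcont, hnear, self_mem_nhdsWithin] with t h1 h2 h3
  have b1 := (hg r t har.le h2.1 h3.2).mono (d := e / 3) (by
    refine le_trans ?_ hr.le
    have : (t - r) ^ p ≤ (2 * (t₀ - r)) ^ p :=
      Real.rpow_le_rpow (by linarith) h2.2.le hp.le
    gcongr)
  have b2 := (hg r t₀ har.le hrt ht₀.2).mono (d := e / 3) (by
    refine le_trans ?_ hr.le
    have : (t₀ - r) ^ p ≤ (2 * (t₀ - r)) ^ p :=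
      Real.rpow_le_rpow (by linarith) (by linarith) hp.le
    gcongr)
  convert (b1.add h1).sub b2 using 1
  · abel
  · ring

end Scale

/-! ### The convolution integral of a mildly Hölder continuous function -/

section Conv

open Filter Topology

variable {X : Type*} [NormedAddCommGroup X] [NormedSpace ℝ X]

theorem continuousOn_of_norm_sub_le {Y : Type*} [SeminormedAddCommGroup Y] {f : ℝ → Y} {D : Set ℝ}
    {C p : ℝ} (hp : 0 < p) (h : ∀ s ∈ D, ∀ t ∈ D, ‖f t - f s‖ ≤ C * |t - s| ^ p) :
    ContinuousOn f D := by
  intro s hs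
  rw [ContinuousWithinAt, tendsto_iff_norm_sub_tendsto_zero]
  have hlim : Tendsto (fun t : ℝ => C * |t - s| ^ p) (𝓝[D] s) (𝓝 0) := by
    have : ContinuousAt (fun t : ℝ => C * |t - s| ^ p) s :=
      ContinuousAt.mul continuousAt_const (ContinuousAt.rpow_const (by fun_prop) (Or.inr hp.le))
    have h := this.tendsto
    simp only [sub_self, abs_zero, Real.zero_rpow hp.ne', mul_zero] at h
    exact h.mono_left nhdsWithin_le_nhds
  refine squeeze_zero' (Eventually.of_forall fun _ => norm_nonneg _) ?_ hlim
  filter_upwards [self_mem_nhdsWithin] with t ht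
  exact h s hs t ht

theorem continuousOn_of_local_holder {f : ℝ → X} {a b p : ℝ} (hp : 0 < p)
    (h : ∀ q, a < q → ∃ C : ℝ, ∀ s t, q ≤ s → s < t → t ≤ b → ‖f t - f s‖ ≤ C * (t - s) ^ p) :
    ContinuousOn f (Ioc a b) := by
  intro t₀ ht₀
  obtain ⟨q, hq1, hq2⟩ := exists_between ht₀.1
  obtain ⟨C, hC⟩ := h q hq1
  have hc : ContinuousOn f (Icc q b) := by
    refine continuousOn_of_norm_sub_le (C := C) hp fun s hs t ht => ?_
    rcases lt_trichotomy s t with hst | rfl | hst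
    · rw [abs_of_pos (by linarith)]
      exact hC s t hs.1 hst ht.2
    · simp [Real.zero_rpow hp.ne']
    · rw [norm_sub_rev, abs_of_neg (by linarith), neg_sub]
      exact hC t s ht.1 hst hs.2
  refine (hc t₀ ⟨hq2.le, ht₀.2⟩).mono_of_mem_nhdsWithin ?_
  filter_upwards [self_mem_nhdsWithin, nhdsWithin_le_nhds (lt_mem_nhds hq2)] with t h1 h2
  exact ⟨h2.le, h1.2⟩

/-- The germ `(r,u) ↦ (x(u) - x(r)) S(T-r) φ(r)` of `∫ S(T-r) φ(r) dx(r)`. -/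
noncomputable def convGerm (S : ℝ → X →L[ℝ] X) (x : ℝ → ℝ) (φ : ℝ → X) (T r u : ℝ) : X :=
  (x u - x r) • S (T - r) (φ r)

/-- The convolution integral `∫_s^t S(t-r) φ(r) dx(r)` as a limit of dyadic sums. -/
noncomputable def convInt (S : ℝ → X →L[ℝ] X) (x : ℝ → ℝ) (φ : ℝ → X) (s t : ℝ) : X :=
  sew (convGerm S x φ t) s t

/-- `φ` is bounded on `[a,b]`, and its mild increments are `α`-Hölder continuous with a constant
which may blow up at `a`. -/
structure MildHolder (S : ℝ → X →L[ℝ] X) (α a b c : ℝ) (φ : ℝ → X) : Prop where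
  bdd : ∀ t, a ≤ t → t ≤ b → ‖φ t‖ ≤ c
  incr : ∀ s t, a ≤ s → s < t → t ≤ b → ‖φ t - S (t - s) (φ s)‖ ≤ c * ((t - s) / (t - a)) ^ α

theorem MildHolder.nonneg {S : ℝ → X →L[ℝ] X} {α a b c : ℝ} {φ : ℝ → X}
    (h : MildHolder S α a b c φ) (hab : a ≤ b) : 0 ≤ c :=
  (norm_nonneg _).trans (h.bdd a le_rfl hab)

variable {E : ℝ → Type*} [∀ l, NormedAddCommGroup (E l)] [∀ l, NormedSpace ℝ (E l)]

/-- The standing assumptions on the scale of spaces, the path and the exponents. -/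
structure YoungSetting (S : ℝ → X →L[ℝ] X) (A : X →ₗ.[ℝ] X) (ι : ∀ l : ℝ, E l →L[ℝ] X)
    (x : ℝ → ℝ) (η α : ℝ) : Prop where
  scale : IsSmoothingScale S A ι
  path : ∃ C : ℝ, ∀ s ∈ Icc (0 : ℝ) 1, ∀ t ∈ Icc (0 : ℝ) 1, |x t - x s| ≤ C * |t - s| ^ η
  eta_lt : η < 1
  alpha_pos : 0 < α
  alpha_lt : α < η
  sum_gt : 1 < η + α

variable {S : ℝ → X →L[ℝ] X} {A : X →ₗ.[ℝ] X} {ι : ∀ l : ℝ, E l →L[ℝ] X} {x : ℝ → ℝ} {η α : ℝ}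

namespace YoungSetting

theorem alpha_lt_one (h : YoungSetting S A ι x η α) : α < 1 := h.alpha_lt.trans h.eta_lt

theorem eta_pos (h : YoungSetting S A ι x η α) : 0 < η := h.alpha_pos.trans h.alpha_lt

theorem exists_path (h : YoungSetting S A ι x η α) : ∃ C : ℝ, 0 < C ∧
    ∀ s t, 0 ≤ s → s ≤ t → t ≤ 1 → |x t - x s| ≤ C * (t - s) ^ η := by
  obtain ⟨C, hC⟩ := h.path
  refine ⟨max C 1, by positivity, fun s t hs hst ht => ?_⟩
  have := hC s ⟨hs, hst.trans ht⟩ t ⟨hs.trans hst, ht⟩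
  rw [abs_of_nonneg (sub_nonneg.2 hst)] at this
  refine this.trans ?_
  have h0 : 0 ≤ (t - s) ^ η := Real.rpow_nonneg (by linarith) _
  gcongr
  exact le_max_left _ _

theorem continuousOn_path (h : YoungSetting S A ι x η α) : ContinuousOn x (Icc 0 1) := by
  obtain ⟨C, hC⟩ := h.path
  exact continuousOn_of_norm_sub_le h.eta_pos hC

end YoungSetting

/-- With T fixed, the semigroup law makes the defect of the germ depend on φ only through its mild
increment. This is the reason for freezing the final time. -/
theorem convGerm_diff (hS : IsSemigroup S) (φ : ℝ → X) {s u t T : ℝ} (hsu : s ≤ u) (huT : u ≤ T) :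
    convGerm S x φ T s u + convGerm S x φ T u t - convGerm S x φ T s t =
      (x t - x u) • S (T - u) (φ u - S (u - s) (φ s)) := by
  rw [map_sub, hS.comp_apply hsu huT]
  simp only [convGerm]
  module

theorem convGerm_shift (hS : IsSemigroup S) (φ : ℝ → X) {r u s t : ℝ} (hrs : r ≤ s) (hst : s ≤ t) :
    convGerm S x φ t r u = S (t - s) (convGerm S x φ s r u) := by
  rw [convGerm, convGerm, map_smul, hS.comp_apply hrs hst]

/-- The defect is of order (t-s)^(η+α)(t-a)^(-α). Splitting off (t-s)^(η+α-1) leaves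
(t-s)(t-a)^(-α), which by concavity is at most an increment of (·-a)^(1-α)/(1-α). -/
theorem YoungSetting.exists_convGerm_le (h : YoungSetting S A ι x η α) :
    ∃ K : ℝ, 0 < K ∧ ∀ (a b c : ℝ) (φ : ℝ → X), 0 ≤ a → b ≤ 1 → MildHolder S α a b c φ →
      ∀ s u t T, a ≤ s → s ≤ u → u ≤ t → t ≤ T → T ≤ b →
      ‖convGerm S x φ T s u + convGerm S x φ T u t - convGerm S x φ T s t‖ ≤
        (t - s) ^ (η + α - 1) *
          (K * c * (t - a) ^ (1 - α) - K * c * (s - a) ^ (1 - α)) := by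
  obtain ⟨L, hL, hLb⟩ := h.scale.exists_bound
  obtain ⟨C, hC, hx⟩ := h.exists_path
  have hα := h.alpha_lt_one
  have hα0 := h.alpha_pos
  have hη0 := h.eta_pos
  have hα' : 0 < 1 - α := by linarith
  refine ⟨C * L / (1 - α), by positivity, ?_⟩
  intro a b c φ ha hb hφ s u t T hs hsu hut htT hT
  have hc : 0 ≤ c := hφ.nonneg (by linarith)
  rw [convGerm_diff h.scale.semigroup φ hsu (hut.trans htT), ← mul_sub]
  have hmono : (s - a) ^ (1 - α) ≤ (t - a) ^ (1 - α) :=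
    Real.rpow_le_rpow (by linarith) (by linarith) hα'.le
  rcases hsu.eq_or_lt with rfl | hsu
  · rw [sub_self, h.scale.semigroup.zero_apply, sub_self, map_zero, smul_zero, norm_zero]
    have : 0 ≤ (t - a) ^ (1 - α) - (s - a) ^ (1 - α) := by linarith
    have : 0 ≤ t - s := by linarith
    positivity
  have hta : 0 < t - a := by linarith
  have hua : 0 < u - a := by linarith
  have hts : 0 < t - s := by linarith
  have h1 : ‖S (T - u) (φ u - S (u - s) (φ s))‖ ≤ L * (c * ((t - s) / (t - a)) ^ α) := by
    refine (hLb _ ⟨by linarith, by linarith⟩ _).trans ?_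
    have := hφ.incr s u hs hsu (by linarith)
    -- The ratio (u-s)/(u-a) = 1-(s-a)/(u-a) increases with u because s ≥ a.
    have h2 : ((u - s) / (u - a)) ^ α ≤ ((t - s) / (t - a)) ^ α := by
      refine Real.rpow_le_rpow (div_nonneg (by linarith) hua.le) ?_ hα0.le
      rw [div_le_div_iff₀ hua hta]
      nlinarith
    gcongr
    exact this.trans (by gcongr)
  have h2 : |x t - x u| ≤ C * (t - s) ^ η := by
    refine (hx u t (by linarith) hut (by linarith)).trans ?_
    have : (t - u) ^ η ≤ (t - s) ^ η := Real.rpow_le_rpow (by linarith) (by linarith) hη0.le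
    gcongr
  have h3 := rpow_sub_rpow_ge (p := 1 - α) (s := s - a) (t := t - a) hα' (by linarith)
    (by linarith) hta
  rw [show t - a - (s - a) = t - s by ring, show 1 - α - 1 = -α by ring] at h3
  have e : (t - s) ^ η * ((t - s) / (t - a)) ^ α =
      (t - s) ^ (η + α - 1) * ((t - s) * (t - a) ^ (-α)) := by
    rw [Real.div_rpow hts.le hta.le, Real.rpow_neg hta.le, ← mul_assoc,
      ← Real.rpow_add_one hts.ne', sub_add_cancel, Real.rpow_add hts]
    ring
  rw [norm_smul, Real.norm_eq_abs]
  calc |x t - x u| * ‖S (T - u) (φ u - S (u - s) (φ s))‖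
      ≤ (C * (t - s) ^ η) * (L * (c * ((t - s) / (t - a)) ^ α)) := by
        gcongr
    _ = C * L * c * ((t - s) ^ η * ((t - s) / (t - a)) ^ α) := by ring
    _ = (t - s) ^ (η + α - 1) * (C * L / (1 - α) * c * ((1 - α) * (t - s) * (t - a) ^ (-α))) := by
        rw [e]; field_simp
    _ ≤ _ := by gcongr

theorem monotoneOn_weight {K a b p : ℝ} (hK : 0 ≤ K) (hp : 0 ≤ p) :
    MonotoneOn (fun t : ℝ => K * (t - a) ^ p) (Icc a b) := by
  intro s hs t ht hst
  have : (s - a) ^ p ≤ (t - a) ^ p := Real.rpow_le_rpow (by linarith [hs.1]) (by linarith) hp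
  dsimp only
  gcongr

variable [CompleteSpace X]

namespace YoungSetting

theorem tendsto_convInt (h : YoungSetting S A ι x η α) {a b c : ℝ} {φ : ℝ → X} (ha : 0 ≤ a)
    (hb : b ≤ 1) (hφ : MildHolder S α a b c φ) {s t T : ℝ} (hs : a ≤ s) (hst : s ≤ t) (htT : t ≤ T)
    (hT : T ≤ b) : Tendsto (fun n => dyadicSum (convGerm S x φ T) n s t) atTop
      (𝓝 (sew (convGerm S x φ T) s t)) := by
  obtain ⟨K, hK, hle⟩ := h.exists_convGerm_le
  refine (sew_sub_germ (a := a) (b := T) (κ := η + α - 1)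
    (j := ContinuousLinearMap.id ℝ X)
    (P := fun t => K * c * (t - a) ^ (1 - α)) (by linarith [h.sum_gt]) ?_ hs hst htT).1
  intro s t hs hst ht
  exact normLE_id.2 (hle a b c φ ha hb hφ s _ t T hs (by linarith) (by linarith) ht hT)

/-- Moving the final time from s to t applies S(t-s) to every term of the dyadic sums, and S(t-s) is
continuous. -/
theorem sew_convGerm (h : YoungSetting S A ι x η α) {a b c : ℝ} {φ : ℝ → X} (ha : 0 ≤ a)
    (hb : b ≤ 1) (hφ : MildHolder S α a b c φ) {r s t : ℝ} (hr : a ≤ r) (hrs : r ≤ s) (hst : s ≤ t)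
    (ht : t ≤ b) : sew (convGerm S x φ t) r s = S (t - s) (convInt S x φ r s) := by
  have h1 := h.tendsto_convInt ha hb hφ hr hrs hst ht
  have h2 := h.tendsto_convInt ha hb hφ hr hrs le_rfl (hst.trans ht)
  refine tendsto_nhds_unique h1 ((((S (t - s)).continuous.tendsto _).comp h2).congr fun n => ?_)
  exact (dyadicSum_map (T := S (t - s)) (a := r) (b := s) (fun r' u hr' hru hus =>
    convGerm_shift h.scale.semigroup φ (hru.trans hus) hst) n le_rfl hrs le_rfl).symm

/-- Plain additivity of the sewn germ with final time t, combined with the change of final time on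
[r,s]. -/
theorem convInt_add (h : YoungSetting S A ι x η α) {a b c : ℝ} {φ : ℝ → X} (ha : 0 ≤ a)
    (hb : b ≤ 1) (hφ : MildHolder S α a b c φ) {r s t : ℝ} (hr : a ≤ r) (hrs : r ≤ s) (hst : s ≤ t)
    (ht : t ≤ b) : convInt S x φ r t = convInt S x φ s t + S (t - s) (convInt S x φ r s) := by
  obtain ⟨K, hK, hle⟩ := h.exists_convGerm_le
  have hc : 0 ≤ c := hφ.nonneg (by linarith)
  have hα := h.alpha_lt_one
  obtain ⟨L, hL, hLb⟩ := h.scale.exists_bound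
  have hxc := h.continuousOn_path
  -- Increments of this function are S(t-u) applied to mild increments of φ, so it is continuous up
  -- to r = t although S need not be continuous at 0.
  have hf : ContinuousOn (fun r => S (t - r) (φ r)) (Ioc a t) := by
    refine continuousOn_of_local_holder h.alpha_pos fun q hq =>
      ⟨L * c * ((q - a)⁻¹) ^ α, fun s u hs hsu hu => ?_⟩
    have e : S (t - u) (φ u) - S (t - s) (φ s) = S (t - u) (φ u - S (u - s) (φ s)) := by
      rw [map_sub, h.scale.semigroup.comp_apply hsu.le hu]
    rw [e]
    refine (hLb _ ⟨by linarith, by linarith⟩ _).trans ?_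
    have h1 := hφ.incr s u (by linarith) hsu (by linarith)
    have hqa : 0 < q - a := by linarith
    have h2 : ((u - s) / (u - a)) ^ α ≤ ((q - a)⁻¹) ^ α * (u - s) ^ α := by
      rw [← Real.mul_rpow (by positivity) (by linarith)]
      refine Real.rpow_le_rpow (div_nonneg (by linarith) (by linarith)) ?_ h.alpha_pos.le
      rw [div_eq_inv_mul]
      have : 0 ≤ u - s := by linarith
      gcongr
      linarith
    calc L * ‖φ u - S (u - s) (φ s)‖ ≤ L * (c * (((q - a)⁻¹) ^ α * (u - s) ^ α)) := by
          gcongr; exact h1.trans (by gcongr)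
      _ = _ := by ring
  have hadd := sew_add (G := convGerm S x φ t) (P := fun t => K * c * (t - a) ^ (1 - α)) (a := a)
    (b := t) (κ := η + α - 1) (by linarith [h.sum_gt])
    (monotoneOn_weight (by positivity) (by linarith))
    (fun s u v hs hsu huv hv => hle a b c φ ha hb hφ s u v t hs hsu huv hv ht) ?_ ?_ hr hrs hst
    le_rfl
  · rw [convInt, hadd, h.sew_convGerm ha hb hφ hr hrs hst ht, add_comm]
    rfl
  · refine ContinuousOn.smul (ContinuousOn.sub ?_ ?_) ?_
    · exact hxc.comp (by fun_prop) fun p hp =>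
        ⟨by linarith [hp.1, hp.2.1], by linarith [hp.1, hp.2.2]⟩
    · exact hxc.comp (by fun_prop) fun p hp =>
        ⟨by linarith [hp.1, hp.2.1], by linarith [hp.2.1, hp.2.2]⟩
    · exact hf.comp (f := fun p : ℝ × ℝ => p.1) (by fun_prop) fun p hp =>
        ⟨hp.1, hp.2.1.trans hp.2.2⟩
  · refine ContinuousOn.smul (ContinuousOn.sub ?_ continuousOn_const) continuousOn_const
    exact hxc.mono fun u hu => ⟨by linarith [hu.1], by linarith [hu.2]⟩

theorem convInt_self (φ : ℝ → X) (s : ℝ) : convInt S x φ s s = 0 :=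
  sew_self (by simp [convGerm])

theorem convInt_sub (h : YoungSetting S A ι x η α) {a b c c' : ℝ} {φ φ' : ℝ → X} (ha : 0 ≤ a)
    (hb : b ≤ 1) (hφ : MildHolder S α a b c φ) (hφ' : MildHolder S α a b c' φ')
    {d : ℝ} (hd : MildHolder S α a b d (fun t => φ t - φ' t)) {s t : ℝ}
    (hs : a ≤ s) (hst : s ≤ t) (ht : t ≤ b) :
    convInt S x (fun t => φ t - φ' t) s t = convInt S x φ s t - convInt S x φ' s t := by
  have h1 := h.tendsto_convInt ha hb hφ hs hst le_rfl ht
  have h2 := h.tendsto_convInt ha hb hφ' hs hst le_rfl ht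
  have h3 := h.tendsto_convInt ha hb hd hs hst le_rfl ht
  refine tendsto_nhds_unique h3 ((h1.sub h2).congr fun n => ?_)
  rw [← dyadicSum_sub]
  congr 1
  funext r u
  simp only [convGerm, map_sub, smul_sub]

theorem exists_convInt_sub_germ_le (h : YoungSetting S A ι x η α) :
    ∃ K : ℝ, 0 < K ∧ ∀ (a b c : ℝ) (φ : ℝ → X), 0 ≤ a → b ≤ 1 → MildHolder S α a b c φ →
      ∀ s t, a ≤ s → s ≤ t → t ≤ b →
      ‖convInt S x φ s t - (x t - x s) • S (t - s) (φ s)‖ ≤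
        (t - s) ^ (η + α - 1) *
          (K * c * (t - a) ^ (1 - α) - K * c * (s - a) ^ (1 - α)) := by
  obtain ⟨K, hK, hle⟩ := h.exists_convGerm_le
  have hκ : 0 < η + α - 1 := by linarith [h.sum_gt]
  have hc := half_rpow_lt_one hκ
  refine ⟨(1 - (1 / 2 : ℝ) ^ (η + α - 1))⁻¹ * K, mul_pos (inv_pos.2 (by linarith)) hK, ?_⟩
  intro a b c φ ha hb hφ s t hs hst ht
  have := (sew_sub_germ (a := a) (b := t) (κ := η + α - 1)
    (j := ContinuousLinearMap.id ℝ X)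
    (P := fun t => K * c * (t - a) ^ (1 - α)) hκ (fun s u hs hsu hu =>
      normLE_id.2 (hle a b c φ ha hb hφ s _ u t hs (by linarith) (by linarith) hu ht))
      hs hst le_rfl).2
  refine (normLE_id.1 this).trans (le_of_eq ?_)
  ring

/-- `‖∫_s^t S(t-r) φ(r) dx(r)‖ ≤ K c (t-s)^η`. -/
theorem exists_convInt_le (h : YoungSetting S A ι x η α) :
    ∃ K : ℝ, 0 < K ∧ ∀ (a b c : ℝ) (φ : ℝ → X), 0 ≤ a → b ≤ 1 → MildHolder S α a b c φ →
      ∀ s t, a ≤ s → s ≤ t → t ≤ b → ‖convInt S x φ s t‖ ≤ K * c * (t - s) ^ η := by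
  obtain ⟨K, hK, hle⟩ := h.exists_convInt_sub_germ_le
  obtain ⟨L, hL, hLb⟩ := h.scale.exists_bound
  obtain ⟨C, hC, hx⟩ := h.exists_path
  have hα := h.alpha_lt_one
  have hα0 := h.alpha_pos
  refine ⟨K + C * L, by positivity, ?_⟩
  intro a b c φ ha hb hφ s t hs hst ht
  have hc : 0 ≤ c := hφ.nonneg (by linarith)
  rcases hst.eq_or_lt with rfl | hst
  · rw [convInt_self, norm_zero]
    have : 0 ≤ (s - s) ^ η := Real.rpow_nonneg (by linarith) _
    positivity
  have hts : 0 < t - s := by linarith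
  have h1 := hle a b c φ ha hb hφ s t hs hst.le ht
  have h2 : ‖(x t - x s) • S (t - s) (φ s)‖ ≤ C * (t - s) ^ η * (L * c) := by
    rw [norm_smul, Real.norm_eq_abs]
    have a1 := hx s t (by linarith) hst.le (by linarith)
    have a2 := (hLb (t - s) ⟨by linarith, by linarith⟩ (φ s)).trans
      (mul_le_mul_of_nonneg_left (hφ.bdd s hs (by linarith)) (by linarith))
    gcongr
  have h3 : (t - s) ^ (η + α - 1) * (K * c * (t - a) ^ (1 - α) - K * c * (s - a) ^ (1 - α)) ≤
      K * c * (t - s) ^ η := by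
    have := rpow_sub_rpow_le (p := 1 - α) (s := s - a) (t := t - a) (by linarith) (by linarith)
      (by linarith) (by linarith)
    rw [show t - a - (s - a) = t - s by ring] at this
    rw [← mul_sub]
    calc _ ≤ (t - s) ^ (η + α - 1) * (K * c * (t - s) ^ (1 - α)) := by gcongr
      _ = K * c * ((t - s) ^ (η + α - 1) * (t - s) ^ (1 - α)) := by ring
      _ = _ := by rw [← Real.rpow_add hts]; congr 2; ring
  have e : convInt S x φ s t = (convInt S x φ s t - (x t - x s) • S (t - s) (φ s)) +
      (x t - x s) • S (t - s) (φ s) := by abel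
  rw [e]
  refine (norm_add_le _ _).trans ((add_le_add (h1.trans h3) h2).trans (le_of_eq ?_))
  ring

/-- The remainder of the convolution integral in the spaces `X_l` with `l < 1`. -/
theorem exists_convInt_sub_germ_normLE [∀ l, CompleteSpace (E l)] (h : YoungSetting S A ι x η α)
    {l : ℝ} (hl0 : 0 ≤ l) (hl : l < 1) :
    ∃ K : ℝ, 0 < K ∧ ∀ (s t B : ℝ) (φ : ℝ → X), 0 ≤ s → s < t → t ≤ 1 → 0 ≤ B →
      (∀ r u, s ≤ r → r < u → u ≤ t → ‖φ u - S (u - r) (φ r)‖ ≤ B * (u - r) ^ α) →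
      NormLE (ι l) (convInt S x φ s t - (x t - x s) • S (t - s) (φ s))
        (K * B * (t - s) ^ (η + α - l)) := by
  obtain ⟨L, hL, hLb⟩ := h.scale.exists_smoothing hl0 (by linarith)
  obtain ⟨C, hC, hx⟩ := h.exists_path
  have hα := h.alpha_lt_one
  have hα0 := h.alpha_pos
  have hη0 := h.eta_pos
  have hκ : 0 < η + α - 1 := by linarith [h.sum_gt]
  have hc := half_rpow_lt_one hκ
  have hl' : 0 < 1 - l := by linarith
  set q := (1 - (1 / 2 : ℝ) ^ (η + α - 1))⁻¹ with hq
  have hq0 : 0 < q := inv_pos.2 (by linarith)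
  set D := 2 * C * L / (1 - l) with hD
  have hD0 : 0 < D := by positivity
  refine ⟨q * D, by positivity, ?_⟩
  intro s t B φ hs hst ht hB hφ
  have hts : 0 < t - s := by linarith
  -- Now the singularity sits at the final time: the control is the increment of v ↦ -(t-v)^(1-l),
  -- increasing because l < 1.
  have key : ∀ r u, s ≤ r → r ≤ u → u ≤ t → NormLE (ι l)
      (convGerm S x φ t r ((r + u) / 2) + convGerm S x φ t ((r + u) / 2) u - convGerm S x φ t r u)
      ((u - r) ^ (η + α - 1) * (-(D * B) * (t - u) ^ (1 - l) - -(D * B) * (t - r) ^ (1 - l))) := by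
    intro r u hr hru hu
    rw [convGerm_diff h.scale.semigroup φ (by linarith) (by linarith)]
    rcases hru.eq_or_lt with rfl | hru
    · rw [add_self_div_two, sub_self, zero_smul]
      exact NormLE.zero (by simp)
    set m := (r + u) / 2 with hm
    have htm : 0 < t - m := by rw [hm]; linarith
    have htr : 0 < t - r := by linarith
    have hur : 0 < u - r := by linarith
    refine ((hLb (t - m) ⟨htm, by rw [hm]; linarith⟩ _).smul _).mono ?_
    have h1 := hφ r m hr (by rw [hm]; linarith) (by rw [hm]; linarith)
    have h2 : (m - r) ^ α ≤ (u - r) ^ α :=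
      Real.rpow_le_rpow (by rw [hm]; linarith) (by rw [hm]; linarith) hα0.le
    -- The midpoint stays away from the singularity: t-m ≥ (t-r)/2, since u ≤ t. An arbitrary
    -- intermediate point would not do.
    have h3 : (t - m) ^ (-l) ≤ 2 * (t - r) ^ (-l) := by
      refine le_trans ?_ (half_rpow_neg_le hl.le htr)
      exact Real.rpow_le_rpow_of_nonpos (by linarith) (by rw [hm]; linarith) (by linarith)
    have h4 : |x u - x m| ≤ C * (u - r) ^ η := by
      refine (hx m u (by rw [hm]; linarith) (by rw [hm]; linarith) (by linarith)).trans ?_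
      have : (u - m) ^ η ≤ (u - r) ^ η :=
        Real.rpow_le_rpow (by rw [hm]; linarith) (by rw [hm]; linarith) hη0.le
      gcongr
    have h5 := rpow_sub_rpow_ge (p := 1 - l) (s := t - u) (t := t - r) hl' (by linarith)
      (by linarith) htr
    rw [show t - r - (t - u) = u - r by ring, show 1 - l - 1 = -l by ring] at h5
    have e : (u - r) ^ η * (u - r) ^ α = (u - r) ^ (η + α - 1) * (u - r) := by
      rw [← Real.rpow_add_one hur.ne', sub_add_cancel, Real.rpow_add hur]
    calc |x u - x m| * (L * (t - m) ^ (-l) * ‖φ m - S (m - r) (φ r)‖)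
        ≤ (C * (u - r) ^ η) * (L * (2 * (t - r) ^ (-l)) * (B * (u - r) ^ α)) := by
          gcongr
          exact h1.trans (by gcongr)
      _ = 2 * C * L * B * (t - r) ^ (-l) * ((u - r) ^ η * (u - r) ^ α) := by ring
      _ = (u - r) ^ (η + α - 1) * (D * B * ((1 - l) * (u - r) * (t - r) ^ (-l))) := by
          rw [e, hD]; field_simp
      _ ≤ (u - r) ^ (η + α - 1) * (D * B * ((t - r) ^ (1 - l) - (t - u) ^ (1 - l))) := by gcongr
      _ = _ := by ring
  have := (sew_sub_germ (a := s) (b := t) (j := ι l)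
    (P := fun v => -(D * B) * (t - v) ^ (1 - l)) hκ key le_rfl hst.le le_rfl).2
  refine this.mono (le_of_eq ?_)
  rw [sub_self, Real.zero_rpow hl'.ne', ← hq,
    show η + α - l = (η + α - 1) + (1 - l) by ring, Real.rpow_add hts]
  ring

/-- `‖∫_s^t S(t-r) φ(r) dx(r)‖_{X_α} ≤ K c (t-s)^{η-α}`. -/
theorem exists_convInt_normLE [∀ l, CompleteSpace (E l)] (h : YoungSetting S A ι x η α) :
    ∃ K : ℝ, 0 < K ∧ ∀ (a b c : ℝ) (φ : ℝ → X), 0 ≤ a → b ≤ 1 → MildHolder S α a b c φ →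
      ∀ s t, a ≤ s → s < t → t ≤ b →
      NormLE (ι α) (convInt S x φ s t) (K * c * (t - s) ^ (η - α)) := by
  have hα := h.alpha_lt_one
  have hα0 := h.alpha_pos
  have hη0 := h.eta_pos
  have hαη := h.alpha_lt
  obtain ⟨K₁, hK₁, h₁⟩ := h.exists_convInt_sub_germ_normLE hα0.le hα
  obtain ⟨K₂, hK₂, h₂⟩ := h.exists_convInt_le
  obtain ⟨L, hL, hLb⟩ := h.scale.exists_smoothing hα0.le (by linarith)
  obtain ⟨C, hC, hx⟩ := h.exists_path
  refine ⟨2 * K₁ + 2 * C * L + 2 * L * K₂, by positivity, ?_⟩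
  intro a b c φ ha hb hφ s t hs hst ht
  have hc : 0 ≤ c := hφ.nonneg (by linarith)
  have hts : 0 < t - s := by linarith
  set m := (s + t) / 2 with hm
  have htm : t - m = (t - s) / 2 := by rw [hm]; ring
  have hms : m - s = (t - s) / 2 := by rw [hm]; ring
  have hhalf : ((t - s) / 2) ^ (-α) ≤ 2 * (t - s) ^ (-α) := half_rpow_neg_le hα.le hts
  have hpow : ((t - s) / 2) ^ η ≤ (t - s) ^ η :=
    Real.rpow_le_rpow (by linarith) (by linarith) hη0.le
  have e1 : (t - s) ^ (-α) * (t - s) ^ η = (t - s) ^ (η - α) := by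
    rw [← Real.rpow_add hts]; congr 1; ring
  -- On [m,t] the mild Hölder constant is no longer singular, since u-a ≥ (t-s)/2 there. The part
  -- over [s,m] is smoothed by S(t-m) at the cost (t-s)^(-α).
  rw [h.convInt_add ha hb hφ hs (by rw [hm]; linarith : s ≤ m) (by rw [hm]; linarith : m ≤ t) ht]
  have b1 := h₁ m t (c * (2 * (t - s) ^ (-α))) φ (by linarith) (by linarith) (by linarith)
    (by positivity) (by
      intro r u hr hru hu
      refine (hφ.incr r u (by linarith) hru (by linarith)).trans ?_
      rw [mul_assoc]
      gcongr
      rw [Real.div_rpow (by linarith) (by linarith), div_eq_mul_inv, mul_comm,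
        ← Real.rpow_neg (by linarith)]
      have : (u - a) ^ (-α) ≤ 2 * (t - s) ^ (-α) :=
        (Real.rpow_le_rpow_of_nonpos (by linarith) (by linarith) (by linarith)).trans hhalf
      have : 0 ≤ (u - r) ^ α := Real.rpow_nonneg (by linarith) _
      gcongr)
  have b2 := (hLb (t - m) ⟨by linarith, by linarith⟩ (φ m)).smul (x t - x m)
  have b3 := hLb (t - m) ⟨by linarith, by linarith⟩ (convInt S x φ s m)
  have hx1 := hx m t (by linarith) (by linarith) (by linarith)
  have hK := h₂ a b c φ ha hb hφ s m hs (by linarith) (by linarith)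
  have hφm := hφ.bdd m (by linarith) (by linarith)
  rw [show η + α - α = η by ring] at b1
  rw [htm] at b1 b2 b3 hx1 ⊢
  rw [hms] at hK
  have hb1 := b1.mono (d := 2 * K₁ * c * (t - s) ^ (η - α)) (by
    rw [← e1]
    calc K₁ * (c * (2 * (t - s) ^ (-α))) * ((t - s) / 2) ^ η
        ≤ K₁ * (c * (2 * (t - s) ^ (-α))) * (t - s) ^ η := by gcongr
      _ = _ := by ring)
  have hb2 := b2.mono (d := 2 * C * L * c * (t - s) ^ (η - α)) (by
    rw [← e1]
    calc |x t - x m| * (L * ((t - s) / 2) ^ (-α) * ‖φ m‖)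
        ≤ (C * (t - s) ^ η) * (L * (2 * (t - s) ^ (-α)) * c) := by
          gcongr
          exact hx1.trans (by gcongr)
      _ = _ := by ring)
  have hb3 := b3.mono (d := 2 * L * K₂ * c * (t - s) ^ (η - α)) (by
    rw [← e1]
    calc L * ((t - s) / 2) ^ (-α) * ‖convInt S x φ s m‖
        ≤ L * (2 * (t - s) ^ (-α)) * (K₂ * c * (t - s) ^ η) := by
          gcongr
          exact hK.trans (by gcongr)
      _ = _ := by ring)
  convert (hb1.add hb2).add hb3 using 1
  · abel
  · ring

end YoungSetting

/-- Uniqueness of the convolution integral. -/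
theorem YoungSetting.eq_convInt (h : YoungSetting S A ι x η α) {a b c : ℝ} {φ : ℝ → X} (ha : 0 ≤ a)
    (hb : b ≤ 1) (hφ : MildHolder S α a b c φ) {k : ℝ → ℝ → X} {C μ : ℝ} (hμ : 1 < μ)
    (hk : ∀ r s t, a ≤ r → r ≤ s → s ≤ t → t ≤ b → k r t = k s t + S (t - s) (k r s))
    (hk2 : ∀ s t, a ≤ s → s ≤ t → t ≤ b →
      ‖k s t - (x t - x s) • S (t - s) (φ s)‖ ≤ C * (t - s) ^ μ)
    {s t : ℝ} (hs : a ≤ s) (hst : s ≤ t) (ht : t ≤ b) : k s t = convInt S x φ s t := by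
  obtain ⟨K, hK, hle⟩ := h.exists_convInt_sub_germ_le
  obtain ⟨L, hL, hLb⟩ := h.scale.exists_bound
  have hα := h.alpha_lt_one
  have hκ0 : 0 < η + α - 1 := by linarith [h.sum_gt]
  have hc : 0 ≤ c := hφ.nonneg (by linarith)
  set κ := min (η + α - 1) (μ - 1) with hκ
  have hκ' : 0 < κ := lt_min hκ0 (by linarith)
  set C' := max C 0 with hC'
  have hC0 : 0 ≤ C' := le_max_right _ _
  have hD : ∀ r s, a ≤ r → r ≤ s → s ≤ t → ‖S (t - s) (k r s - convInt S x φ r s)‖ ≤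
      (s - r) ^ κ * ((L * (K * c * (s - a) ^ (1 - α)) + L * C' * s) -
        (L * (K * c * (r - a) ^ (1 - α)) + L * C' * r)) := by
    intro r s hr hrs hs
    rcases hrs.eq_or_lt with rfl | hrs
    · have h0 := hk r r r hr le_rfl le_rfl (hs.trans ht)
      rw [sub_self, h.scale.semigroup.zero_apply] at h0
      have h1 : k r r = 0 := by simpa using h0
      rw [h1, convInt_self, sub_self, map_zero]
      simp
    have hsr : 0 < s - r := by linarith
    refine (hLb _ ⟨by linarith, by linarith⟩ _).trans ?_
    have h1 := hle a b c φ ha hb hφ r s hr hrs.le (hs.trans ht)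
    have h2 := hk2 r s hr hrs.le (hs.trans ht)
    have e : k r s - convInt S x φ r s = (k r s - (x s - x r) • S (s - r) (φ r)) -
      (convInt S x φ r s - (x s - x r) • S (s - r) (φ r)) := by abel
    have p1 : (s - r) ^ (η + α - 1) ≤ (s - r) ^ κ := rpow_anti hsr (by linarith) (min_le_left _ _)
    have p2 : (s - r) ^ μ ≤ (s - r) ^ κ * (s - r) := by
      have := rpow_anti hsr (by linarith) (min_le_right (η + α - 1) (μ - 1))
      calc (s - r) ^ μ = (s - r) ^ (μ - 1) * (s - r) := by
            rw [← Real.rpow_add_one hsr.ne', sub_add_cancel]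
        _ ≤ _ := by gcongr
    have p3 : (r - a) ^ (1 - α) ≤ (s - a) ^ (1 - α) :=
      Real.rpow_le_rpow (by linarith) (by linarith) (by linarith)
    rw [← mul_sub] at h1
    have p4 : 0 ≤ (s - a) ^ (1 - α) - (r - a) ^ (1 - α) := by linarith
    have h3 : ‖k r s - convInt S x φ r s‖ ≤ C' * ((s - r) ^ κ * (s - r)) +
        (s - r) ^ κ * (K * c * ((s - a) ^ (1 - α) - (r - a) ^ (1 - α))) := by
      rw [e]
      refine (norm_sub_le _ _).trans (add_le_add (h2.trans ?_) (h1.trans (by gcongr)))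
      calc C * (s - r) ^ μ ≤ C' * (s - r) ^ μ := by gcongr; exact le_max_left _ _
        _ ≤ _ := by gcongr
    calc L * ‖k r s - convInt S x φ r s‖ ≤ L * _ := mul_le_mul_of_nonneg_left h3 (by linarith)
      _ = _ := by ring
  have hadd : ∀ r s u, a ≤ r → r ≤ s → s ≤ u → u ≤ t →
      S (t - u) (k r u - convInt S x φ r u) =
        S (t - s) (k r s - convInt S x φ r s) + S (t - u) (k s u - convInt S x φ s u) := by
    intro r s u hr hrs hsu hu
    rw [hk r s u hr hrs hsu (hu.trans ht), h.convInt_add ha hb hφ hr hrs hsu (hu.trans ht),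
      ← h.scale.semigroup.comp_apply hsu hu]
    simp only [map_add, map_sub]
    abel
  -- Applying S(t-s) with t frozen turns the twisted cocycle relation into plain additivity. The
  -- exponent κ and the weight serve both remainders at once.
  have hz := eq_zero_of_midpoint (D := fun r s => S (t - s) (k r s - convInt S x φ r s))
    (P := fun s => L * (K * c * (s - a) ^ (1 - α)) + L * C' * s) (a := a) (b := t) hκ'
    (fun r s hr hrs hs => hadd r _ s hr (by linarith) (by linarith) hs) hD hs hst le_rfl
  simp only [sub_self, h.scale.semigroup.zero_apply] at hz
  exact sub_eq_zero.1 hz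

end Conv

/-! ### The weighted class of solutions -/

section Class

open Filter Topology

variable {X : Type*} [NormedAddCommGroup X] [NormedSpace ℝ X]
  {E : ℝ → Type*} [∀ l, NormedAddCommGroup (E l)] [∀ l, NormedSpace ℝ (E l)]
  {S : ℝ → X →L[ℝ] X} {A : X →ₗ.[ℝ] X} {ι : ∀ l : ℝ, E l →L[ℝ] X} {x : ℝ → ℝ} {η α : ℝ}

/-- Functions on `[a,1]` which are bounded in `X`, of size `(t-a)^{-α}` in `X_α` and `α`-Hölder
continuous in `X` with a constant of size `(s-a)^{-α}`, all this relative to the weight `ω`. -/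
structure SolClass (ι : ∀ l : ℝ, E l →L[ℝ] X) (α a : ℝ) (ω : ℝ → ℝ) (c : ℝ) (y : ℝ → X) : Prop where
  mem : ∀ t, a < t → t ≤ 1 → NormLE (ι α) (y t) (c * ω t * (t - a) ^ (-α))
  bdd : ∀ t, a ≤ t → t ≤ 1 → ‖y t‖ ≤ c * ω t
  incr : ∀ s t, a < s → s < t → t ≤ 1 → ‖y t - y s‖ * (s - a) ^ α ≤ c * ω t * (t - s) ^ α

/-- Nondecreasing weights which are at least `1` on `[0,∞)`. -/
structure IsWeight (ω : ℝ → ℝ) : Prop where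
  mono : Monotone ω
  one_le : ∀ t, 0 ≤ t → 1 ≤ ω t

theorem isWeight_one : IsWeight fun _ => 1 := ⟨fun _ _ _ => le_rfl, fun _ _ => le_rfl⟩

theorem isWeight_exp {δ : ℝ} (hδ : 0 < δ) : IsWeight fun t => Real.exp (t / δ) := by
  refine ⟨fun s t h => Real.exp_le_exp.2 (by gcongr), fun t ht => Real.one_le_exp (by positivity)⟩

namespace SolClass

variable {a c d : ℝ} {ω : ℝ → ℝ} {y z : ℝ → X}

theorem nonneg (h : SolClass ι α a ω c y) (hω : IsWeight ω) (ha : 0 ≤ a) (ha1 : a ≤ 1) : 0 ≤ c := by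
  have h1 := (norm_nonneg _).trans (h.bdd a le_rfl ha1)
  exact nonneg_of_mul_nonneg_left h1 (by linarith [hω.one_le a ha])

theorem mono (h : SolClass ι α a ω c y) {ω' : ℝ → ℝ}
    (hcd : ∀ t, a ≤ t → t ≤ 1 → c * ω t ≤ d * ω' t) : SolClass ι α a ω' d y where
  mem t h1 h2 := (h.mem t h1 h2).mono
    (mul_le_mul_of_nonneg_right (hcd t h1.le h2) (Real.rpow_nonneg (by linarith) _))
  bdd t h1 h2 := (h.bdd t h1 h2).trans (hcd t h1 h2)
  incr s t h1 h2 h3 := (h.incr s t h1 h2 h3).trans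
    (mul_le_mul_of_nonneg_right (hcd t (by linarith) h3) (Real.rpow_nonneg (by linarith) _))

theorem mono_const (h : SolClass ι α a ω c y) (hω : IsWeight ω) (ha : 0 ≤ a) (hcd : c ≤ d) :
    SolClass ι α a ω d y :=
  h.mono fun t h1 _ => mul_le_mul_of_nonneg_right hcd (by linarith [hω.one_le t (ha.trans h1)])

theorem to_one (h : SolClass ι α a ω c y) (hω : IsWeight ω) (ha : 0 ≤ a) (ha1 : a ≤ 1) :
    SolClass ι α a (fun _ => 1) (c * ω 1) y :=
  h.mono fun t _ h2 => by
    rw [mul_one]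
    exact mul_le_mul_of_nonneg_left (hω.mono h2) (h.nonneg hω ha ha1)

theorem of_one (h : SolClass ι α a (fun _ => 1) c y) (hω : IsWeight ω) (ha : 0 ≤ a) (ha1 : a ≤ 1) :
    SolClass ι α a ω c y :=
  h.mono fun t h1 _ =>
    mul_le_mul_of_nonneg_left (hω.one_le t (ha.trans h1)) (h.nonneg isWeight_one ha ha1)

theorem congr (h : SolClass ι α a ω c y) (hyz : ∀ t, a ≤ t → t ≤ 1 → y t = z t) :
    SolClass ι α a ω c z where
  mem t h1 h2 := hyz t h1.le h2 ▸ h.mem t h1 h2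
  bdd t h1 h2 := hyz t h1 h2 ▸ h.bdd t h1 h2
  incr s t h1 h2 h3 := by
    rw [← hyz t (by linarith) h3, ← hyz s h1.le (by linarith)]
    exact h.incr s t h1 h2 h3

theorem add (hy : SolClass ι α a ω c y) (hz : SolClass ι α a ω d z) :
    SolClass ι α a ω (c + d) (fun t => y t + z t) where
  mem t h1 h2 := ((hy.mem t h1 h2).add (hz.mem t h1 h2)).mono (le_of_eq (by ring))
  bdd t h1 h2 := (norm_add_le _ _).trans
    ((add_le_add (hy.bdd t h1 h2) (hz.bdd t h1 h2)).trans (le_of_eq (by ring)))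
  incr s t h1 h2 h3 := by
    have e : y t + z t - (y s + z s) = (y t - y s) + (z t - z s) := by abel
    rw [e]
    have h0 : 0 ≤ (s - a) ^ α := Real.rpow_nonneg (by linarith) _
    calc _ ≤ (‖y t - y s‖ + ‖z t - z s‖) * (s - a) ^ α := by gcongr; exact norm_add_le _ _
      _ = ‖y t - y s‖ * (s - a) ^ α + ‖z t - z s‖ * (s - a) ^ α := by ring
      _ ≤ _ := add_le_add (hy.incr s t h1 h2 h3) (hz.incr s t h1 h2 h3)
      _ = _ := by ring

theorem neg (hy : SolClass ι α a ω c y) : SolClass ι α a ω c (fun t => -y t) where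
  mem t h1 h2 := (hy.mem t h1 h2).neg
  bdd t h1 h2 := by rw [norm_neg]; exact hy.bdd t h1 h2
  incr s t h1 h2 h3 := by
    rw [neg_sub_neg, norm_sub_rev]; exact hy.incr s t h1 h2 h3

theorem sub (hy : SolClass ι α a ω c y) (hz : SolClass ι α a ω d z) :
    SolClass ι α a ω (c + d) (fun t => y t - z t) := by
  simpa only [sub_eq_add_neg] using hy.add hz.neg

theorem tsum [CompleteSpace X] [CompleteSpace (E α)] {u : ℕ → ℝ → X} {c : ℕ → ℝ}
    (h : ∀ n, SolClass ι α a ω (c n) (u n)) (hc : Summable c) :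
    (∀ t, a ≤ t → t ≤ 1 → Summable fun n => u n t) ∧
      SolClass ι α a ω (∑' n, c n) (fun t => ∑' n, u n t) := by
  have hs : ∀ t, a ≤ t → t ≤ 1 → Summable fun n => u n t := fun t h1 h2 =>
    Summable.of_norm_bounded (hc.mul_right (ω t)) fun n => (h n).bdd t h1 h2
  refine ⟨hs, ?_, ?_, ?_⟩
  · intro t h1 h2
    have := (NormLE.tsum (fun n => (h n).mem t h1 h2) ((hc.mul_right _).mul_right _)).2
    rwa [tsum_mul_right, tsum_mul_right] at this
  · intro t h1 h2
    have := tsum_of_norm_bounded (hc.mul_right (ω t)).hasSum fun n => (h n).bdd t h1 h2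
    rwa [tsum_mul_right] at this
  · intro s t h1 h2 h3
    have hp : 0 < (s - a) ^ α := Real.rpow_pos_of_pos (by linarith) _
    rw [← (hs t (by linarith) h3).tsum_sub (hs s h1.le (by linarith)), ← le_div_iff₀ hp]
    have hsum : HasSum (fun n => c n * ω t * (t - s) ^ α / (s - a) ^ α)
        ((∑' n, c n) * ω t * (t - s) ^ α / (s - a) ^ α) :=
      ((hc.hasSum.mul_right (ω t)).mul_right _).div_const _
    refine tsum_of_norm_bounded hsum fun n => ?_
    rw [le_div_iff₀ hp]
    exact (h n).incr s t h1 h2 h3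

end SolClass

/-- For t-s ≤ s-a, the distances s-a and t-a are comparable, and S(t-s)-I is controlled by the X_α
norm of φ(s). Otherwise (t-s)/(t-a) ≥ 1/2, and boundedness suffices. The outcome is singular in t-a
rather than s-a, so s = a is allowed. -/
theorem YoungSetting.exists_mildHolder (h : YoungSetting S A ι x η α) :
    ∃ K : ℝ, 0 < K ∧ ∀ (a c : ℝ) (ω : ℝ → ℝ) (φ : ℝ → X), 0 ≤ a → IsWeight ω →
      SolClass ι α a ω c φ → ∀ b, a ≤ b → b ≤ 1 → MildHolder S α a b (K * c * ω b) φ := by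
  obtain ⟨L, hL, hLb⟩ := h.scale.exists_bound
  have hα := h.alpha_lt_one
  have hα0 := h.alpha_pos
  obtain ⟨C, hC, hap⟩ := h.scale.exists_approx hα0 hα.le
  refine ⟨2 * (1 + C) + 2 * (1 + L), by positivity, ?_⟩
  intro a c ω φ ha hω hφ b hab hb
  have hc := hφ.nonneg hω ha (hab.trans hb)
  have hωb : ∀ t, t ≤ b → c * ω t ≤ c * ω b := fun t ht => by
    have := hω.mono ht
    gcongr
  have hωb0 : 0 ≤ ω b := by linarith [hω.one_le b (ha.trans hab)]
  have hcω : 0 ≤ c * ω b := by positivity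
  constructor
  · intro t h1 h2
    refine (hφ.bdd t h1 (h2.trans hb)).trans ((hωb t h2).trans ?_)
    nlinarith
  · intro s t h1 h2 h3
    have hta : 0 < t - a := by linarith
    have hts : 0 < t - s := by linarith
    have hrough : ‖φ t - S (t - s) (φ s)‖ ≤ (1 + L) * (c * ω b) := by
      refine (norm_sub_le _ _).trans ?_
      have b1 := (hφ.bdd t (by linarith) (h3.trans hb)).trans (hωb t h3)
      have b2 := (hφ.bdd s h1 (by linarith)).trans (hωb s (by linarith))
      have b3 := (hLb (t - s) ⟨by linarith, by linarith⟩ (φ s)).trans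
        (mul_le_mul_of_nonneg_left b2 (by linarith))
      linarith
    rcases le_or_gt (t - s) (s - a) with hcase | hcase
    · have hsa : 0 < s - a := by linarith
      have hneg : (s - a) ^ (-α) ≤ 2 * (t - a) ^ (-α) := by
        refine le_trans ?_ (half_rpow_neg_le hα.le hta)
        exact Real.rpow_le_rpow_of_nonpos (by linarith) (by linarith) (by linarith)
      have b1 : ‖φ t - φ s‖ ≤ c * ω b * (t - s) ^ α * (s - a) ^ (-α) := by
        rw [Real.rpow_neg hsa.le, ← div_eq_mul_inv, le_div_iff₀ (by positivity)]
        refine (hφ.incr s t (by linarith) h2 (h3.trans hb)).trans ?_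
        have := hωb t h3
        gcongr
      have b2 := hap (t - s) ⟨hts.le, by linarith⟩ _ _ (hφ.mem s (by linarith) (by linarith))
      have b3 : c * ω s ≤ c * ω b := hωb s (by linarith)
      have e : φ t - S (t - s) (φ s) = (φ t - φ s) - (S (t - s) (φ s) - φ s) := by abel
      rw [e, Real.div_rpow hts.le hta.le, div_eq_mul_inv, ← Real.rpow_neg hta.le]
      have hp : 0 ≤ (t - s) ^ α := by positivity
      have hq : 0 ≤ (t - a) ^ (-α) := by positivity
      calc _ ≤ ‖φ t - φ s‖ + ‖S (t - s) (φ s) - φ s‖ := norm_sub_le _ _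
        _ ≤ c * ω b * (t - s) ^ α * (2 * (t - a) ^ (-α)) +
            C * (t - s) ^ α * (c * ω b * (2 * (t - a) ^ (-α))) := by
          refine add_le_add (b1.trans (by gcongr)) (b2.trans ?_)
          gcongr
        _ = 2 * (1 + C) * (c * ω b * ((t - s) ^ α * (t - a) ^ (-α))) := by ring
        _ ≤ (2 * (1 + C) + 2 * (1 + L)) * (c * ω b * ((t - s) ^ α * (t - a) ^ (-α))) := by
          gcongr
          linarith
        _ = _ := by ring
    · have hratio : 1 / 2 ≤ ((t - s) / (t - a)) ^ α := by
        calc (1 / 2 : ℝ) = (1 / 2 : ℝ) ^ (1 : ℝ) := by simp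
          _ ≤ (1 / 2 : ℝ) ^ α := rpow_anti (by norm_num) (by norm_num) hα.le
          _ ≤ _ := by
            refine Real.rpow_le_rpow (by norm_num) ?_ hα0.le
            rw [div_le_div_iff₀ (by norm_num) hta]
            linarith
      refine hrough.trans ?_
      calc (1 + L) * (c * ω b) = 2 * (1 + L) * (c * ω b) * (1 / 2) := by ring
        _ ≤ 2 * (1 + L) * (c * ω b) * ((t - s) / (t - a)) ^ α := by gcongr
        _ ≤ _ := by
          rw [mul_assoc _ c]
          gcongr
          linarith

theorem YoungSetting.exists_solClass_datum (h : YoungSetting S A ι x η α) :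
    ∃ K : ℝ, 0 < K ∧ ∀ (a : ℝ) (ψ : X), 0 ≤ a →
      SolClass ι α a (fun _ => 1) (K * ‖ψ‖) (fun t => S (t - a) ψ) := by
  obtain ⟨L, hL, hLb⟩ := h.scale.exists_bound
  have hα := h.alpha_lt_one
  have hα0 := h.alpha_pos
  obtain ⟨C, hC, hap⟩ := h.scale.exists_approx hα0 hα.le
  obtain ⟨L', hL', hsm⟩ := h.scale.exists_smoothing hα0.le (by linarith)
  refine ⟨L + L' + C * L', by positivity, fun a ψ ha => ⟨?_, ?_, ?_⟩⟩
  · intro t h1 h2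
    refine (hsm (t - a) ⟨by linarith, by linarith⟩ ψ).mono ?_
    have : 0 ≤ (t - a) ^ (-α) := Real.rpow_nonneg (by linarith) _
    calc L' * (t - a) ^ (-α) * ‖ψ‖ = L' * ‖ψ‖ * 1 * (t - a) ^ (-α) := by ring
      _ ≤ _ := by
        gcongr
        nlinarith [mul_pos hC hL']
  · intro t h1 h2
    refine (hLb (t - a) ⟨by linarith, by linarith⟩ ψ).trans ?_
    rw [mul_one]
    gcongr
    nlinarith [mul_pos hC hL']
  · intro s t h1 h2 h3
    have hsa : 0 < s - a := by linarith
    have b1 := hap (t - s) ⟨by linarith, by linarith⟩ _ _ (hsm (s - a) ⟨hsa, by linarith⟩ ψ)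
    rw [h.scale.semigroup.comp_apply h1.le h2.le] at b1
    have e : (s - a) ^ (-α) * (s - a) ^ α = 1 := by
      rw [← Real.rpow_add hsa, neg_add_cancel, Real.rpow_zero]
    calc _ ≤ (C * (t - s) ^ α * (L' * (s - a) ^ (-α) * ‖ψ‖)) * (s - a) ^ α := by gcongr
      _ = C * L' * ‖ψ‖ * 1 * (t - s) ^ α * ((s - a) ^ (-α) * (s - a) ^ α) := by ring
      _ = C * L' * ‖ψ‖ * 1 * (t - s) ^ α := by rw [e, mul_one]
      _ ≤ _ := by
        have : 0 ≤ (t - s) ^ α := Real.rpow_nonneg (by linarith) _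
        gcongr
        linarith

/-- The convolution integral maps into the class, with a small constant for steep weights. -/
theorem YoungSetting.exists_solClass_convInt [CompleteSpace X] [∀ l, CompleteSpace (E l)]
    (h : YoungSetting S A ι x η α) :
    ∃ K : ℝ, 0 < K ∧ ∀ (a c δ : ℝ) (φ : ℝ → X), 0 ≤ a → a ≤ 1 → 0 < δ → δ ≤ 1 →
      (∀ b, a ≤ b → b ≤ 1 → MildHolder S α a b (c * Real.exp (b / δ)) φ) →
      SolClass ι α a (fun t => Real.exp (t / δ)) (K * c * δ ^ (η - α))
        (fun t => convInt S x φ a t) := by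
  obtain ⟨L, hL, hLb⟩ := h.scale.exists_bound
  have hα := h.alpha_lt_one
  have hα0 := h.alpha_pos
  have hη0 := h.eta_pos
  have hαη := h.alpha_lt
  obtain ⟨C, hC, hap⟩ := h.scale.exists_approx hα0 hα.le
  obtain ⟨L', hL', hsm⟩ := h.scale.exists_smoothing hα0.le (by linarith)
  obtain ⟨K₂, hK₂, h₂⟩ := h.exists_convInt_le
  obtain ⟨K₃, hK₃, h₃⟩ := h.exists_convInt_normLE
  set K' := K₃ + 2 * L' * L * K₂ with hK'
  have hK'0 : 0 < K' := by positivity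
  refine ⟨K' + K₂ + C * K' + 4 * L * K₂, by positivity, ?_⟩
  intro a c δ φ ha ha1 hδ hδ1 hφ
  set ω : ℝ → ℝ := fun t => Real.exp (t / δ) with hω
  have hω0 : ∀ t, 0 < ω t := fun t => Real.exp_pos _
  have hωm : Monotone ω := (isWeight_exp hδ).mono
  have hc : 0 ≤ c := by
    have := (hφ a le_rfl ha1).nonneg le_rfl
    exact nonneg_of_mul_nonneg_left this (hω0 a)
  -- A step δ back in time halves the weight, because e ≥ 2; contributions of earlier steps
  -- therefore form a geometric series.
  have hωδ : ∀ t, ω (t - δ) ≤ ω t / 2 := by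
    intro t
    have e1 : (t - δ) / δ = t / δ - 1 := by field_simp
    have e2 : (2 : ℝ) ≤ Real.exp 1 := by linarith [Real.add_one_le_exp 1]
    simp only [hω]
    rw [e1, Real.exp_sub]
    have := Real.exp_pos (t / δ)
    gcongr
  have hadd : ∀ r s t, a ≤ r → r ≤ s → s ≤ t → t ≤ 1 →
      convInt S x φ r t = convInt S x φ s t + S (t - s) (convInt S x φ r s) :=
    fun r s t h1 h2 h3 h4 => h.convInt_add ha h4 (hφ t (by linarith) h4) h1 h2 h3 le_rfl
  have hk2 : ∀ s t, a ≤ s → s ≤ t → t ≤ 1 →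
      ‖convInt S x φ s t‖ ≤ K₂ * (c * ω t) * (t - s) ^ η :=
    fun s t h1 h2 h3 => h₂ a t _ φ ha h3 (hφ t (by linarith) h3) s t h1 h2 le_rfl
  have hk3 : ∀ s t, a ≤ s → s < t → t ≤ 1 →
      NormLE (ι α) (convInt S x φ s t) (K₃ * (c * ω t) * (t - s) ^ (η - α)) :=
    fun s t h1 h2 h3 => h₃ a t _ φ ha h3 (hφ t (by linarith) h3) s t h1 h2 le_rfl
  have hδη : δ ^ η ≤ δ ^ (η - α) := rpow_anti hδ hδ1 (by linarith)
  have hδ0 : 0 < δ ^ (η - α) := by positivity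
  -- Induction on the number of steps of length δ. Carrying the extra S(v) lets the semigroups merge
  -- into S(v+δ), so that the bound L of S enters only once instead of as a power.
  have hiter : ∀ (n : ℕ) (t : ℝ), a ≤ t → t ≤ 1 → t - a ≤ n * δ → ∀ v, 0 ≤ v → v + t ≤ 1 →
      ‖S v (convInt S x φ a t)‖ ≤ 2 * L * K₂ * c * ω t * δ ^ η := by
    have hbase : ∀ t, a ≤ t → t ≤ 1 → t - a ≤ δ → ∀ v, 0 ≤ v → v + t ≤ 1 →
        ‖S v (convInt S x φ a t)‖ ≤ 2 * L * K₂ * c * ω t * δ ^ η := by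
      intro t h1 h2 h3 v hv hvt
      have hp : (t - a) ^ η ≤ δ ^ η := Real.rpow_le_rpow (by linarith) h3 hη0.le
      have := hω0 t
      calc _ ≤ L * ‖convInt S x φ a t‖ := hLb v ⟨hv, by linarith⟩ _
        _ ≤ L * (K₂ * (c * ω t) * δ ^ η) := by
          gcongr
          exact (hk2 a t le_rfl h1 h2).trans (by gcongr)
        _ = L * K₂ * c * ω t * δ ^ η := by ring
        _ ≤ _ := by
          have : 0 ≤ L * K₂ * c * ω t * δ ^ η := by positivity
          linarith
    intro n
    induction n with
    | zero =>
      intro t h1 h2 h3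
      exact hbase t h1 h2 (h3.trans (by simpa using hδ.le))
    | succ n ih =>
      intro t h1 h2 h3 v hv hvt
      rcases le_or_gt (t - a) δ with hcase | hcase
      · exact hbase t h1 h2 hcase v hv hvt
      have i1 := ih (t - δ) (by linarith) (by linarith) (by push_cast at h3; linarith) (v + δ)
        (by linarith) (by linarith)
      have i2 := hk2 (t - δ) t (by linarith) (by linarith) h2
      rw [sub_sub_cancel] at i2
      rw [hadd a (t - δ) t le_rfl (by linarith) (by linarith) h2, map_add, sub_sub_cancel,
        ← h.scale.semigroup.add_apply hv hδ.le]
      have i3 := hωδ t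
      have := hω0 t
      calc _ ≤ ‖S v (convInt S x φ (t - δ) t)‖ + ‖S (v + δ) (convInt S x φ a (t - δ))‖ :=
            norm_add_le _ _
        _ ≤ L * (K₂ * (c * ω t) * δ ^ η) + 2 * L * K₂ * c * (ω t / 2) * δ ^ η := by
          refine add_le_add ((hLb v ⟨hv, by linarith⟩ _).trans (by gcongr)) (i1.trans (by gcongr))
        _ = _ := by ring
  have hone : ∀ t, a ≤ t → t ≤ 1 → ‖convInt S x φ a t‖ ≤ 2 * L * K₂ * c * ω t * δ ^ η := by
    intro t h1 h2
    obtain ⟨n, hn⟩ := exists_nat_ge ((t - a) / δ)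
    have := hiter n t h1 h2 ((div_le_iff₀ hδ).1 hn) 0 le_rfl (by linarith)
    rwa [h.scale.semigroup.zero_apply] at this
  have htwo : ∀ t, a < t → t ≤ 1 → NormLE (ι α) (convInt S x φ a t)
      (K' * c * δ ^ (η - α) * ω t * (t - a) ^ (-α)) := by
    intro t h1 h2
    have hta : 0 < t - a := by linarith
    have hta1 := one_le_rpow_neg hα0.le hta (by linarith)
    have hωt := hω0 t
    -- Close to a, the X_α bound of the integral is used directly. Otherwise only the last step of
    -- length δ is estimated that way, and the past is smoothed by S(δ): δ^(-α)·δ^η = δ^(η-α).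
    rcases le_or_gt (t - a) δ with hcase | hcase
    · refine (hk3 a t le_rfl h1 h2).mono ?_
      have hp : (t - a) ^ η ≤ δ ^ (η - α) :=
        (Real.rpow_le_rpow hta.le hcase hη0.le).trans hδη
      have e : (t - a) ^ (η - α) = (t - a) ^ η * (t - a) ^ (-α) := by
        rw [← Real.rpow_add hta]; congr 1
      rw [e]
      calc K₃ * (c * ω t) * ((t - a) ^ η * (t - a) ^ (-α))
          ≤ K₃ * (c * ω t) * (δ ^ (η - α) * (t - a) ^ (-α)) := by gcongr
        _ = K₃ * (c * δ ^ (η - α) * ω t * (t - a) ^ (-α)) := by ring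
        _ ≤ K' * (c * δ ^ (η - α) * ω t * (t - a) ^ (-α)) := by
          gcongr
          rw [hK']
          have : 0 ≤ 2 * L' * L * K₂ := by positivity
          linarith
        _ = _ := by ring
    · rw [hadd a (t - δ) t le_rfl (by linarith) (by linarith) h2, sub_sub_cancel]
      have i1 := hk3 (t - δ) t (by linarith) (by linarith) h2
      rw [sub_sub_cancel] at i1
      have i2 := hsm δ ⟨hδ, hδ1⟩ (convInt S x φ a (t - δ))
      have i3 := hone (t - δ) (by linarith) (by linarith)
      refine (i1.add i2).mono ?_
      have i4 : ω (t - δ) ≤ ω t := hωm (by linarith)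
      have e : δ ^ (-α) * δ ^ η = δ ^ (η - α) := by
        rw [← Real.rpow_add hδ]; congr 1; ring
      calc K₃ * (c * ω t) * δ ^ (η - α) + L' * δ ^ (-α) * ‖convInt S x φ a (t - δ)‖
          ≤ K₃ * (c * ω t) * δ ^ (η - α) + L' * δ ^ (-α) * (2 * L * K₂ * c * ω t * δ ^ η) := by
            gcongr
            exact i3.trans (by gcongr)
        _ = K₃ * (c * ω t) * δ ^ (η - α) + 2 * L' * L * K₂ * c * ω t * (δ ^ (-α) * δ ^ η) := by
            ring
        _ = K' * c * δ ^ (η - α) * ω t * 1 := by rw [e, hK']; ring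
        _ ≤ _ := by gcongr
  have hsum : ∀ B t, B ≤ K' + K₂ + C * K' + 4 * L * K₂ → B * c * δ ^ (η - α) * ω t ≤
      (K' + K₂ + C * K' + 4 * L * K₂) * c * δ ^ (η - α) * ω t := by
    intro B t hB
    have := hω0 t
    gcongr
  have q1 : 0 < C * K' := by positivity
  have q2 : 0 < L * K₂ := by positivity
  refine ⟨?_, ?_, ?_⟩
  · intro t h1 h2
    refine (htwo t h1 h2).mono ?_
    have : 0 ≤ (t - a) ^ (-α) := Real.rpow_nonneg (by linarith) _
    have := hsum K' t (by nlinarith)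
    gcongr
  · intro t h1 h2
    refine (hone t h1 h2).trans (le_trans ?_ (hsum (2 * L * K₂) t (by nlinarith)))
    have := hω0 t
    calc 2 * L * K₂ * c * ω t * δ ^ η ≤ 2 * L * K₂ * c * ω t * δ ^ (η - α) := by gcongr
      _ = _ := by ring
  · intro s t h1 h2 h3
    have hsa : 0 < s - a := by linarith
    have hts : 0 < t - s := by linarith
    have hsa1 : (s - a) ^ α ≤ 1 := rpow_le_one_of_mem hα0.le hsa.le (by linarith)
    have hωt := hω0 t
    have hωst : ω s ≤ ω t := hωm h2.le
    -- For short increments, (t-s)^(η-α) ≤ δ^(η-α) supplies the gain; for long ones the sup bound of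
    -- order δ^η is enough, since δ^α ≤ (t-s)^α.
    rcases le_or_gt (t - s) δ with hcase | hcase
    · have e : convInt S x φ a t - convInt S x φ a s = convInt S x φ s t +
          (S (t - s) (convInt S x φ a s) - convInt S x φ a s) := by
        rw [hadd a s t le_rfl h1.le h2.le h3]; abel
      rw [e]
      have i1 := hk2 s t h1.le h2.le h3
      have i2 := hap (t - s) ⟨hts.le, by linarith⟩ _ _ (htwo s h1 (by linarith))
      have i3 : (t - s) ^ η ≤ (t - s) ^ α * δ ^ (η - α) := by
        calc (t - s) ^ η = (t - s) ^ α * (t - s) ^ (η - α) := by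
              rw [← Real.rpow_add hts]; congr 1; ring
          _ ≤ _ := by
            have := Real.rpow_le_rpow hts.le hcase (by linarith : 0 ≤ η - α)
            gcongr
      have e2 : (s - a) ^ (-α) * (s - a) ^ α = 1 := by
        rw [← Real.rpow_add hsa, neg_add_cancel, Real.rpow_zero]
      calc _ ≤ (‖convInt S x φ s t‖ + ‖S (t - s) (convInt S x φ a s) - convInt S x φ a s‖) *
            (s - a) ^ α := by gcongr; exact norm_add_le _ _
        _ = ‖convInt S x φ s t‖ * (s - a) ^ α +
            ‖S (t - s) (convInt S x φ a s) - convInt S x φ a s‖ * (s - a) ^ α := by ring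
        _ ≤ K₂ * (c * ω t) * ((t - s) ^ α * δ ^ (η - α)) * 1 +
            C * (t - s) ^ α * (K' * c * δ ^ (η - α) * ω t * (s - a) ^ (-α)) * (s - a) ^ α := by
          refine add_le_add (mul_le_mul (i1.trans (by gcongr)) hsa1 (by positivity)
            (by positivity)) ?_
          gcongr
          exact i2.trans (by gcongr)
        _ = K₂ * (c * ω t) * ((t - s) ^ α * δ ^ (η - α)) +
            C * (t - s) ^ α * (K' * c * δ ^ (η - α) * ω t) * ((s - a) ^ (-α) * (s - a) ^ α) := by
          ring
        _ = (K₂ + C * K') * c * δ ^ (η - α) * ω t * (t - s) ^ α := by rw [e2]; ring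
        _ ≤ _ := by
          have := hsum (K₂ + C * K') t (by nlinarith)
          gcongr
    · have i1 := hone t (by linarith) h3
      have i2 := hone s h1.le (by linarith)
      have i3 : δ ^ η ≤ (t - s) ^ α * δ ^ (η - α) := by
        calc δ ^ η = δ ^ α * δ ^ (η - α) := by
              rw [← Real.rpow_add hδ]; congr 1; ring
          _ ≤ _ := by
            have := Real.rpow_le_rpow hδ.le hcase.le hα0.le
            gcongr
      calc _ ≤ (‖convInt S x φ a t‖ + ‖convInt S x φ a s‖) * 1 := by
            gcongr
            exact norm_sub_le _ _
        _ ≤ (2 * L * K₂ * c * ω t * δ ^ η + 2 * L * K₂ * c * ω t * δ ^ η) * 1 := by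
            gcongr
            exact i2.trans (by gcongr)
        _ = 4 * L * K₂ * c * ω t * δ ^ η := by ring
        _ ≤ 4 * L * K₂ * c * ω t * ((t - s) ^ α * δ ^ (η - α)) := by gcongr
        _ = (4 * L * K₂) * c * δ ^ (η - α) * ω t * (t - s) ^ α := by ring
        _ ≤ _ := by
          have := hsum (4 * L * K₂) t (by nlinarith)
          gcongr

end Class

/-! ### The nonlinearity -/

section Nonlinearity

open Filter Topology

variable {X : Type*} [NormedAddCommGroup X] [NormedSpace ℝ X]
  {E : ℝ → Type*} [∀ l, NormedAddCommGroup (E l)] [∀ l, NormedSpace ℝ (E l)]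
  {S : ℝ → X →L[ℝ] X} {A : X →ₗ.[ℝ] X} {ι : ∀ l : ℝ, E l →L[ℝ] X} {x : ℝ → ℝ} {η α : ℝ}
  {σ : X → X} {σ' : X → X →L[ℝ] X}

namespace HasNiceGateauxDeriv

/-- Along a line, Gâteaux differentiability is ordinary differentiability, so one-dimensional mean
value inequalities apply. -/
theorem hasDerivAt_segment (hσ : HasNiceGateauxDeriv σ σ') (b v : X) (p : ℝ) :
    HasDerivAt (fun p : ℝ => σ (b + p • v)) (σ' (b + p • v) v) p := by
  have h : HasDerivAt (fun t : ℝ => σ (b + p • v + t • v)) (σ' (b + p • v) v) (p - p) := by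
    rw [sub_self]
    exact hσ.deriv (b + p • v) v
  have h2 := h.comp_sub_const p p
  refine h2.congr_of_eventuallyEq (Eventually.of_forall fun q => ?_)
  dsimp only
  congr 1
  module

theorem exists_lipschitz (hσ : HasNiceGateauxDeriv σ σ') :
    ∃ C : ℝ, 0 < C ∧ ∀ u v : X, ‖σ u - σ v‖ ≤ C * ‖u - v‖ := by
  obtain ⟨C, hC⟩ := hσ.bounded
  refine ⟨max C 1, by positivity, fun u v => ?_⟩
  have h := norm_image_sub_le_of_norm_deriv_le_segment_01' (f := fun p : ℝ => σ (v + p • (u - v)))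
    (C := max C 1 * ‖u - v‖) (fun p _ => (hσ.hasDerivAt_segment v (u - v) p).hasDerivWithinAt)
    (fun p _ => (ContinuousLinearMap.le_opNorm _ _).trans (by
      gcongr
      exact (hC _).trans (le_max_left _ _)))
  simpa using h

/-- Mean value inequality for the difference of σ along the segments from b to a and from d to c. It
controls the Hölder increments of σ(y)-σ(z) linearly in y-z, for which Lipschitz continuity of σ
alone would not suffice. -/
theorem exists_four_point (hσ : HasNiceGateauxDeriv σ σ') (R : ℝ) :
    ∃ K : ℝ, 0 < K ∧ ∀ a b c d : X, ‖a‖ ≤ R → ‖b‖ ≤ R → ‖c‖ ≤ R → ‖d‖ ≤ R →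
      ‖σ a - σ b - (σ c - σ d)‖ ≤
        K * (‖a - b - (c - d)‖ + (‖a - c‖ + ‖b - d‖) * ‖c - d‖) := by
  obtain ⟨C, hC⟩ := hσ.bounded
  -- The maximum with 1 only ensures a positive radius; the segments stay in the ball of radius R.
  obtain ⟨L, hL⟩ := hσ.lipschitz (max R 1) (by positivity)
  set K := max (max C L) 1 with hK
  have hCK : C ≤ K := (le_max_left C L).trans (le_max_left _ _)
  have hLK : L ≤ K := (le_max_right C L).trans (le_max_left _ _)
  have hK0 : 0 < K := by positivity
  refine ⟨K, hK0, fun a b c d ha hb hc hd => ?_⟩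
  have hseg : ∀ u v : X, ‖u‖ ≤ R → ‖v‖ ≤ R → ∀ p ∈ Ico (0 : ℝ) 1,
      ‖v + p • (u - v)‖ ≤ max R 1 := by
    intro u v hu hv p hp
    have e : v + p • (u - v) = (1 - p) • v + p • u := by module
    have : 0 ≤ 1 - p := by linarith [hp.2]
    have : 0 ≤ p := hp.1
    rw [e]
    calc _ ≤ ‖(1 - p) • v‖ + ‖p • u‖ := norm_add_le _ _
      _ = (1 - p) * ‖v‖ + p * ‖u‖ := by
        rw [norm_smul, norm_smul, Real.norm_of_nonneg ‹0 ≤ 1 - p›, Real.norm_of_nonneg ‹0 ≤ p›]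
      _ ≤ (1 - p) * R + p * R := by gcongr
      _ = R := by ring
      _ ≤ _ := le_max_left _ _
  have h := norm_image_sub_le_of_norm_deriv_le_segment_01'
    (f := fun p : ℝ => σ (b + p • (a - b)) - σ (d + p • (c - d)))
    (C := K * (‖a - b - (c - d)‖ + (‖a - c‖ + ‖b - d‖) * ‖c - d‖))
    (fun p _ => ((hσ.hasDerivAt_segment b (a - b) p).sub
      (hσ.hasDerivAt_segment d (c - d) p)).hasDerivWithinAt) ?_
  · have e : σ a - σ c - (σ b - σ d) = σ a - σ b - (σ c - σ d) := by abel
    simpa [e] using h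
  · intro p hp
    have e : σ' (b + p • (a - b)) (a - b) - σ' (d + p • (c - d)) (c - d) =
        σ' (b + p • (a - b)) (a - b - (c - d)) +
          (σ' (b + p • (a - b)) - σ' (d + p • (c - d))) (c - d) := by
      rw [sub_apply, map_sub _ (a - b)]; abel
    rw [e]
    have h1 : ‖σ' (b + p • (a - b)) (a - b - (c - d))‖ ≤ K * ‖a - b - (c - d)‖ :=
      (ContinuousLinearMap.le_opNorm _ _).trans (by gcongr; exact (hC _).trans hCK)
    have h2 : ‖b + p • (a - b) - (d + p • (c - d))‖ ≤ ‖a - c‖ + ‖b - d‖ := by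
      have e : b + p • (a - b) - (d + p • (c - d)) = p • (a - c) + (1 - p) • (b - d) := by module
      have : 0 ≤ 1 - p := by linarith [hp.2]
      have : 0 ≤ p := hp.1
      rw [e]
      refine (norm_add_le _ _).trans ?_
      rw [norm_smul, norm_smul, Real.norm_of_nonneg ‹0 ≤ 1 - p›, Real.norm_of_nonneg ‹0 ≤ p›]
      exact add_le_add (mul_le_of_le_one_left (norm_nonneg _) hp.2.le)
        (mul_le_of_le_one_left (norm_nonneg _) (by linarith))
    have h3 : ‖σ' (b + p • (a - b)) - σ' (d + p • (c - d))‖ ≤ K * (‖a - c‖ + ‖b - d‖) := by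
      refine (hL _ _ (hseg a b ha hb p hp) (hseg c d hc hd p hp)).trans ?_
      gcongr
    calc _ ≤ K * ‖a - b - (c - d)‖ + K * (‖a - c‖ + ‖b - d‖) * ‖c - d‖ :=
          (norm_add_le _ _).trans (add_le_add h1
            ((ContinuousLinearMap.le_opNorm _ _).trans (by gcongr)))
      _ = _ := by ring

end HasNiceGateauxDeriv

namespace LipschitzOnSubspace

variable {F : Type*} [NormedAddCommGroup F] [NormedSpace ℝ F] {j : F →L[ℝ] X}

theorem exists_growth (h : LipschitzOnSubspace j σ) :
    ∃ K : ℝ, 0 < K ∧ ∀ (u : X) (c : ℝ), NormLE j u c → NormLE j (σ u) (K * (1 + c)) := by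
  obtain ⟨τ, hτ, C, hC⟩ := h
  refine ⟨max C 0 + ‖τ 0‖ + 1, by positivity, fun u c hu => ?_⟩
  have hc := hu.nonneg
  obtain ⟨z, rfl, hz⟩ := hu
  refine ⟨τ z, hτ z, ?_⟩
  have h1 := hC z 0
  rw [sub_zero] at h1
  have h2 : ‖τ z‖ ≤ ‖τ z - τ 0‖ + ‖τ 0‖ := by
    simpa using norm_add_le (τ z - τ 0) (τ 0)
  have h3 : C * ‖z‖ ≤ max C 0 * c := by
    calc C * ‖z‖ ≤ max C 0 * ‖z‖ := by gcongr; exact le_max_left _ _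
      _ ≤ _ := by gcongr
  nlinarith [norm_nonneg (τ 0), le_max_right C 0, mul_nonneg (norm_nonneg (τ 0)) hc]

theorem exists_sub (h : LipschitzOnSubspace j σ) (hj : Function.Injective j) :
    ∃ K : ℝ, 0 < K ∧ ∀ (u v : X) (c : ℝ), u ∈ range j → v ∈ range j → NormLE j (u - v) c →
      NormLE j (σ u - σ v) (K * c) := by
  obtain ⟨τ, hτ, C, hC⟩ := h
  refine ⟨max C 1, by positivity, fun u v c hu hv huv => ?_⟩
  obtain ⟨z, rfl⟩ := hu
  obtain ⟨w, rfl⟩ := hv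
  obtain ⟨y, hy, hyc⟩ := huv
  rw [← map_sub] at hy
  have hy' := hj hy
  refine ⟨τ z - τ w, by rw [map_sub, hτ, hτ], (hC z w).trans ?_⟩
  rw [← hy']
  calc C * ‖y‖ ≤ max C 1 * ‖y‖ := by gcongr; exact le_max_left _ _
    _ ≤ _ := by gcongr

end LipschitzOnSubspace

/-- Each of the three bounds grows at most linearly, with constants independent of y; the affine
term is absorbed because ω ≥ 1 and (t-a)^(-α) ≥ 1. This is what makes global existence and a priori
bounds possible. -/
theorem YoungSetting.exists_solClass_comp (h : YoungSetting S A ι x η α)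
    (hσ : HasNiceGateauxDeriv σ σ') (hσα : LipschitzOnSubspace (ι α) σ) :
    ∃ K : ℝ, 0 < K ∧ ∀ (a c : ℝ) (ω : ℝ → ℝ) (y : ℝ → X), 0 ≤ a → a ≤ 1 → IsWeight ω →
      SolClass ι α a ω c y → SolClass ι α a ω (K * (1 + c)) (σ ∘ y) := by
  obtain ⟨K₁, hK₁, h₁⟩ := hσα.exists_growth
  obtain ⟨K₂, hK₂, h₂⟩ := hσ.exists_lipschitz
  refine ⟨K₁ + K₂ + ‖σ 0‖, by positivity, fun a c ω y ha ha1 hω hy => ?_⟩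
  have hc := hy.nonneg hω ha ha1
  have h0 := norm_nonneg (σ 0)
  refine ⟨fun t h1 h2 => ?_, fun t h1 h2 => ?_, fun s t h1 h2 h3 => ?_⟩
  · have hω1 := hω.one_le t (by linarith)
    have hp := one_le_rpow_neg h.alpha_pos.le (show 0 < t - a by linarith) (by linarith)
    have hωp : 1 ≤ ω t * (t - a) ^ (-α) := one_le_mul_of_one_le_of_one_le hω1 hp
    refine (h₁ _ _ (hy.mem t h1 h2)).mono ?_
    calc K₁ * (1 + c * ω t * (t - a) ^ (-α))
        ≤ K₁ * (ω t * (t - a) ^ (-α) + c * ω t * (t - a) ^ (-α)) := by gcongr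
      _ = K₁ * ((1 + c) * (ω t * (t - a) ^ (-α))) := by ring
      _ ≤ (K₁ + K₂ + ‖σ 0‖) * ((1 + c) * (ω t * (t - a) ^ (-α))) := by
        gcongr
        linarith
      _ = _ := by ring
  · have hω1 := hω.one_le t (by linarith)
    have b1 := h₂ (y t) 0
    rw [sub_zero] at b1
    have b2 : ‖σ (y t)‖ ≤ ‖σ (y t) - σ 0‖ + ‖σ 0‖ := by
      simpa using norm_add_le (σ (y t) - σ 0) (σ 0)
    have b3 := hy.bdd t h1 h2
    calc ‖σ (y t)‖ ≤ K₂ * (c * ω t) + ‖σ 0‖ * ω t := by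
          refine b2.trans (add_le_add (b1.trans (by gcongr)) ?_)
          exact le_mul_of_one_le_right h0 hω1
      _ = (K₂ * c + ‖σ 0‖ * 1) * ω t := by ring
      _ ≤ _ := by
        gcongr
        nlinarith [mul_nonneg hK₁.le hc, mul_nonneg h0 hc]
  · have hω1 := hω.one_le t (by linarith)
    have hp : 0 ≤ (s - a) ^ α := Real.rpow_nonneg (by linarith) _
    have hq : 0 ≤ (t - s) ^ α := Real.rpow_nonneg (by linarith) _
    calc ‖σ (y t) - σ (y s)‖ * (s - a) ^ α ≤ K₂ * ‖y t - y s‖ * (s - a) ^ α := by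
          gcongr
          exact h₂ _ _
      _ = K₂ * (‖y t - y s‖ * (s - a) ^ α) := by ring
      _ ≤ K₂ * (c * ω t * (t - s) ^ α) := by
          have := hy.incr s t h1 h2 h3
          gcongr
      _ = (K₂ * c) * ω t * (t - s) ^ α := by ring
      _ ≤ _ := by
        gcongr <;> linarith

/-- The radius R, unweighted, enters only through the four-point estimate; the difference itself is
measured with an arbitrary weight, so the weight can be chosen after R. -/
theorem YoungSetting.exists_solClass_comp_sub (h : YoungSetting S A ι x η α)
    (hσ : HasNiceGateauxDeriv σ σ') (hσα : LipschitzOnSubspace (ι α) σ) (R : ℝ) :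
    ∃ K : ℝ, 0 < K ∧ ∀ (a c : ℝ) (ω : ℝ → ℝ) (y z : ℝ → X), 0 ≤ a → a ≤ 1 → IsWeight ω →
      SolClass ι α a (fun _ => 1) R y → SolClass ι α a (fun _ => 1) R z →
      SolClass ι α a ω c (fun t => y t - z t) →
      SolClass ι α a ω (K * c) (fun t => σ (y t) - σ (z t)) := by
  have hα2 : α < 2 := by linarith [h.alpha_lt_one]
  obtain ⟨K₁, hK₁, h₁⟩ := hσα.exists_sub (h.scale.injective_ι α h.alpha_pos.le hα2)
  obtain ⟨K₂, hK₂, h₂⟩ := hσ.exists_lipschitz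
  obtain ⟨K₃, hK₃, h₃⟩ := hσ.exists_four_point R
  refine ⟨K₁ + K₂ + K₃ * (1 + 2 * |R|), by positivity, fun a c ω y z ha ha1 hω hy hz hw => ?_⟩
  have hc := hw.nonneg hω ha ha1
  have hR : 0 ≤ R := hy.nonneg isWeight_one ha ha1
  rw [abs_of_nonneg hR]
  have hω0 : ∀ t, a ≤ t → 0 ≤ ω t := fun t ht => by linarith [hω.one_le t (by linarith)]
  have hK₄ : 0 ≤ K₃ * (1 + 2 * R) := by positivity
  refine ⟨fun t h1 h2 => ?_, fun t h1 h2 => ?_, fun s t h1 h2 h3 => ?_⟩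
  · have := hω0 t h1.le
    have hp : 0 ≤ (t - a) ^ (-α) := Real.rpow_nonneg (by linarith) _
    refine (h₁ _ _ _ (hy.mem t h1 h2).mem (hz.mem t h1 h2).mem (hw.mem t h1 h2)).mono ?_
    calc K₁ * (c * ω t * (t - a) ^ (-α)) = K₁ * c * ω t * (t - a) ^ (-α) := by ring
      _ ≤ _ := by gcongr; linarith
  · have := hω0 t h1
    calc _ ≤ K₂ * (c * ω t) := (h₂ _ _).trans (by have := hw.bdd t h1 h2; gcongr)
      _ = K₂ * c * ω t := by ring
      _ ≤ _ := by gcongr; linarith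
  · have hωt := hω0 t (by linarith)
    have hp : 0 ≤ (s - a) ^ α := Real.rpow_nonneg (by linarith) _
    have hq : 0 ≤ (t - s) ^ α := Real.rpow_nonneg (by linarith) _
    have b := h₃ (y t) (z t) (y s) (z s)
      (by simpa using hy.bdd t (by linarith) h3) (by simpa using hz.bdd t (by linarith) h3)
      (by simpa using hy.bdd s h1.le (by linarith)) (by simpa using hz.bdd s h1.le (by linarith))
    have i1 := hw.incr s t h1 h2 h3
    have i2 := hy.incr s t h1 h2 h3
    have i3 := hz.incr s t h1 h2 h3
    have i4 : ‖y s - z s‖ ≤ c * ω t := (hw.bdd s h1.le (by linarith)).trans (by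
      have := hω.mono h2.le
      gcongr)
    rw [mul_one] at i2 i3
    calc _ ≤ K₃ * (‖y t - z t - (y s - z s)‖ + (‖y t - y s‖ + ‖z t - z s‖) * ‖y s - z s‖) *
          (s - a) ^ α := by gcongr
      _ = K₃ * (‖y t - z t - (y s - z s)‖ * (s - a) ^ α +
          (‖y t - y s‖ * (s - a) ^ α + ‖z t - z s‖ * (s - a) ^ α) * ‖y s - z s‖) := by ring
      _ ≤ K₃ * (c * ω t * (t - s) ^ α + (R * (t - s) ^ α + R * (t - s) ^ α) * (c * ω t)) := by
        gcongr
      _ = K₃ * (1 + 2 * R) * c * ω t * (t - s) ^ α := by ring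
      _ ≤ _ := by gcongr; linarith

end Nonlinearity

/-! ### The fixed point argument -/

section FixedPoint

open Filter Topology

variable {X : Type*} [NormedAddCommGroup X] [NormedSpace ℝ X] [CompleteSpace X]
  {E : ℝ → Type*} [∀ l, NormedAddCommGroup (E l)] [∀ l, NormedSpace ℝ (E l)]
  [∀ l, CompleteSpace (E l)]
  {S : ℝ → X →L[ℝ] X} {A : X →ₗ.[ℝ] X} {ι : ∀ l : ℝ, E l →L[ℝ] X} {x : ℝ → ℝ} {η α : ℝ}
  {σ : X → X} {σ' : X → X →L[ℝ] X}

namespace YoungSetting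

theorem exists_convInt_comp (h : YoungSetting S A ι x η α)
    (hσ : HasNiceGateauxDeriv σ σ') (hσα : LipschitzOnSubspace (ι α) σ) :
    ∃ K : ℝ, 0 < K ∧ ∀ (a c δ : ℝ) (y : ℝ → X), 0 ≤ a → a ≤ 1 → 0 < δ → δ ≤ 1 →
      SolClass ι α a (fun t => Real.exp (t / δ)) c y →
      SolClass ι α a (fun t => Real.exp (t / δ)) (K * δ ^ (η - α) * (1 + c))
        (fun t => convInt S x (σ ∘ y) a t) := by
  obtain ⟨K₁, hK₁, h₁⟩ := h.exists_solClass_comp hσ hσα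
  obtain ⟨K₂, hK₂, h₂⟩ := h.exists_mildHolder
  obtain ⟨K₃, hK₃, h₃⟩ := h.exists_solClass_convInt
  refine ⟨K₃ * K₂ * K₁, by positivity, fun a c δ y ha ha1 hδ hδ1 hy => ?_⟩
  have hw := isWeight_exp hδ
  have := h₃ a (K₂ * (K₁ * (1 + c))) δ (σ ∘ y) ha ha1 hδ hδ1
    (fun b hab hb => h₂ a _ _ _ ha hw (h₁ a c _ y ha ha1 hw hy) b hab hb)
  convert this using 1
  ring

theorem exists_convInt_comp_sub (h : YoungSetting S A ι x η α)
    (hσ : HasNiceGateauxDeriv σ σ') (hσα : LipschitzOnSubspace (ι α) σ) (R : ℝ) :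
    ∃ K : ℝ, 0 < K ∧ ∀ (a c δ : ℝ) (y z : ℝ → X), 0 ≤ a → a ≤ 1 → 0 < δ → δ ≤ 1 →
      SolClass ι α a (fun _ => 1) R y → SolClass ι α a (fun _ => 1) R z →
      SolClass ι α a (fun t => Real.exp (t / δ)) c (fun t => y t - z t) →
      SolClass ι α a (fun t => Real.exp (t / δ)) (K * δ ^ (η - α) * c)
        (fun t => convInt S x (σ ∘ y) a t - convInt S x (σ ∘ z) a t) := by
  obtain ⟨K₀, hK₀, h₀⟩ := h.exists_solClass_comp hσ hσα
  obtain ⟨K₁, hK₁, h₁⟩ := h.exists_solClass_comp_sub hσ hσα R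
  obtain ⟨K₂, hK₂, h₂⟩ := h.exists_mildHolder
  obtain ⟨K₃, hK₃, h₃⟩ := h.exists_solClass_convInt
  refine ⟨K₃ * K₂ * K₁, by positivity, fun a c δ y z ha ha1 hδ hδ1 hy hz hyz => ?_⟩
  have hw := isWeight_exp hδ
  have hd := h₁ a c _ y z ha ha1 hw hy hz hyz
  have hd' := fun b hab hb => h₂ a _ _ _ ha hw hd b hab hb
  have := h₃ a (K₂ * (K₁ * c)) δ _ ha ha1 hδ hδ1 hd'
  have h4 : SolClass ι α a (fun t => Real.exp (t / δ)) (K₃ * (K₂ * (K₁ * c)) * δ ^ (η - α))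
      (fun t => convInt S x (σ ∘ y) a t - convInt S x (σ ∘ z) a t) := by
    refine this.congr fun t h1 h2 => ?_
    exact h.convInt_sub ha h2 (h₂ a _ _ _ ha isWeight_one (h₀ a _ _ y ha ha1 isWeight_one hy) t h1 h2)
      (h₂ a _ _ _ ha isWeight_one (h₀ a _ _ z ha ha1 isWeight_one hz) t h1 h2) (hd' t h1 h2)
      le_rfl h1 le_rfl
  convert h4 using 1
  ring

theorem exists_step (h : YoungSetting S A ι x η α) (K : ℝ) :
    ∃ δ : ℝ, 0 < δ ∧ δ ≤ 1 ∧ K * δ ^ (η - α) ≤ 1 / 2 := by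
  have hp : 0 < η - α := by linarith [h.alpha_lt]
  have hlim : Tendsto (fun δ : ℝ => K * δ ^ (η - α)) (𝓝[>] 0) (𝓝 0) := by
    have : ContinuousAt (fun δ : ℝ => K * δ ^ (η - α)) 0 :=
      continuousAt_const.mul (continuousAt_id.rpow_const (Or.inr hp.le))
    have h := this.tendsto
    simp only [Real.zero_rpow hp.ne', mul_zero] at h
    exact h.mono_left nhdsWithin_le_nhds
  have hev : ∀ᶠ δ in 𝓝[>] (0 : ℝ), 0 < δ ∧ δ ≤ 1 ∧ K * δ ^ (η - α) ≤ 1 / 2 := by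
    filter_upwards [hlim.eventually (gt_mem_nhds (by norm_num : (0:ℝ) < 1 / 2)),
      self_mem_nhdsWithin, nhdsWithin_le_nhds (gt_mem_nhds one_pos)] with δ h1 h2 h3
    exact ⟨h2, h3.le, h1.le⟩
  exact hev.exists

/-- Two solutions of the fixed point equation in the class coincide. -/
theorem eqOn_of_fixedPoint (h : YoungSetting S A ι x η α)
    (hσ : HasNiceGateauxDeriv σ σ') (hσα : LipschitzOnSubspace (ι α) σ) {ψ : X} {R : ℝ}
    {y z : ℝ → X} (hy : SolClass ι α 0 (fun _ => 1) R y) (hz : SolClass ι α 0 (fun _ => 1) R z)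
    (hy' : ∀ t ∈ Icc (0 : ℝ) 1, y t = S t ψ + convInt S x (σ ∘ y) 0 t)
    (hz' : ∀ t ∈ Icc (0 : ℝ) 1, z t = S t ψ + convInt S x (σ ∘ z) 0 t) : EqOn y z (Icc 0 1) := by
  obtain ⟨K, hK, hc⟩ := h.exists_convInt_comp_sub hσ hσα R
  obtain ⟨δ, hδ, hδ1, hδK⟩ := h.exists_step K
  have hR : 0 ≤ R := hy.nonneg isWeight_one le_rfl zero_le_one
  have key : ∀ n : ℕ, SolClass ι α 0 (fun t => Real.exp (t / δ)) ((R + R) * (1 / 2) ^ n)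
      (fun t => y t - z t) := by
    intro n
    induction n with
    | zero => simpa using (hy.sub hz).of_one (isWeight_exp hδ) le_rfl zero_le_one
    | succ n ih =>
      have h1 := hc 0 _ δ y z le_rfl zero_le_one hδ hδ1 hy hz ih
      refine (h1.mono_const (isWeight_exp hδ) le_rfl ?_).congr fun t h2 h3 => ?_
      · calc _ ≤ 1 / 2 * ((R + R) * (1 / 2) ^ n) := by gcongr
          _ = _ := by ring
      · rw [hy' t ⟨h2, h3⟩, hz' t ⟨h2, h3⟩]; abel
  intro t ht
  have hlim : Tendsto (fun n : ℕ => (R + R) * (1 / 2) ^ n * Real.exp (t / δ)) atTop (𝓝 0) := by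
    simpa using ((tendsto_pow_atTop_nhds_zero_of_lt_one (by norm_num)
      (by norm_num : (1 / 2 : ℝ) < 1)).const_mul (R + R)).mul_const (Real.exp (t / δ))
  exact sub_eq_zero.1 (norm_le_zero_iff.1 (ge_of_tendsto' hlim fun n => (key n).bdd t ht.1 ht.2))

/-- Picard iteration with two weights: linear growth first confines all iterates to a ball, and the
Lipschitz constant on that ball then determines a steeper weight for which successive differences
decay geometrically. -/
theorem exists_fixedPoint (h : YoungSetting S A ι x η α)
    (hσ : HasNiceGateauxDeriv σ σ') (hσα : LipschitzOnSubspace (ι α) σ) (ψ : X) :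
    ∃ (y : ℝ → X) (R : ℝ), SolClass ι α 0 (fun _ => 1) R y ∧
      ∀ t ∈ Icc (0 : ℝ) 1, y t = S t ψ + convInt S x (σ ∘ y) 0 t := by
  obtain ⟨K₀, hK₀, h₀⟩ := h.exists_solClass_datum
  obtain ⟨K₁, hK₁, h₁⟩ := h.exists_convInt_comp hσ hσα
  obtain ⟨δ₀, hδ₀, hδ₀1, hδK₀⟩ := h.exists_step K₁
  have hdat := h₀ 0 ψ le_rfl
  simp only [sub_zero] at hdat
  set c := K₀ * ‖ψ‖ with hc
  have hc0 : 0 ≤ c := by positivity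
  let Y : ℕ → ℝ → X := fun n => Nat.rec (fun t => S t ψ)
    (fun _ y t => S t ψ + convInt S x (σ ∘ y) 0 t) n
  have hYs : ∀ n t, Y (n + 1) t = S t ψ + convInt S x (σ ∘ Y n) 0 t := fun n t => rfl
  -- The radius 2c+1 is the fixed point of q ↦ c + (1+q)/2.
  have hball : ∀ n, SolClass ι α 0 (fun t => Real.exp (t / δ₀)) (2 * c + 1) (Y n) := by
    intro n
    have hdat' := hdat.of_one (isWeight_exp hδ₀) le_rfl zero_le_one
    induction n with
    | zero => exact hdat'.mono_const (isWeight_exp hδ₀) le_rfl (by linarith)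
    | succ n ih =>
      refine (hdat'.add (h₁ 0 _ δ₀ (Y n) le_rfl zero_le_one hδ₀ hδ₀1 ih)).mono_const
        (isWeight_exp hδ₀) le_rfl ?_
      calc c + K₁ * δ₀ ^ (η - α) * (1 + (2 * c + 1)) ≤ c + 1 / 2 * (1 + (2 * c + 1)) := by gcongr
        _ = _ := by ring
  set R := (2 * c + 1) * Real.exp (1 / δ₀) with hR
  have hYR : ∀ n, SolClass ι α 0 (fun _ => 1) R (Y n) :=
    fun n => (hball n).to_one (isWeight_exp hδ₀) le_rfl zero_le_one
  have hR0 : 0 ≤ R := by positivity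
  obtain ⟨K₂, hK₂, h₂⟩ := h.exists_convInt_comp_sub hσ hσα R
  obtain ⟨δ, hδ, hδ1, hδK⟩ := h.exists_step K₂
  have hw := isWeight_exp hδ
  have hdiff : ∀ n : ℕ, SolClass ι α 0 (fun t => Real.exp (t / δ)) ((R + R) * (1 / 2) ^ n)
      (fun t => Y (n + 1) t - Y n t) := by
    intro n
    induction n with
    | zero => simpa using ((hYR 1).sub (hYR 0)).of_one hw le_rfl zero_le_one
    | succ n ih =>
      have h1 := h₂ 0 _ δ _ _ le_rfl zero_le_one hδ hδ1 (hYR (n + 1)) (hYR n) ih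
      refine (h1.mono_const hw le_rfl ?_).congr fun t _ _ => ?_
      · calc _ ≤ 1 / 2 * ((R + R) * (1 / 2) ^ n) := by gcongr
          _ = _ := by ring
      · rw [hYs (n + 1), hYs n]; abel
  have hgeo : Summable fun n : ℕ => (R + R) * (1 / 2 : ℝ) ^ n :=
    (summable_geometric_of_lt_one (by norm_num) (by norm_num)).mul_left _
  set y : ℝ → X := fun t => Y 0 t + ∑' n, (Y (n + 1) t - Y n t) with hy
  have htail : ∀ n, SolClass ι α 0 (fun t => Real.exp (t / δ)) (2 * (R + R) * (1 / 2) ^ n)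
      (fun t => y t - Y n t) := by
    intro n
    have h1 := SolClass.tsum (fun k => hdiff (k + n)) ((summable_nat_add_iff n).2 hgeo)
    have e : ∑' k : ℕ, (R + R) * (1 / 2 : ℝ) ^ (k + n) = 2 * (R + R) * (1 / 2) ^ n := by
      simp_rw [pow_add]
      rw [tsum_mul_left, tsum_mul_right, tsum_geometric_two]
      ring
    rw [e] at h1
    refine h1.2.congr fun t h2 h3 => ?_
    have hs := (SolClass.tsum hdiff hgeo).1 t h2 h3
    have h4 := hs.sum_add_tsum_nat_add n
    rw [Finset.sum_range_sub (fun n => Y n t)] at h4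
    simp only [hy]
    rw [← h4]
    abel
  have hyR : SolClass ι α 0 (fun _ => 1) (2 * (R + R) * Real.exp (1 / δ) + R) y := by
    have h1 := ((htail 0).to_one hw le_rfl zero_le_one).add (hYR 0)
    rw [pow_zero, mul_one] at h1
    exact h1.congr fun t _ _ => by abel
  refine ⟨y, _, hyR, fun t ht => ?_⟩
  set R' := 2 * (R + R) * Real.exp (1 / δ) + R with hR'
  have hRR' : R ≤ R' := by
    have : 0 ≤ 2 * (R + R) * Real.exp (1 / δ) := by positivity
    linarith
  -- The limit has the larger radius R'. Its Lipschitz constant need not be small: the step is only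
  -- used to pass to the limit in the equation.
  obtain ⟨K₃, hK₃, h₃⟩ := h.exists_convInt_comp_sub hσ hσα R'
  have hconv := fun n => h₃ 0 _ δ y (Y n) le_rfl zero_le_one hδ hδ1 hyR
    ((hYR n).mono_const isWeight_one le_rfl hRR') (htail n)
  have hpow : Tendsto (fun n : ℕ => (1 / 2 : ℝ) ^ n) atTop (𝓝 0) :=
    tendsto_pow_atTop_nhds_zero_of_lt_one (by norm_num) (by norm_num)
  have l1 : Tendsto (fun n => y t - Y (n + 1) t) atTop (𝓝 0) := by
    refine squeeze_zero_norm (fun n => (htail (n + 1)).bdd t ht.1 ht.2) ?_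
    simpa using (((tendsto_add_atTop_iff_nat 1).2 hpow).const_mul (2 * (R + R))).mul_const
      (Real.exp (t / δ))
  have l2 : Tendsto (fun n => convInt S x (σ ∘ y) 0 t - convInt S x (σ ∘ Y n) 0 t) atTop (𝓝 0) := by
    refine squeeze_zero_norm (fun n => (hconv n).bdd t ht.1 ht.2) ?_
    simpa using ((hpow.const_mul (2 * (R + R))).const_mul (K₃ * δ ^ (η - α))).mul_const
      (Real.exp (t / δ))
  have l3 := l1.sub l2
  rw [sub_zero] at l3
  have e : ∀ n, y t - Y (n + 1) t - (convInt S x (σ ∘ y) 0 t - convInt S x (σ ∘ Y n) 0 t) =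
      y t - (S t ψ + convInt S x (σ ∘ y) 0 t) := fun n => by rw [hYs]; abel
  simp_rw [e] at l3
  exact sub_eq_zero.1 (tendsto_nhds_unique tendsto_const_nhds l3)

end YoungSetting

end FixedPoint

/-! ### Continuity of the convolution integral in the scale of spaces -/

section Continuity

open Filter Topology

variable {X : Type*} [NormedAddCommGroup X] [NormedSpace ℝ X]

section General

variable {T F : Type*} [TopologicalSpace T] [NormedAddCommGroup F] [NormedSpace ℝ F] {j : F →L[ℝ] X}
  {D : Set T} {f g : T → X} {p₀ : T}

theorem NormLEContAt.congr (hf : NormLEContAt j D f p₀) (hp₀ : p₀ ∈ D) (h : ∀ p ∈ D, f p = g p) :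
    NormLEContAt j D g p₀ := by
  intro e he
  filter_upwards [hf e he, self_mem_nhdsWithin] with p hp hpD
  rwa [← h p hpD, ← h p₀ hp₀]

theorem NormLEContAt.add (hf : NormLEContAt j D f p₀) (hg : NormLEContAt j D g p₀) :
    NormLEContAt j D (fun p => f p + g p) p₀ := by
  intro e he
  filter_upwards [hf _ (half_pos he), hg _ (half_pos he)] with p h1 h2
  convert h1.add h2 using 1
  · abel
  · ring

theorem NormLEContAt.mono {D' : Set T} (hf : NormLEContAt j D f p₀) (h : D' ⊆ D) :
    NormLEContAt j D' f p₀ :=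
  fun e he => (hf e he).filter_mono (nhdsWithin_mono _ h)

theorem NormLEContAt.comp {T' : Type*} [TopologicalSpace T'] {D' : Set T'} {w : T' → T} {q₀ : T'}
    (hf : NormLEContAt j D f (w q₀)) (hw : ContinuousWithinAt w D' q₀) (hm : MapsTo w D' D) :
    NormLEContAt j D' (fun q => f (w q)) q₀ :=
  fun e he => (hw.tendsto_nhdsWithin hm).eventually (hf e he)

end General

/-- On the diagonal the Hölder bound itself gives continuity; off it, continuity of S at positive
times is available. -/
theorem normLEContAt_diag {F : Type*} [NormedAddCommGroup F] [NormedSpace ℝ F] {j : F →L[ℝ] X}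
    {D : Set (ℝ × ℝ)} {f : ℝ × ℝ → X} {s C q : ℝ} (hq : 0 < q) (h0 : f (s, s) = 0)
    (hf : ∀ᶠ p in 𝓝[D] (s, s), NormLE j (f p) (C * (p.2 - p.1) ^ q)) :
    NormLEContAt j D f (s, s) := by
  intro e he
  have hlim : Tendsto (fun p : ℝ × ℝ => C * (p.2 - p.1) ^ q) (𝓝[D] (s, s)) (𝓝 0) := by
    have : ContinuousAt (fun p : ℝ × ℝ => C * (p.2 - p.1) ^ q) (s, s) :=
      ContinuousAt.mul continuousAt_const (ContinuousAt.rpow_const (by fun_prop) (Or.inr hq.le))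
    have h := this.tendsto
    simp only [sub_self, Real.zero_rpow hq.ne', mul_zero] at h
    exact h.mono_left nhdsWithin_le_nhds
  filter_upwards [hf, hlim.eventually (gt_mem_nhds he)] with p h1 h2
  rw [h0, sub_zero]
  exact h1.mono h2.le

variable [CompleteSpace X] {E : ℝ → Type*} [∀ l, NormedAddCommGroup (E l)]
  [∀ l, NormedSpace ℝ (E l)]
  {S : ℝ → X →L[ℝ] X} {A : X →ₗ.[ℝ] X} {ι : ∀ l : ℝ, E l →L[ℝ] X} {x : ℝ → ℝ} {η α : ℝ}

theorem IsSmoothingScale.normLEContAt_zero (hS : IsSmoothingScale S A ι) {T : Type*}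
    [TopologicalSpace T] {D : Set T} {f : T → X} {p₀ : T} (hf : ContinuousWithinAt f D p₀) :
    NormLEContAt (ι 0) D f p₀ := by
  intro e he
  rw [ContinuousWithinAt, Metric.tendsto_nhds] at hf
  filter_upwards [hf e he] with p hp
  rw [dist_eq_norm] at hp
  exact (hS.normLE_zero _).mono hp.le

namespace YoungSetting

theorem normLEContAt_primitive (h : YoungSetting S A ι x η α) {τ c C p l : ℝ} {φ : ℝ → X}
    (hτ : 0 ≤ τ) (hφ : MildHolder S α τ 1 c φ) (hp : 0 < p) (hl0 : 0 ≤ l) (hl : l < 2)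
    (hk : ∀ s t, τ ≤ s → s < t → t ≤ 1 → NormLE (ι l) (convInt S x φ s t) (C * (t - s) ^ p))
    {t₀ : ℝ} (ht₀ : t₀ ∈ Icc τ 1) :
    NormLEContAt (ι l) (Icc τ 1) (fun t => convInt S x φ τ t) t₀ := by
  rcases ht₀.1.eq_or_lt with rfl | h1
  · intro e he
    have hlim : Tendsto (fun t : ℝ => C * (t - τ) ^ p) (𝓝[Icc τ 1] τ) (𝓝 0) := by
      have : ContinuousAt (fun t : ℝ => C * (t - τ) ^ p) τ :=
        ContinuousAt.mul continuousAt_const (ContinuousAt.rpow_const (by fun_prop) (Or.inr hp.le))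
      have h := this.tendsto
      simp only [sub_self, Real.zero_rpow hp.ne', mul_zero] at h
      exact h.mono_left nhdsWithin_le_nhds
    filter_upwards [hlim.eventually (gt_mem_nhds he), self_mem_nhdsWithin] with t h1 h2
    rw [convInt_self, sub_zero]
    rcases h2.1.eq_or_lt with rfl | h3
    · rw [convInt_self]
      exact NormLE.zero he.le
    · exact (hk τ t le_rfl h3 h2.2).mono h1.le
  · refine h.scale.contAt_of_increments (C := C) hl0 hl hτ le_rfl hp (fun s t h1 h2 h3 => ?_)
      ⟨h1, ht₀.2⟩
    rw [h.convInt_add hτ le_rfl hφ le_rfl h1 h2.le h3, add_sub_cancel_right]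
    exact hk s t h1 h2 h3

theorem normLEContAt_convInt (h : YoungSetting S A ι x η α) {τ c C p l : ℝ} {φ : ℝ → X}
    (hτ : 0 ≤ τ) (hφ : MildHolder S α τ 1 c φ) (hp : 0 < p) (hl0 : 0 ≤ l) (hl : l < 2)
    (hk : ∀ s t, τ ≤ s → s < t → t ≤ 1 → NormLE (ι l) (convInt S x φ s t) (C * (t - s) ^ p))
    {p₀ : ℝ × ℝ} (hp₀ : p₀ ∈ closedTri τ 1) :
    NormLEContAt (ι l) (closedTri τ 1) (fun p => convInt S x φ p.1 p.2) p₀ := by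
  obtain ⟨s₀, t₀⟩ := p₀
  obtain ⟨h1, h2, h3⟩ := hp₀
  dsimp only at h1 h2 h3
  have hprim : ∀ t ∈ Icc τ 1, NormLEContAt (ι l) (Icc τ 1) (fun t => convInt S x φ τ t) t :=
    fun t ht => h.normLEContAt_primitive hτ hφ hp hl0 hl hk ht
  have hf1 : MapsTo Prod.fst (closedTri τ 1) (Icc τ 1) := fun p hp => ⟨hp.1, hp.2.1.trans hp.2.2⟩
  have hf2 : MapsTo Prod.snd (closedTri τ 1) (Icc τ 1) := fun p hp => ⟨hp.1.trans hp.2.1, hp.2.2⟩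
  rcases h2.eq_or_lt with rfl | h2
  · refine normLEContAt_diag (C := C) hp (convInt_self φ s₀) ?_
    filter_upwards [self_mem_nhdsWithin] with p hpD
    rcases hpD.2.1.eq_or_lt with he | hlt
    · rw [← he, convInt_self, sub_self, Real.zero_rpow hp.ne', mul_zero]
      exact NormLE.zero le_rfl
    · exact hk _ _ hpD.1 hlt hpD.2.2
  · have c2 := (hprim t₀ ⟨h1.trans h2.le, h3⟩).comp (q₀ := (s₀, t₀)) (w := Prod.snd)
      continuousWithinAt_snd hf2
    have c1 := ((hprim s₀ ⟨h1, h2.le.trans h3⟩).comp (q₀ := (s₀, t₀)) (w := Prod.fst)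
      continuousWithinAt_fst hf1).continuousWithinAt
    have c3 : NormLEContAt (ι l) (closedTri τ 1)
        (fun p : ℝ × ℝ => S (p.2 - p.1) (convInt S x φ τ p.1)) (s₀, t₀) := by
      intro e he
      refine h.scale.eventually_normLE hl0 hl (by simpa using h2) ?_ ?_ (by dsimp only; linarith)
        c1 he
      · exact ((continuous_snd.sub continuous_fst).tendsto (s₀, t₀)).mono_left nhdsWithin_le_nhds
      · filter_upwards [self_mem_nhdsWithin] with p hp
        linarith [hp.1, hp.2.2]
    -- The cocycle relation expresses the integral through its primitive from τ, reducing joint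
    -- continuity to one variable and to S at the positive time t₀-s₀.
    refine (c2.sub c3).congr ⟨h1, h2.le, h3⟩ fun p hp => ?_
    rw [h.convInt_add hτ le_rfl hφ le_rfl hp.1 hp.2.1 hp.2.2, add_sub_cancel_right]

/-- Interior bounds for the convolution integral and its remainder in `X_l`, `l < 1`. -/
theorem exists_interior_normLE [∀ l, CompleteSpace (E l)] (h : YoungSetting S A ι x η α) {c : ℝ}
    {φ : ℝ → X} (hφ : SolClass ι α 0 (fun _ => 1) c φ) {τ l : ℝ} (hτ : 0 < τ)
    (hl0 : 0 ≤ l) (hl : l < 1) :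
    ∃ (C p : ℝ), 0 < p ∧ (∀ s t, τ ≤ s → s < t → t ≤ 1 →
      NormLE (ι l) (convInt S x φ s t) (C * (t - s) ^ p)) ∧
      ∀ s t, τ ≤ s → s < t → t ≤ 1 →
      NormLE (ι l) (convInt S x φ s t - (x t - x s) • S (t - s) (φ s))
        (C * (t - s) ^ (η + α - l)) := by
  have hα0 := h.alpha_pos
  have hα := h.alpha_lt_one
  have hsum := h.sum_gt
  have hc := hφ.nonneg isWeight_one le_rfl zero_le_one
  obtain ⟨K, hK, hrem⟩ := h.exists_convInt_sub_germ_normLE hl0 hl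
  obtain ⟨K₂, hK₂, h₂⟩ := h.exists_mildHolder
  obtain ⟨Cx, hCx, hx⟩ := h.exists_path
  have hmild := h₂ 0 c _ φ le_rfl isWeight_one hφ 1 zero_le_one le_rfl
  set B := K₂ * c * 1 * τ ^ (-α) with hB
  have hB0 : 0 ≤ B := by positivity
  have hincr : ∀ s t, τ ≤ s → s < t → t ≤ 1 →
      NormLE (ι l) (convInt S x φ s t - (x t - x s) • S (t - s) (φ s))
        (K * B * (t - s) ^ (η + α - l)) := by
    intro s t hs hst ht
    refine hrem s t B φ (by linarith) hst ht hB0 fun r u hr hru hu => ?_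
    refine (hmild.incr r u (by linarith) hru (by linarith)).trans ?_
    rw [sub_zero, Real.div_rpow (by linarith) (by linarith), div_eq_mul_inv,
      ← Real.rpow_neg (by linarith), hB]
    have h1 : u ^ (-α) ≤ τ ^ (-α) := Real.rpow_le_rpow_of_nonpos hτ (by linarith) (by linarith)
    have h2 : 0 ≤ (u - r) ^ α := Real.rpow_nonneg (by linarith) _
    calc K₂ * c * 1 * ((u - r) ^ α * u ^ (-α)) ≤ K₂ * c * 1 * ((u - r) ^ α * τ ^ (-α)) := by
          gcongr
      _ = _ := by ring
  -- Smoothing is used for l above α, the embedding of X_α for l below. The exponent η+min(α-l,0)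
  -- stays positive because η+α > 1 > l.
  obtain ⟨L, hL, hgerm⟩ : ∃ L : ℝ, 0 < L ∧ ∀ t ∈ Ioc (0 : ℝ) 1, ∀ (u : X) (d : ℝ),
      NormLE (ι α) u d → NormLE (ι l) (S t u) (L * t ^ (min (α - l) 0) * d) := by
    rcases le_total α l with hal | hal
    · obtain ⟨L, hL, hs⟩ := h.scale.exists_smoothing_le hα0.le hal (by linarith)
      exact ⟨L, hL, by rwa [min_eq_left (by linarith)]⟩
    · obtain ⟨L, hL, hs⟩ := h.scale.exists_stable hl0 (by linarith)
      obtain ⟨L', hL', he⟩ := h.scale.exists_embedding hl0 hal (by linarith)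
      refine ⟨L * L', by positivity, fun t ht u d hu => ?_⟩
      refine (hs t ⟨ht.1.le, ht.2⟩ u _ (he u d hu)).mono (le_of_eq ?_)
      rw [min_eq_right (by linarith), Real.rpow_zero]
      ring
  set p := η + min (α - l) 0 with hp
  have hp0 : 0 < p := by
    rw [hp]
    rcases min_choice (α - l) 0 with e | e <;> rw [e] <;> linarith [h.eta_pos]
  have hp1 : p ≤ η + α - l := by rw [hp]; linarith [min_le_left (α - l) 0]
  set G := Cx * (L * (c * 1 * τ ^ (-α))) with hG
  have hG0 : 0 ≤ G := by positivity
  refine ⟨K * B + G, p, hp0, fun s t hs hst ht => ?_, fun s t hs hst ht => ?_⟩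
  · have hts : 0 < t - s := by linarith
    have b1 := hincr s t hs hst ht
    have b0 := (hφ.mem s (by linarith) (by linarith)).mono (d := c * 1 * τ ^ (-α)) (by
      rw [sub_zero]
      have : s ^ (-α) ≤ τ ^ (-α) := Real.rpow_le_rpow_of_nonpos hτ hs (by linarith)
      gcongr)
    have b2 := (hgerm (t - s) ⟨hts, by linarith⟩ _ _ b0).smul (x t - x s)
    have b3 := hx s t (by linarith) hst.le ht
    have e : convInt S x φ s t = (convInt S x φ s t - (x t - x s) • S (t - s) (φ s)) +
      (x t - x s) • S (t - s) (φ s) := by abel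
    rw [e]
    refine (b1.add b2).mono ?_
    have b4 := rpow_anti hts (by linarith) hp1
    calc _ ≤ K * B * (t - s) ^ p + Cx * (t - s) ^ η *
          (L * (t - s) ^ min (α - l) 0 * (c * 1 * τ ^ (-α))) := by gcongr
      _ = K * B * (t - s) ^ p + G * ((t - s) ^ η * (t - s) ^ min (α - l) 0) := by rw [hG]; ring
      _ = _ := by rw [← Real.rpow_add hts]; ring
  · refine (hincr s t hs hst ht).mono ?_
    have : 0 ≤ (t - s) ^ (η + α - l) := Real.rpow_nonneg (by linarith) _
    gcongr
    linarith

end YoungSetting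

end Continuity

/-! ### Regularity of the fixed point for regular initial data -/

section Regularity

open Filter Topology

variable {X : Type*} [NormedAddCommGroup X] [NormedSpace ℝ X] [CompleteSpace X]
  {E : ℝ → Type*} [∀ l, NormedAddCommGroup (E l)] [∀ l, NormedSpace ℝ (E l)]
  [∀ l, CompleteSpace (E l)]
  {S : ℝ → X →L[ℝ] X} {A : X →ₗ.[ℝ] X} {ι : ∀ l : ℝ, E l →L[ℝ] X} {x : ℝ → ℝ} {η α : ℝ}
  {σ : X → X} {σ' : X → X →L[ℝ] X}

namespace YoungSetting

/-- If `k(s,t)` is of order `(t-s)^q` in `X_α` for `t ≤ 2s`, then for all `s < t`. -/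
theorem exists_normLE_of_halving (h : YoungSetting S A ι x η α) {c C q : ℝ} {φ : ℝ → X}
    (hφ : MildHolder S α 0 1 c φ) (hq : 0 < q) (hC : 0 ≤ C)
    (hk : ∀ s t, 0 < s → s < t → t ≤ 1 → t ≤ 2 * s →
      NormLE (ι α) (convInt S x φ s t) (C * (t - s) ^ q)) :
    ∃ C' : ℝ, ∀ s t, 0 ≤ s → s < t → t ≤ 1 →
      NormLE (ι α) (convInt S x φ s t) (C' * (t - s) ^ q) := by
  have hα0 := h.alpha_pos
  have hα2 : α < 2 := by linarith [h.alpha_lt_one]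
  obtain ⟨L, hL, hst⟩ := h.scale.exists_stable hα0.le hα2
  obtain ⟨L', hL', hsm⟩ := h.scale.exists_smoothing hα0.le hα2
  obtain ⟨K, hK, hle⟩ := h.exists_convInt_le
  have hc : 0 ≤ c := hφ.nonneg zero_le_one
  set b := (1 / 2 : ℝ) ^ q with hb
  have hb1 : b < 1 := half_rpow_lt_one hq
  have hb0 : 0 < b := by positivity
  -- Q solves Q = b(LC+Q): one halving costs bLC and rescales the remaining bound by b, so the
  -- constant reproduces itself.
  set Q := b * (L * C) / (1 - b) with hQ
  have hQ0 : 0 ≤ Q := div_nonneg (by positivity) (by linarith)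
  have hQe : b * (L * C + Q) = Q := by
    have : 1 - b ≠ 0 := by linarith
    rw [hQ]; field_simp; ring
  have hhalf : ∀ s t : ℝ, s < t → (t - (s + t) / 2) ^ q = b * (t - s) ^ q ∧
      ((s + t) / 2 - s) ^ q = b * (t - s) ^ q := by
    intro s t hst
    rw [hb, ← Real.mul_rpow (by norm_num) (by linarith)]
    constructor <;> congr 1 <;> ring
  have hadd : ∀ s t, 0 ≤ s → s < t → t ≤ 1 → convInt S x φ s t =
      convInt S x φ ((s + t) / 2) t + S ((t - s) / 2) (convInt S x φ s ((s + t) / 2)) := by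
    intro s t h1 h2 h3
    rw [h.convInt_add le_rfl le_rfl hφ h1 (by linarith : s ≤ (s + t) / 2) (by linarith) h3]
    congr 3
    ring
  have hupper : ∀ s t, 0 ≤ s → s < t → t ≤ 1 →
      NormLE (ι α) (convInt S x φ ((s + t) / 2) t) (C * (b * (t - s) ^ q)) := by
    intro s t h1 h2 h3
    have := hk ((s + t) / 2) t (by linarith) (by linarith) h3 (by linarith)
    rwa [(hhalf s t h2).1] at this
  -- Repeated halving toward s. What is left after n steps lives on an interval of length
  -- 2^(-n)(t-s) and is smoothed for at least the time d, so it tends to 0 in X_α; an X_α bound near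
  -- s is not needed.
  have key : ∀ d : ℝ, 0 < d → ∀ (n : ℕ) (s t v : ℝ), 0 ≤ s → s < t → d ≤ v → v + t ≤ 1 →
      NormLE (ι α) (S v (convInt S x φ s t))
        (Q * (t - s) ^ q + L' * d ^ (-α) * (K * c * ((1 / 2) ^ n * (t - s)) ^ η)) := by
    intro d hd n
    induction n with
    | zero =>
      intro s t v h1 h2 h3 h4
      refine (hsm v ⟨by linarith, by linarith⟩ _).mono ?_
      have p1 : v ^ (-α) ≤ d ^ (-α) := Real.rpow_le_rpow_of_nonpos hd h3 (by linarith)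
      have p2 := hle 0 1 c φ le_rfl le_rfl hφ s t h1 h2.le (by linarith)
      have p3 : 0 ≤ Q * (t - s) ^ q := mul_nonneg hQ0 (Real.rpow_nonneg (by linarith) _)
      rw [pow_zero, one_mul]
      calc _ ≤ L' * d ^ (-α) * (K * c * (t - s) ^ η) := by gcongr
        _ ≤ _ := by linarith
    | succ n ih =>
      intro s t v h1 h2 h3 h4
      have i1 := ih s ((s + t) / 2) (v + (t - s) / 2) h1 (by linarith) (by linarith) (by linarith)
      have i2 := hst v ⟨by linarith, by linarith⟩ _ _ (hupper s t h1 h2 (by linarith))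
      rw [h.scale.semigroup.add_apply (by linarith) (by linarith)] at i1
      rw [hadd s t h1 h2 (by linarith), map_add]
      refine (i2.add i1).mono (le_of_eq ?_)
      rw [(hhalf s t h2).2, show (1 / 2 : ℝ) ^ n * ((s + t) / 2 - s) = (1 / 2) ^ (n + 1) * (t - s) by
        rw [pow_succ]; ring]
      have : L * (C * (b * (t - s) ^ q)) + Q * (b * (t - s) ^ q) = Q * (t - s) ^ q := by
        calc _ = b * (L * C + Q) * (t - s) ^ q := by ring
          _ = _ := by rw [hQe]
      linarith
  refine ⟨C * b + Q * b, fun s t h1 h2 h3 => ?_⟩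
  have hd : 0 < (t - s) / 2 := by linarith
  have hlim : Tendsto (fun n : ℕ => Q * ((s + t) / 2 - s) ^ q + L' * ((t - s) / 2) ^ (-α) *
      (K * c * ((1 / 2) ^ n * ((s + t) / 2 - s)) ^ η)) atTop
      (𝓝 (Q * ((s + t) / 2 - s) ^ q)) := by
    have p1 : Tendsto (fun n : ℕ => (1 / 2 : ℝ) ^ n * ((s + t) / 2 - s)) atTop (𝓝 0) := by
      simpa using (tendsto_pow_atTop_nhds_zero_of_lt_one (by norm_num)
        (by norm_num : (1 / 2 : ℝ) < 1)).mul_const ((s + t) / 2 - s)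
    have p2 := p1.rpow_const (p := η) (Or.inr h.eta_pos.le)
    rw [Real.zero_rpow h.eta_pos.ne'] at p2
    have p3 := (p2.const_mul (K * c)).const_mul (L' * ((t - s) / 2) ^ (-α))
    simpa using p3.const_add (Q * ((s + t) / 2 - s) ^ q)
  have h4 := NormLE.of_tendsto (h.scale.injective_ι α hα0.le hα2) hlim (Eventually.of_forall
    fun n => key _ hd n s ((s + t) / 2) ((t - s) / 2) h1 (by linarith) le_rfl (by linarith))
  rw [hadd s t h1 h2 h3]
  refine ((hupper s t h1 h2 h3).add h4).mono (le_of_eq ?_)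
  rw [(hhalf s t h2).2]
  ring

/-- The datum contributes t^(θ-α) in X_α, and the integral t^(η-α), which is no worse. With this
weaker singularity the equation is used once more to estimate increments of y and of σ(y), and
thereby the integral away from time 0. -/
theorem exists_regular (h : YoungSetting S A ι x η α)
    (hσ : HasNiceGateauxDeriv σ σ') (hσα : LipschitzOnSubspace (ι α) σ) {θ : ℝ} (hθ : 0 ≤ θ)
    (hθα : θ ≤ α) (hηθ : 2 * α - θ < η) {ψ : X} (hψ : ψ ∈ range (ι θ)) {y : ℝ → X} {R : ℝ}
    (hy : SolClass ι α 0 (fun _ => 1) R y)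
    (hy' : ∀ t ∈ Icc (0 : ℝ) 1, y t = S t ψ + convInt S x (σ ∘ y) 0 t) :
    ∃ C : ℝ, (∀ t, 0 < t → t ≤ 1 → NormLE (ι α) (y t) (C * t ^ (-(α - θ)))) ∧
      ∀ s t, 0 ≤ s → s < t → t ≤ 1 →
        NormLE (ι α) (convInt S x (σ ∘ y) s t) (C * (t - s) ^ (η - (α - θ))) := by
  have hα0 := h.alpha_pos
  have hα := h.alpha_lt_one
  have hη0 := h.eta_pos
  obtain ⟨K₀, hK₀, h₀⟩ := h.exists_solClass_comp hσ hσα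
  obtain ⟨K₁, hK₁, h₁⟩ := h.exists_mildHolder
  obtain ⟨K₂, hK₂, h₂⟩ := h.exists_convInt_le
  obtain ⟨K₃, hK₃, h₃⟩ := h.exists_convInt_normLE
  obtain ⟨K₄, hK₄, h₄⟩ := h.exists_convInt_sub_germ_normLE hα0.le hα
  obtain ⟨Lθ, hLθ, hsθ⟩ := h.scale.exists_smoothing_le hθ hθα (by linarith)
  obtain ⟨L, hL, hst⟩ := h.scale.exists_stable hα0.le (by linarith)
  obtain ⟨C, hC, hap⟩ := h.scale.exists_approx hα0 hα.le
  obtain ⟨Cx, hCx, hx⟩ := h.exists_path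
  obtain ⟨Cσ, hCσ, hlip⟩ := hσ.exists_lipschitz
  obtain ⟨Kσ, hKσ, hgr⟩ := hσα.exists_growth
  obtain ⟨cψ, hcψ⟩ := NormLE.of_mem hψ
  have hcψ0 := hcψ.nonneg
  have hR := hy.nonneg isWeight_one le_rfl zero_le_one
  set φ := σ ∘ y with hφdef
  have hφ := h₁ 0 _ _ φ le_rfl isWeight_one (h₀ 0 R _ y le_rfl zero_le_one isWeight_one hy) 1
    zero_le_one le_rfl
  set c := K₁ * (K₀ * (1 + R)) * 1 with hc
  have hc0 : 0 ≤ c := by positivity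
  set γ := α - θ with hγ
  have hγ0 : 0 ≤ γ := by linarith
  have hadd : ∀ s t, 0 ≤ s → s ≤ t → t ≤ 1 → y t = S (t - s) (y s) + convInt S x φ s t := by
    intro s t h1 h2 h3
    have e1 := hy' t ⟨h1.trans h2, h3⟩
    have e2 := hy' s ⟨h1, h2.trans h3⟩
    rw [h.convInt_add le_rfl le_rfl hφ le_rfl h1 h2 h3] at e1
    rw [e1, e2, map_add, ← h.scale.semigroup.add_apply (by linarith) h1, sub_add_cancel]
    abel
  set C₁ := Lθ * cψ + K₃ * c with hC₁
  have hC₁0 : 0 ≤ C₁ := by positivity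
  have hmem : ∀ t, 0 < t → t ≤ 1 → NormLE (ι α) (y t) (C₁ * t ^ (-γ)) := by
    intro t h1 h2
    rw [hy' t ⟨h1.le, h2⟩]
    refine ((hsθ t ⟨h1, h2⟩ ψ cψ hcψ).add
      (h₃ 0 1 c φ le_rfl le_rfl hφ 0 t le_rfl h1 h2)).mono ?_
    have e : θ - α = -γ := by rw [hγ]; ring
    have p := rpow_anti h1 h2 (show -γ ≤ η - α by rw [hγ]; linarith)
    rw [sub_zero, e]
    calc _ ≤ Lθ * t ^ (-γ) * cψ + K₃ * c * t ^ (-γ) := by gcongr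
      _ = _ := by rw [hC₁]; ring
  set C₂ := K₂ * c + C * C₁ with hC₂
  have hC₂0 : 0 ≤ C₂ := by positivity
  have hincr : ∀ s t, 0 < s → s < t → t ≤ 1 → ‖y t - y s‖ ≤ C₂ * s ^ (-γ) * (t - s) ^ α := by
    intro s t h1 h2 h3
    have hts : 0 < t - s := by linarith
    have e : y t - y s = convInt S x φ s t + (S (t - s) (y s) - y s) := by
      rw [hadd s t h1.le h2.le h3]; abel
    have b1 := h₂ 0 1 c φ le_rfl le_rfl hφ s t h1.le h2.le h3
    have b2 := hap (t - s) ⟨hts.le, by linarith⟩ _ _ (hmem s h1 (by linarith))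
    have p1 : (t - s) ^ η ≤ (t - s) ^ α := rpow_anti hts (by linarith) h.alpha_lt.le
    have p2 := one_le_rpow_neg hγ0 h1 (by linarith)
    rw [e]
    calc _ ≤ K₂ * c * (t - s) ^ η + C * (t - s) ^ α * (C₁ * s ^ (-γ)) :=
          (norm_add_le _ _).trans (add_le_add b1 b2)
      _ ≤ K₂ * c * ((t - s) ^ α * s ^ (-γ)) + C * (t - s) ^ α * (C₁ * s ^ (-γ)) := by
          gcongr
          exact p1.trans (le_mul_of_one_le_right (by positivity) p2)
      _ = _ := by rw [hC₂]; ring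
  set C₃ := Kσ * (1 + C₁) with hC₃
  have hC₃0 : 0 ≤ C₃ := by positivity
  have hφmem : ∀ t, 0 < t → t ≤ 1 → NormLE (ι α) (φ t) (C₃ * t ^ (-γ)) := by
    intro t h1 h2
    refine (hgr _ _ (hmem t h1 h2)).mono ?_
    have p2 := one_le_rpow_neg hγ0 h1 h2
    calc _ ≤ Kσ * (t ^ (-γ) + C₁ * t ^ (-γ)) := by gcongr
      _ = _ := by rw [hC₃]; ring
  set C₄ := Cσ * C₂ + C * C₃ with hC₄
  have hC₄0 : 0 ≤ C₄ := by positivity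
  have hφincr : ∀ s t, 0 < s → s < t → t ≤ 1 →
      ‖φ t - S (t - s) (φ s)‖ ≤ C₄ * s ^ (-γ) * (t - s) ^ α := by
    intro s t h1 h2 h3
    have e : φ t - S (t - s) (φ s) = (φ t - φ s) - (S (t - s) (φ s) - φ s) := by abel
    have b1 := (hlip (y t) (y s)).trans (mul_le_mul_of_nonneg_left (hincr s t h1 h2 h3) hCσ.le)
    have b2 := hap (t - s) ⟨by linarith, by linarith⟩ _ _ (hφmem s h1 (by linarith))
    rw [e]
    refine (norm_sub_le _ _).trans ((add_le_add b1 b2).trans (le_of_eq ?_))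
    rw [hC₄]; ring
  have hhalf : ∀ s t, 0 < s → s < t → t ≤ 1 → t ≤ 2 * s →
      NormLE (ι α) (convInt S x φ s t) ((K₄ * C₄ + Cx * L * C₃) * (t - s) ^ (η - γ)) := by
    intro s t h1 h2 h3 h4
    have hts : 0 < t - s := by linarith
    have hs0 : 0 ≤ s ^ (-γ) := by positivity
    have b1 := h₄ s t (C₄ * s ^ (-γ)) φ h1.le h2 h3 (by positivity) (by
      intro r u hr hru hu
      refine (hφincr r u (by linarith) hru (by linarith)).trans ?_
      have p1 : r ^ (-γ) ≤ s ^ (-γ) := Real.rpow_le_rpow_of_nonpos h1 hr (by linarith)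
      have p2 : 0 ≤ (u - r) ^ α := Real.rpow_nonneg (by linarith) _
      gcongr)
    have b2 := (hst (t - s) ⟨hts.le, by linarith⟩ _ _ (hφmem s h1 (by linarith))).smul (x t - x s)
    have b3 := hx s t h1.le h2.le h3
    have e : convInt S x φ s t = (convInt S x φ s t - (x t - x s) • S (t - s) (φ s)) +
      (x t - x s) • S (t - s) (φ s) := by abel
    rw [e]
    refine (b1.add b2).mono ?_
    -- Here t ≤ 2s enters: the singularity at time 0 is traded for a loss of γ in the Hölder
    -- exponent.
    have p1 : s ^ (-γ) ≤ (t - s) ^ (-γ) :=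
      Real.rpow_le_rpow_of_nonpos hts (by linarith) (by linarith)
    rw [show η + α - α = η by ring]
    calc _ ≤ K₄ * (C₄ * (t - s) ^ (-γ)) * (t - s) ^ η +
          Cx * (t - s) ^ η * (L * (C₃ * (t - s) ^ (-γ))) := by gcongr
      _ = (K₄ * C₄ + Cx * L * C₃) * ((t - s) ^ η * (t - s) ^ (-γ)) := by ring
      _ = _ := by rw [← Real.rpow_add hts]; rfl
  obtain ⟨C', hC'⟩ := h.exists_normLE_of_halving hφ (q := η - γ) (by rw [hγ]; linarith)
    (by positivity) hhalf
  refine ⟨max C₁ C', fun t h1 h2 => (hmem t h1 h2).mono ?_,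
    fun s t h1 h2 h3 => (hC' s t h1 h2 h3).mono ?_⟩
  · have : 0 ≤ t ^ (-γ) := Real.rpow_nonneg h1.le _
    gcongr
    exact le_max_left _ _
  · have : 0 ≤ (t - s) ^ (η - γ) := Real.rpow_nonneg (by linarith) _
    gcongr
    exact le_max_right _ _

end YoungSetting

end Regularity

/-! ### Fixed points are mild solutions -/

section Existence

open Filter Topology

variable {X : Type*} [NormedAddCommGroup X] [NormedSpace ℝ X]

theorem lift_zero {F : Type*} [NormedAddCommGroup F] [NormedSpace ℝ F] {j : F →L[ℝ] X}
    (hj : Function.Injective j) : lift j 0 = 0 :=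
  norm_le_zero_iff.1 (norm_lift_le hj (NormLE.zero le_rfl))

theorem valuedIn_holderTri {F : Type*} [NormedAddCommGroup F] [NormedSpace ℝ F] {j : F →L[ℝ] X}
    (hj : Function.Injective j) {β a b C : ℝ} {f : ℝ × ℝ → X}
    (hc : ∀ p ∈ closedTri a b, NormLEContAt j (closedTri a b) f p)
    (h0 : ∀ s ∈ Icc a b, f (s, s) = 0)
    (hf : ∀ s t, a ≤ s → s < t → t ≤ b → NormLE j (f (s, t)) (C * (t - s) ^ β)) :
    ValuedIn j (closedTri a b) (HolderTri β a b) f := by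
  have hmem : ∀ p ∈ closedTri a b, f p ∈ range j := by
    rintro ⟨s, t⟩ ⟨h1, h2, h3⟩
    dsimp only at h1 h2 h3
    rcases h2.eq_or_lt with rfl | h2
    · rw [h0 s ⟨h1, h3⟩]
      exact ⟨0, map_zero _⟩
    · exact (hf s t h1 h2 h3).mem
  refine ⟨fun p => lift j (f p), ⟨continuousOn_lift hj hmem hc, fun s hs => ?_, C, ?_⟩,
    fun p hp => apply_lift (hmem p hp)⟩
  · dsimp only
    rw [h0 s hs, lift_zero hj]
  · intro s t h1 h2 h3
    have : 0 < (t - s) ^ β := Real.rpow_pos_of_pos (by linarith) _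
    rw [div_le_iff₀ this]
    exact norm_lift_le hj (hf s t h1 h2 h3)

variable [CompleteSpace X]
  {E : ℝ → Type*} [∀ l, NormedAddCommGroup (E l)] [∀ l, NormedSpace ℝ (E l)]
  [∀ l, CompleteSpace (E l)]
  {S : ℝ → X →L[ℝ] X} {A : X →ₗ.[ℝ] X} {ι : ∀ l : ℝ, E l →L[ℝ] X} {x : ℝ → ℝ} {η α : ℝ}
  {σ : X → X} {σ' : X → X →L[ℝ] X}

namespace YoungSetting

theorem injective_ι (h : YoungSetting S A ι x η α) : Function.Injective (ι α) :=
  h.scale.injective_ι α h.alpha_pos.le (by linarith [h.alpha_lt_one])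

/-- The parameters are α' = α, β' = 0, ρ = γ = α. Then ρ+η+β'-α' = η, so the condition on γ is just
α < η. -/
theorem admissible_of_solClass (h : YoungSetting S A ι x η α) {c : ℝ} {φ : ℝ → X}
    (hφ : SolClass ι α 0 (fun _ => 1) c φ)
    (hcont : ∀ t ∈ Ioc (0 : ℝ) 1, NormLEContAt (ι α) (Ioc 0 1) φ t) :
    Admissible S ι η 0 1 α 0 α α φ := by
  have hα0 := h.alpha_pos
  have hα := h.alpha_lt_one
  obtain ⟨K₂, hK₂, h₂⟩ := h.exists_mildHolder
  have hc := hφ.nonneg isWeight_one le_rfl zero_le_one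
  have hmild := h₂ 0 c _ φ le_rfl isWeight_one hφ 1 zero_le_one le_rfl
  set d := K₂ * c * 1 with hd
  have hd0 : 0 ≤ d := by positivity
  have hinj0 := h.scale.injective_ι 0 le_rfl (by norm_num)
  refine ⟨by linarith, le_rfl, hα0.le, by linarith, by linarith [h.sum_gt], hα, hα0.le, ?_, ?_, ?_⟩
  · rw [lt_min_iff]
    constructor <;> linarith [h.alpha_lt]
  · refine ⟨fun t => lift (ι α) (φ t),
      ⟨continuousOn_lift h.injective_ι (fun t ht => (hφ.mem t ht.1 ht.2).mem) hcont, c,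
        fun t ht => ?_⟩, fun t ht => apply_lift (hφ.mem t ht.1 ht.2).mem⟩
    have b := norm_lift_le h.injective_ι (hφ.mem t ht.1 ht.2)
    rw [sub_zero] at b ⊢
    have ht0 := ht.1
    calc _ ≤ t ^ α * (c * 1 * t ^ (-α)) := by gcongr
      _ = c * (t ^ α * t ^ (-α)) := by ring
      _ = c := by rw [← Real.rpow_add ht0, add_neg_cancel, Real.rpow_zero, mul_one]
  · have hφc : ContinuousOn φ (Ioc 0 1) := fun t ht => (hcont t ht).continuousWithinAt
    have hle : ∀ s t, 0 < s → s < t → t ≤ 1 →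
        ‖dhat₁ S φ (s, t)‖ ≤ d * s ^ (-α) * (t - s) ^ α := by
      intro s t h1 h2 h3
      refine (hmild.incr s t h1.le h2 h3).trans ?_
      rw [sub_zero, Real.div_rpow (by linarith) (by linarith), div_eq_mul_inv,
        ← Real.rpow_neg (by linarith)]
      have p1 : t ^ (-α) ≤ s ^ (-α) := Real.rpow_le_rpow_of_nonpos h1 h2.le (by linarith)
      have p2 : 0 ≤ (t - s) ^ α := Real.rpow_nonneg (by linarith) _
      calc d * ((t - s) ^ α * t ^ (-α)) ≤ d * ((t - s) ^ α * s ^ (-α)) := by gcongr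
        _ = _ := by ring
    have hdiag : ∀ s, dhat₁ S φ (s, s) = 0 := fun s => by
      simp [dhat₁, h.scale.semigroup.zero_apply]
    refine ⟨fun p => lift (ι 0) (dhat₁ S φ p),
      ⟨continuousOn_lift hinj0 (fun p _ => h.scale.zero_surjective _) ?_, ?_, d, ?_⟩,
      fun p _ => apply_lift (h.scale.zero_surjective _)⟩
    · rintro ⟨s, t⟩ hp
      obtain ⟨h1, h2, h3⟩ := id hp
      dsimp only at h1 h2 h3
      rcases h2.eq_or_lt with rfl | h2
      · refine normLEContAt_diag (C := d * (s / 2) ^ (-α)) hα0 (hdiag s) ?_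
        have hnear : ∀ᶠ p : ℝ × ℝ in 𝓝[openTri 0 1] (s, s), s / 2 < p.1 :=
          nhdsWithin_le_nhds (continuous_fst.continuousAt.eventually
            (lt_mem_nhds (show s / 2 < (s, s).1 by dsimp only; linarith)))
        filter_upwards [hnear, self_mem_nhdsWithin] with p hp hpD
        rcases hpD.2.1.eq_or_lt with he | hlt
        · have e : p = (p.1, p.1) := Prod.ext rfl he.symm
          rw [e, hdiag]
          exact NormLE.zero (by simp [Real.zero_rpow hα0.ne'])
        · refine (h.scale.normLE_zero _).mono ((hle p.1 p.2 hpD.1 hlt hpD.2.2).trans ?_)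
          have p1 : p.1 ^ (-α) ≤ (s / 2) ^ (-α) :=
            Real.rpow_le_rpow_of_nonpos (by linarith) hp.le (by linarith)
          have p2 : 0 ≤ (p.2 - p.1) ^ α := Real.rpow_nonneg (by linarith) _
          gcongr
      · refine h.scale.normLEContAt_zero ?_
        have c1 : ContinuousWithinAt (fun p : ℝ × ℝ => φ p.1) (openTri 0 1) (s, t) :=
          (hφc s ⟨h1, h2.le.trans h3⟩).comp (f := Prod.fst) (x := (s, t)) continuousWithinAt_fst
            fun p hp => ⟨hp.1, hp.2.1.trans hp.2.2⟩
        have c2 : ContinuousWithinAt (fun p : ℝ × ℝ => φ p.2) (openTri 0 1) (s, t) :=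
          (hφc t ⟨h1.trans h2, h3⟩).comp (f := Prod.snd) (x := (s, t)) continuousWithinAt_snd
            fun p hp => ⟨hp.1.trans_le hp.2.1, hp.2.2⟩
        refine Tendsto.sub c2 (h.scale.tendsto_semigroup (by simpa using h2) ?_ ?_
          (by dsimp only; linarith) c1)
        · exact ((continuous_snd.sub continuous_fst).tendsto (s, t)).mono_left nhdsWithin_le_nhds
        · filter_upwards [self_mem_nhdsWithin] with p hp
          linarith [hp.1, hp.2.2]
    · intro s _
      dsimp only
      rw [hdiag, lift_zero hinj0]
    · intro s t h1 h2 h3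
      have p1 : 0 < (t - s) ^ α := Real.rpow_pos_of_pos (by linarith) _
      have b := norm_lift_le hinj0 ((h.scale.normLE_zero _).mono (hle s t h1 h2 h3))
      rw [← div_le_iff₀ p1] at b
      rw [sub_zero]
      calc _ ≤ s ^ α * (d * s ^ (-α)) := by gcongr
        _ = d * (s ^ α * s ^ (-α)) := by ring
        _ = d := by rw [← Real.rpow_add h1, add_neg_cancel, Real.rpow_zero, mul_one]

/-- The sewing function is the germ minus the integral. Its regularity is the remainder estimate in
X_ε, ε < 1, away from time 0, and its defect relation is the cocycle relation of the integral. -/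
theorem isSewing_of_solClass (h : YoungSetting S A ι x η α) {c : ℝ} {φ : ℝ → X}
    (hφ : SolClass ι α 0 (fun _ => 1) c φ) :
    IsSewing S ι (η + α) 0 0 1 (germ x φ)
      (fun p => S (p.2 - p.1) (germ x φ p) - convInt S x φ p.1 p.2) := by
  have hα0 := h.alpha_pos
  obtain ⟨K₂, hK₂, h₂⟩ := h.exists_mildHolder
  have hmild := fun b (h1 : 0 ≤ b) (h2 : b ≤ 1) => h₂ 0 c _ φ le_rfl isWeight_one hφ b h1 h2
  have hgerm : ∀ s t, S (t - s) (germ x φ (s, t)) = (x t - x s) • S (t - s) (φ s) :=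
    fun s t => by rw [germ, map_smul]
  have hφc : ContinuousOn φ (Ioc 0 1) := by
    refine continuousOn_of_local_holder hα0 fun q hq => ⟨c * q ^ (-α), fun s t hs hst ht => ?_⟩
    have b := hφ.incr s t (by linarith) hst ht
    have hs0 : 0 < s := by linarith
    have p1 : s ^ (-α) ≤ q ^ (-α) := Real.rpow_le_rpow_of_nonpos hq hs (by linarith)
    have p2 : 0 ≤ (t - s) ^ α := Real.rpow_nonneg (by linarith) _
    have hc := hφ.nonneg isWeight_one le_rfl zero_le_one
    rw [sub_zero, ← le_div_iff₀ (by positivity), div_eq_mul_inv, ← Real.rpow_neg hs0.le] at b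
    refine b.trans ?_
    calc c * 1 * (t - s) ^ α * s ^ (-α) ≤ c * 1 * (t - s) ^ α * q ^ (-α) := by gcongr
      _ = _ := by ring
  refine ⟨fun ε τ hε hε1 _ hτ hτ1 => ?_, fun r s t hr hrs hst ht => ?_⟩
  · rw [sub_zero] at hτ1
    rw [zero_add τ, zero_add ε]
    have hinj := h.scale.injective_ι ε hε (by linarith)
    obtain ⟨C, p, hp, hk, hM⟩ := h.exists_interior_normLE hφ hτ hε hε1
    have hM' : ∀ s t, τ ≤ s → s < t → t ≤ 1 →
        NormLE (ι ε) (S (t - s) (germ x φ (s, t)) - convInt S x φ s t)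
          (C * (t - s) ^ (η + α - ε)) := by
      intro s t h1 h2 h3
      rw [hgerm, ← neg_sub]
      exact (hM s t h1 h2 h3).neg
    have hdiag : ∀ s, S (s - s) (germ x φ (s, s)) - convInt S x φ s s = 0 := fun s => by
      simp [germ, convInt_self]
    have hq : 0 < η + α - ε := by linarith [h.sum_gt]
    have hmild' : MildHolder S α τ 1 (K₂ * c * 1) φ := by
      have hm := hmild 1 zero_le_one le_rfl
      refine ⟨fun t h1 h2 => hm.bdd t (by linarith) h2, fun s t h1 h2 h3 => ?_⟩
      refine (hm.incr s t (by linarith) h2 h3).trans ?_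
      have := hm.nonneg zero_le_one
      have p1 : ((t - s) / (t - 0)) ^ α ≤ ((t - s) / (t - τ)) ^ α := by
        refine Real.rpow_le_rpow (div_nonneg (by linarith) (by linarith)) ?_ hα0.le
        exact div_le_div_of_nonneg_left (by linarith) (by linarith) (by linarith)
      gcongr
    refine valuedIn_holderTri hinj ?_ (fun s _ => hdiag s) hM'
    rintro ⟨s, t⟩ hp'
    obtain ⟨h1, h2, h3⟩ := id hp'
    dsimp only at h1 h2 h3
    rcases h2.eq_or_lt with rfl | h2
    · refine normLEContAt_diag (C := C) hq (hdiag s) ?_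
      filter_upwards [self_mem_nhdsWithin] with p hpD
      rcases hpD.2.1.eq_or_lt with he | hlt
      · have e : p = (p.1, p.1) := Prod.ext rfl he.symm
        rw [e]
        dsimp only
        rw [hdiag]
        exact NormLE.zero (by simp [Real.zero_rpow hq.ne'])
      · exact hM' p.1 p.2 hpD.1 hlt hpD.2.2
    · refine NormLEContAt.sub ?_ (h.normLEContAt_convInt hτ.le hmild' hp hε (by linarith) hk hp')
      intro e he
      have c1 : ContinuousWithinAt (fun p : ℝ × ℝ => φ p.1) (closedTri τ 1) (s, t) :=
        (hφc s ⟨by linarith, h2.le.trans h3⟩).comp (f := Prod.fst) (x := (s, t))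
          continuousWithinAt_fst fun p hp => ⟨by linarith [hp.1], hp.2.1.trans hp.2.2⟩
      have c2 : ContinuousWithinAt (fun p : ℝ × ℝ => x p.1) (closedTri τ 1) (s, t) :=
        (h.continuousOn_path s ⟨by linarith, h2.le.trans h3⟩).comp (f := Prod.fst) (x := (s, t))
          continuousWithinAt_fst fun p hp => ⟨by linarith [hp.1], hp.2.1.trans hp.2.2⟩
      have c3 : ContinuousWithinAt (fun p : ℝ × ℝ => x p.2) (closedTri τ 1) (s, t) :=
        (h.continuousOn_path t ⟨by linarith, h3⟩).comp (f := Prod.snd) (x := (s, t))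
          continuousWithinAt_snd fun p hp => ⟨by linarith [hp.1, hp.2.1], hp.2.2⟩
      refine h.scale.eventually_normLE hε (by linarith) (by simpa using h2) ?_ ?_
        (by dsimp only; linarith) ((c3.sub c2).smul c1) he
      · exact ((continuous_snd.sub continuous_fst).tendsto (s, t)).mono_left nhdsWithin_le_nhds
      · filter_upwards [self_mem_nhdsWithin] with p hp
        linarith [hp.1, hp.2.2]
  · have hadd := h.convInt_add le_rfl ht (hmild t (by linarith) ht) hr.le hrs hst le_rfl
    simp only [dhat₂, dS₂, hgerm, hadd]
    rw [map_sub, map_smul, h.scale.semigroup.comp_apply hrs hst]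
    simp only [germ, map_add, map_neg, map_sub, map_smul]
    rw [h.scale.semigroup.comp_apply hrs hst]
    module

theorem exists_mildSolution (h : YoungSetting S A ι x η α)
    (hσ : HasNiceGateauxDeriv σ σ') (hσα : LipschitzOnSubspace (ι α) σ) {θ : ℝ} (hθ : 0 ≤ θ)
    (hθα : θ ≤ α) (hηθ : 2 * α - θ < η) {ψ : X} (hψ : ψ ∈ range (ι θ)) :
    ∃ (y : ℝ → X) (R : ℝ), SolClass ι α 0 (fun _ => 1) R y ∧
      (∀ t ∈ Icc (0 : ℝ) 1, y t = S t ψ + convInt S x (σ ∘ y) 0 t) ∧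
      IsMildSolution S ι η x σ ψ y ∧ MemY S ι α (α - θ) y := by
  have hα0 := h.alpha_pos
  have hα := h.alpha_lt_one
  obtain ⟨y, R, hy, hy'⟩ := h.exists_fixedPoint hσ hσα ψ
  obtain ⟨C, hmem, hk⟩ := h.exists_regular hσ hσα hθ hθα hηθ hψ hy hy'
  obtain ⟨K₀, hK₀, h₀⟩ := h.exists_solClass_comp hσ hσα
  obtain ⟨K₁, hK₁, h₁⟩ := h.exists_mildHolder
  have hφ := h₀ 0 R _ y le_rfl zero_le_one isWeight_one hy
  have hmild := h₁ 0 _ _ _ le_rfl isWeight_one hφ 1 zero_le_one le_rfl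
  have hC : 0 ≤ C := by
    have := (hmem 1 one_pos le_rfl).nonneg
    rwa [Real.one_rpow, mul_one] at this
  -- This is the assumption η > 2α-θ: mild increments of y are better than α-Hölder in X_α, up to
  -- time 0.
  have hq : α < η - (α - θ) := by linarith
  have hcontk : ∀ p ∈ closedTri 0 1,
      NormLEContAt (ι α) (closedTri 0 1) (fun p => convInt S x (σ ∘ y) p.1 p.2) p :=
    fun p hp => h.normLEContAt_convInt le_rfl hmild (by linarith) hα0.le (by linarith) hk hp
  have hconty : ∀ t ∈ Ioc (0 : ℝ) 1, NormLEContAt (ι α) (Ioc 0 1) y t := by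
    intro t ht
    have c1 := (h.normLEContAt_primitive le_rfl hmild (by linarith) hα0.le (by linarith) hk
      (Ioc_subset_Icc_self ht)).mono Ioc_subset_Icc_self
    have c2 : NormLEContAt (ι α) (Ioc 0 1) (fun t => S t ψ) t := by
      intro e he
      refine h.scale.eventually_normLE hα0.le (by linarith) ht.1
        (tendsto_id.mono_left nhdsWithin_le_nhds) ?_ ht.2 tendsto_const_nhds he
      filter_upwards [self_mem_nhdsWithin] with s hs using hs.2
    exact (c2.add c1).congr ht fun s hs => (hy' s (Ioc_subset_Icc_self hs)).symm
  have hcontφ : ∀ t ∈ Ioc (0 : ℝ) 1, NormLEContAt (ι α) (Ioc 0 1) (σ ∘ y) t := by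
    intro t ht e he
    obtain ⟨K, hK, hsub⟩ := hσα.exists_sub h.injective_ι
    filter_upwards [hconty t ht (e / K) (by positivity), self_mem_nhdsWithin] with s hs hs'
    have := hsub _ _ _ (hy.mem s hs'.1 hs'.2).mem (hy.mem t ht.1 ht.2).mem hs
    rwa [mul_div_cancel₀ _ hK.ne'] at this
  refine ⟨y, R, hy, hy', ⟨fun p => convInt S x (σ ∘ y) p.1 p.2, ⟨α, 0, α, α,
    h.admissible_of_solClass hφ hcontφ, ⟨_, h.isSewing_of_solClass hφ, fun p _ => ?_⟩,
    fun p hp => (hcontk p hp).continuousWithinAt⟩, hy'⟩, ?_, ?_, ?_⟩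
  · abel
  · refine ⟨fun t => lift (ι α) (y t), ⟨continuousOn_lift h.injective_ι
      (fun t ht => (hmem t ht.1 ht.2).mem) hconty, C, fun t ht => ?_⟩,
      fun t ht => apply_lift (hmem t ht.1 ht.2).mem⟩
    have b := norm_lift_le h.injective_ι (hmem t ht.1 ht.2)
    have ht0 := ht.1
    rw [sub_zero]
    calc _ ≤ t ^ (α - θ) * (C * t ^ (-(α - θ))) := by gcongr
      _ = C * (t ^ (α - θ) * t ^ (-(α - θ))) := by ring
      _ = C := by rw [← Real.rpow_add ht0, add_neg_cancel, Real.rpow_zero, mul_one]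
  · refine ⟨fun t ht => (hconty t ht).continuousWithinAt, R * 1, fun t ht => ?_⟩
    rw [Real.rpow_zero, one_mul]
    exact hy.bdd t ht.1.le ht.2
  · have e : ∀ p ∈ closedTri 0 1, convInt S x (σ ∘ y) p.1 p.2 = dhat₁ S y p := by
      rintro ⟨s, t⟩ ⟨h1, h2, h3⟩
      dsimp only at h1 h2 h3 ⊢
      have e1 := hy' t ⟨h1.trans h2, h3⟩
      have e2 := hy' s ⟨h1, h2.trans h3⟩
      rw [h.convInt_add le_rfl le_rfl hmild le_rfl h1 h2 h3] at e1
      rw [dhat₁, e1, e2, map_add, ← h.scale.semigroup.add_apply (by linarith) h1, sub_add_cancel]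
      abel
    refine valuedIn_holderTri (C := C) h.injective_ι (fun p hp => (hcontk p hp).congr hp e)
      (fun s _ => ?_) fun s t h1 h2 h3 => ?_
    · simp [dhat₁, h.scale.semigroup.zero_apply]
    · rw [← e (s, t) ⟨h1, h2.le, h3⟩]
      refine (hk s t h1 h2 h3).mono ?_
      have := rpow_anti (sub_pos.2 h2) (by linarith) hq.le
      gcongr

end YoungSetting

end Existence

/-! ### Uniqueness of mild solutions -/

section Uniqueness

open Filter Topology

variable {X : Type*} [NormedAddCommGroup X] [NormedSpace ℝ X]

theorem tendsto_left_of_continuousOn {k : ℝ × ℝ → X} (hc : ContinuousOn k (closedTri 0 1)) {t : ℝ}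
    (ht : 0 < t) (ht1 : t ≤ 1) : Tendsto (fun r => k (r, t)) (𝓝[>] 0) (𝓝 (k (0, t))) := by
  refine (hc (0, t) ⟨le_rfl, ht.le, ht1⟩).tendsto.comp (tendsto_nhdsWithin_iff.2 ⟨?_, ?_⟩)
  · exact ((by fun_prop : Continuous fun r : ℝ => (r, t)).tendsto 0).mono_left nhdsWithin_le_nhds
  · filter_upwards [Ioo_mem_nhdsGT ht] with r hr
    exact ⟨hr.1.le, hr.2.le, ht1⟩

/-- The cocycle relation of a convolution integral extends to the boundary of the triangle. -/
theorem cocycle_of_continuousOn {S : ℝ → X →L[ℝ] X} (hS : IsSemigroup S) {k : ℝ × ℝ → X}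
    (hc : ContinuousOn k (closedTri 0 1))
    (hk : ∀ r s t, 0 < r → r ≤ s → s ≤ t → t ≤ 1 → k (r, t) = k (s, t) + S (t - s) (k (r, s))) :
    k (0, 0) = 0 ∧ ∀ r s t, 0 ≤ r → r ≤ s → s ≤ t → t ≤ 1 →
      k (r, t) = k (s, t) + S (t - s) (k (r, s)) := by
  have h0 : k (0, 0) = 0 := by
    have hd : Tendsto (fun r => k (r, r)) (𝓝[>] 0) (𝓝 (k (0, 0))) := by
      refine (hc (0, 0) ⟨le_rfl, le_rfl, zero_le_one⟩).tendsto.comp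
        (tendsto_nhdsWithin_iff.2 ⟨?_, ?_⟩)
      · exact ((by fun_prop : Continuous fun r : ℝ => (r, r)).tendsto 0).mono_left
          nhdsWithin_le_nhds
      · filter_upwards [Ioo_mem_nhdsGT one_pos] with r hr
        exact ⟨hr.1.le, le_rfl, hr.2.le⟩
    refine tendsto_nhds_unique hd (tendsto_const_nhds.congr' ?_)
    filter_upwards [Ioo_mem_nhdsGT one_pos] with r hr
    have e := hk r r r hr.1 le_rfl le_rfl hr.2.le
    rw [sub_self, hS.zero_apply] at e
    exact (left_eq_add.1 e).symm
  refine ⟨h0, fun r s t hr hrs hst ht => ?_⟩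
  rcases hr.eq_or_lt with rfl | hr
  · rcases hrs.eq_or_lt with rfl | hs
    · rw [h0, map_zero, add_zero]
    · refine tendsto_nhds_unique (tendsto_left_of_continuousOn hc (hs.trans_le hst) ht)
        ((tendsto_const_nhds.add (((S (t - s)).continuous.tendsto _).comp
          (tendsto_left_of_continuousOn hc hs (hst.trans ht)))).congr' ?_)
      filter_upwards [Ioo_mem_nhdsGT hs] with r hr
      exact (hk r s t hr.1 hr.2.le hst ht).symm
  · exact hk r s t hr hrs hst ht

theorem exists_normLE_of_holderTri {F : Type*} [NormedAddCommGroup F] [NormedSpace ℝ F]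
    {j : F →L[ℝ] X} {β a b : ℝ} {f : ℝ × ℝ → X}
    (h : ValuedIn j (closedTri a b) (HolderTri β a b) f) :
    ∃ C : ℝ, 0 ≤ C ∧ ∀ s t, a ≤ s → s ≤ t → t ≤ b → NormLE j (f (s, t)) (C * (t - s) ^ β) := by
  obtain ⟨g, ⟨-, h0, C, hC⟩, hg⟩ := h
  refine ⟨max C 0, le_max_right _ _, fun s t h1 h2 h3 => ⟨g (s, t), hg _ ⟨h1, h2, h3⟩, ?_⟩⟩
  rcases h2.eq_or_lt with rfl | h2
  · rw [h0 s ⟨h1, h3⟩, norm_zero]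
    exact mul_nonneg (le_max_right _ _) (Real.rpow_nonneg (by linarith) _)
  · have p := Real.rpow_pos_of_pos (sub_pos.2 h2) β
    have b := hC s t h1 h2 h3
    rw [div_le_iff₀ p] at b
    exact b.trans (mul_le_mul_of_nonneg_right (le_max_left _ _) p.le)

theorem SolClass.of_tendsto {E : ℝ → Type*} [∀ l, NormedAddCommGroup (E l)]
    [∀ l, NormedSpace ℝ (E l)] {ι : ∀ l : ℝ, E l →L[ℝ] X} {α a d : ℝ} {ω : ℝ → ℝ} {y : ℝ → X}
    (hι : Function.Injective (ι α)) {f : ℕ → ℝ} (hf : Tendsto f atTop (𝓝 d))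
    (h : ∀ n, SolClass ι α a ω (f n) y) : SolClass ι α a ω d y where
  mem t h1 h2 := NormLE.of_tendsto hι ((hf.mul_const _).mul_const _)
    (Eventually.of_forall fun n => (h n).mem t h1 h2)
  bdd t h1 h2 := ge_of_tendsto (hf.mul_const _) (Eventually.of_forall fun n => (h n).bdd t h1 h2)
  incr s t h1 h2 h3 := ge_of_tendsto ((hf.mul_const _).mul_const _)
    (Eventually.of_forall fun n => (h n).incr s t h1 h2 h3)

/-- Iterating c ↦ (d+c)/2 converges to d, whatever the initial c. The a priori constant thus forgets
the qualitative bound it started from. -/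
theorem SolClass.of_halving {E : ℝ → Type*} [∀ l, NormedAddCommGroup (E l)]
    [∀ l, NormedSpace ℝ (E l)] {ι : ∀ l : ℝ, E l →L[ℝ] X} {α a c d : ℝ} {ω : ℝ → ℝ} {y : ℝ → X}
    (hι : Function.Injective (ι α)) (h : SolClass ι α a ω c y)
    (hs : ∀ c, SolClass ι α a ω c y → SolClass ι α a ω (d / 2 + c / 2) y) :
    SolClass ι α a ω d y := by
  have hn : ∀ n : ℕ, SolClass ι α a ω (d + (c - d) * (1 / 2) ^ n) y := by
    intro n
    induction n with
    | zero => simpa using h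
    | succ n ih =>
      convert hs _ ih using 1
      ring
  refine SolClass.of_tendsto hι ?_ hn
  have := (tendsto_pow_atTop_nhds_zero_of_lt_one (by norm_num : (0 : ℝ) ≤ 1 / 2)
    (by norm_num)).const_mul (c - d) |>.const_add d
  simpa using this

/-- A bound in the solution class that is uniform in the initial time extends to time `0`. -/
theorem SolClass.of_forall_pos {E : ℝ → Type*} [∀ l, NormedAddCommGroup (E l)]
    [∀ l, NormedSpace ℝ (E l)] {ι : ∀ l : ℝ, E l →L[ℝ] X} {α c : ℝ} {ω : ℝ → ℝ} {y : ℝ → X}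
    (hι : Function.Injective (ι α)) (hα : 0 < α) (h : ∀ a ∈ Ioo (0 : ℝ) 1, SolClass ι α a ω c y)
    (h0 : ‖y 0‖ ≤ c * ω 0) : SolClass ι α 0 ω c y where
  mem t h1 h2 := by
    have hsub : Tendsto (fun a : ℝ => t - a) (𝓝[>] 0) (𝓝 (t - 0)) :=
      ((by fun_prop : Continuous fun a : ℝ => t - a).tendsto 0).mono_left nhdsWithin_le_nhds
    refine NormLE.of_tendsto hι
      ((hsub.rpow_const (Or.inl (by linarith))).const_mul (c * ω t)) ?_
    filter_upwards [Ioo_mem_nhdsGT h1] with a ha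
    exact (h a ⟨ha.1, ha.2.trans_le h2⟩).mem t ha.2 h2
  bdd t h1 h2 := by
    rcases h1.eq_or_lt with rfl | h1
    · exact h0
    · exact (h (t / 2) ⟨by linarith, by linarith⟩).bdd t (by linarith) h2
  incr s t h1 h2 h3 := by
    have hsub : Tendsto (fun a : ℝ => s - a) (𝓝[>] 0) (𝓝 (s - 0)) :=
      ((by fun_prop : Continuous fun a : ℝ => s - a).tendsto 0).mono_left nhdsWithin_le_nhds
    refine le_of_tendsto ((hsub.rpow_const (Or.inr hα.le)).const_mul ‖y t - y s‖) ?_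
    filter_upwards [Ioo_mem_nhdsGT h1] with a ha
    exact (h a ⟨ha.1, by linarith [ha.2]⟩).incr s t ha.2 h2 h3

variable [CompleteSpace X]
  {E : ℝ → Type*} [∀ l, NormedAddCommGroup (E l)] [∀ l, NormedSpace ℝ (E l)]
  [∀ l, CompleteSpace (E l)]
  {S : ℝ → X →L[ℝ] X} {A : X →ₗ.[ℝ] X} {ι : ∀ l : ℝ, E l →L[ℝ] X} {x : ℝ → ℝ} {η α : ℝ}
  {σ : X → X} {σ' : X → X →L[ℝ] X}

theorem IsSewing.exists_normLE {μ β : ℝ} {g M : ℝ × ℝ → X} (h : IsSewing S ι μ β 0 1 g M)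
    {l τ : ℝ} (hβl : β ≤ l) (hl : l < β + 1) (hl2 : l < 2) (hτ : 0 < τ) (hτ1 : τ < 1) :
    ∃ C : ℝ, 0 ≤ C ∧ ∀ s t, τ ≤ s → s ≤ t → t ≤ 1 →
      NormLE (ι l) (M (s, t)) (C * (t - s) ^ (μ - (l - β))) := by
  obtain ⟨ε, rfl⟩ : ∃ ε, l = β + ε := ⟨l - β, by ring⟩
  have := exists_normLE_of_holderTri
    (h.regular ε τ (by linarith) (by linarith) hl2 hτ (by linarith))
  rwa [zero_add, show μ - ε = μ - (β + ε - β) by ring] at this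

theorem IsSewing.cocycle (hS : IsSemigroup S) {μ β : ℝ} {φ : ℝ → X} {k M : ℝ × ℝ → X}
    (h : IsSewing S ι μ β 0 1 (germ x φ) M)
    (hk : ∀ p ∈ openTri 0 1, k p = S (p.2 - p.1) (germ x φ p) - M p) {r s t : ℝ} (hr : 0 < r)
    (hrs : r ≤ s) (hst : s ≤ t) (ht : t ≤ 1) : k (r, t) = k (s, t) + S (t - s) (k (r, s)) := by
  have e := h.dhat r s t hr hrs hst ht
  rw [hk (r, t) ⟨hr, hrs.trans hst, ht⟩, hk (s, t) ⟨hr.trans_le hrs, hst, ht⟩,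
    hk (r, s) ⟨hr, hrs, hst.trans ht⟩]
  simp only [dhat₂, dS₂] at e
  rw [show M (r, t) = M (s, t) + S (t - s) (M (r, s)) +
    (M (r, t) - M (s, t) - S (t - s) (M (r, s))) by abel, e]
  simp only [germ, map_add, map_neg, map_sub, map_smul, hS.comp_apply hrs hst]
  module

namespace YoungSetting

/-- Away from time `0`, a bounded mild solution lies in the solution class and its convolution
integral is close to the germ. -/
theorem exists_interior_solClass (h : YoungSetting S A ι x η α) {ρ β B b : ℝ}
    {φ z : ℝ → X} {k M : ℝ × ℝ → X} (hβ : 0 ≤ β) (hβ2 : β < 2) (hρ : 1 < η + ρ)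
    (hM : IsSewing S ι (η + ρ) β 0 1 (germ x φ) M)
    (hk : ∀ p ∈ openTri 0 1, k p = S (p.2 - p.1) (germ x φ p) - M p)
    (hz : ∀ s t, 0 ≤ s → s ≤ t → t ≤ 1 → z t = S (t - s) (z s) + k (s, t))
    (hB : ∀ t ∈ Icc (0 : ℝ) 1, ‖z t‖ ≤ B) (hb : ∀ t ∈ Icc (0 : ℝ) 1, ‖φ t‖ ≤ b)
    {τ : ℝ} (hτ : 0 < τ) (hτ1 : τ < 1) :
    (∃ c, SolClass ι α τ (fun _ => 1) c z) ∧ ∃ C, ∀ s t, τ ≤ s → s ≤ t → t ≤ 1 →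
      ‖k (s, t) - (x t - x s) • S (t - s) (φ s)‖ ≤ C * (t - s) ^ (η + ρ) := by
  have hα0 := h.alpha_pos
  have hα := h.alpha_lt_one
  have hB0 : 0 ≤ B := (norm_nonneg _).trans (hB 0 ⟨le_rfl, zero_le_one⟩)
  have hb0 : 0 ≤ b := (norm_nonneg _).trans (hb 0 ⟨le_rfl, zero_le_one⟩)
  obtain ⟨P, hP, hx⟩ := h.exists_path
  obtain ⟨L, hL, hLS⟩ := h.scale.exists_bound
  obtain ⟨L', hL', hLS'⟩ := h.scale.exists_smoothing hα0.le (by linarith)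
  obtain ⟨D, hD, hDS⟩ := h.scale.exists_approx hα0 hα.le
  obtain ⟨C, hC, hMn⟩ : ∃ C : ℝ, 0 ≤ C ∧ ∀ s t, τ ≤ s → s ≤ t → t ≤ 1 →
      ‖M (s, t)‖ ≤ C * (t - s) ^ (η + ρ) := by
    obtain ⟨C, hC, hMC⟩ := hM.exists_normLE le_rfl (by linarith) hβ2 hτ hτ1
    refine ⟨‖ι β‖ * C, by positivity, fun s t h1 h2 h3 => ?_⟩
    have := (hMC s t h1 h2 h3).norm_le
    rwa [sub_self, sub_zero, ← mul_assoc] at this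
  obtain ⟨N, hN⟩ : ∃ N : ℝ, ∀ t, τ ≤ t → t ≤ 1 → NormLE (ι α) (z t) N := by
    -- The sewing map gains less than one unit of space regularity over β; this reaches X_α whatever
    -- parameters the solution came with.
    have hl : max α β < β + 1 := max_lt (by linarith) (by linarith)
    have hl2 : max α β < 2 := max_lt (by linarith) hβ2
    obtain ⟨C', hC', hMC⟩ := hM.exists_normLE (le_max_right α β) hl hl2 (half_pos hτ)
      (by linarith)
    obtain ⟨K, hK, hKe⟩ := h.scale.exists_embedding hα0.le (le_max_left α β) hl2
    refine ⟨L' * (τ / 2) ^ (-α) * (B + P * b) + K * C', fun t h1 h2 => ?_⟩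
    -- Restarting at τ/2 leaves a smoothing time of at least τ/2, so the first term is in X_α
    -- uniformly for t ≥ τ.
    have e : z t = S (t - τ / 2) (z (τ / 2) + germ x φ (τ / 2, t)) - M (τ / 2, t) := by
      rw [hz (τ / 2) t (by linarith) (by linarith) h2,
        hk _ ⟨by dsimp only; linarith, by dsimp only; linarith, h2⟩, map_add]
      abel
    rw [e]
    refine NormLE.sub ?_ ?_
    · refine (hLS' _ ⟨by linarith, by linarith⟩ _).mono ?_
      have p1 : (t - τ / 2) ^ (-α) ≤ (τ / 2) ^ (-α) :=
        Real.rpow_le_rpow_of_nonpos (by linarith) (by linarith) (by linarith)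
      have p2 : (t - τ / 2) ^ η ≤ 1 :=
        Real.rpow_le_one (by linarith) (by linarith) h.eta_pos.le
      have p3 : ‖germ x φ (τ / 2, t)‖ ≤ P * b := by
        rw [germ, norm_smul, Real.norm_eq_abs]
        have p4 := hx (τ / 2) t (by linarith) (by linarith) h2
        have p5 : |x t - x (τ / 2)| ≤ P * 1 := p4.trans (by gcongr)
        rw [mul_one] at p5
        exact mul_le_mul p5 (hb _ ⟨by linarith, by linarith⟩) (norm_nonneg _) hP.le
      have p6 : ‖z (τ / 2) + germ x φ (τ / 2, t)‖ ≤ B + P * b :=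
        (norm_add_le _ _).trans (add_le_add (hB _ ⟨by linarith, by linarith⟩) p3)
      gcongr
    · refine (hKe _ _ (hMC (τ / 2) t le_rfl (by linarith) h2)).mono ?_
      have p1 : (t - τ / 2) ^ (η + ρ - (max α β - β)) ≤ 1 :=
        Real.rpow_le_one (by linarith) (by linarith) (by linarith)
      calc K * (C' * (t - τ / 2) ^ (η + ρ - (max α β - β))) ≤ K * (C' * 1) := by gcongr
        _ = K * C' := by ring
  have hN0 : 0 ≤ N := (hN 1 hτ1.le le_rfl).nonneg
  have hkM : ∀ s t, τ ≤ s → s ≤ t → t ≤ 1 →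
      k (s, t) - (x t - x s) • S (t - s) (φ s) = -M (s, t) := by
    intro s t h1 h2 h3
    rw [hk _ ⟨by dsimp only; linarith, h2, h3⟩, germ, map_smul]
    abel
  refine ⟨⟨N + B + D * N + L * P * b + C, fun t h1 h2 => ?_, fun t h1 h2 => ?_,
    fun s t h1 h2 h3 => ?_⟩, C, fun s t h1 h2 h3 => ?_⟩
  · refine (hN t h1.le h2).mono ?_
    have p1 : 1 ≤ (t - τ) ^ (-α) := one_le_rpow_neg hα0.le (by linarith) (by linarith)
    have p2 : N ≤ N + B + D * N + L * P * b + C := by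
      have : 0 ≤ B + D * N + L * P * b + C := by positivity
      linarith
    calc N ≤ N + B + D * N + L * P * b + C := p2
      _ ≤ (N + B + D * N + L * P * b + C) * 1 * (t - τ) ^ (-α) := by
        rw [mul_one]
        exact le_mul_of_one_le_right (by positivity) p1
  · refine (hB t ⟨by linarith, h2⟩).trans ?_
    have : 0 ≤ N + D * N + L * P * b + C := by positivity
    linarith
  · have q0 : 0 ≤ (t - s) ^ α := Real.rpow_nonneg (by linarith) _
    have q1 : (t - s) ^ η ≤ (t - s) ^ α :=
      rpow_anti (by linarith) (by linarith) h.alpha_lt.le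
    have q2 : (t - s) ^ (η + ρ) ≤ (t - s) ^ α :=
      rpow_anti (by linarith) (by linarith) (by linarith)
    have q3 : (s - τ) ^ α ≤ 1 := Real.rpow_le_one (by linarith) (by linarith) hα0.le
    have e : z t - z s = (S (t - s) (z s) - z s) + (x t - x s) • S (t - s) (φ s) - M (s, t) := by
      rw [hz s t (by linarith) h2.le h3, sub_eq_add_neg _ (M (s, t)), ← hkM s t h1.le h2.le h3]
      abel
    have b1 := hDS (t - s) ⟨by linarith, by linarith⟩ _ _ (hN s h1.le (by linarith))
    have b2 : ‖(x t - x s) • S (t - s) (φ s)‖ ≤ L * P * b * (t - s) ^ α := by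
      rw [norm_smul, Real.norm_eq_abs]
      calc _ ≤ (P * (t - s) ^ η) * (L * b) := by
            refine mul_le_mul (hx s t (by linarith) h2.le h3) ?_ (norm_nonneg _) (by positivity)
            exact (hLS (t - s) ⟨by linarith, by linarith⟩ _).trans
              (mul_le_mul_of_nonneg_left (hb s ⟨by linarith, by linarith⟩) (by linarith))
        _ ≤ (P * (t - s) ^ α) * (L * b) := by gcongr
        _ = _ := by ring
    have b3 : ‖M (s, t)‖ ≤ C * (t - s) ^ α :=
      (hMn s t h1.le h2.le h3).trans (mul_le_mul_of_nonneg_left q2 hC)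
    have b4 : ‖z t - z s‖ ≤ (D * N + L * P * b + C) * (t - s) ^ α := by
      rw [e]
      refine (norm_sub_le _ _).trans ?_
      have := norm_add_le (S (t - s) (z s) - z s) ((x t - x s) • S (t - s) (φ s))
      linarith
    calc _ ≤ ‖z t - z s‖ * 1 := by gcongr
      _ ≤ (D * N + L * P * b + C) * (t - s) ^ α := by rw [mul_one]; exact b4
      _ ≤ _ := by
        refine mul_le_mul_of_nonneg_right ?_ q0
        linarith
  · rw [hkM s t h1 h2 h3, norm_neg]
    exact hMn s t h1 h2 h3

/-- Every mild solution is a fixed point in the solution class. -/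
theorem exists_solClass_of_isMildSolution (h : YoungSetting S A ι x η α)
    (hσ : HasNiceGateauxDeriv σ σ') (hσα : LipschitzOnSubspace (ι α) σ) {ψ : X} {z : ℝ → X}
    (hz : IsMildSolution S ι η x σ ψ z) :
    ∃ R, SolClass ι α 0 (fun _ => 1) R z ∧
      ∀ t ∈ Icc (0 : ℝ) 1, z t = S t ψ + convInt S x (σ ∘ z) 0 t := by
  have hα0 := h.alpha_pos
  have hS := h.scale.semigroup
  obtain ⟨k, ⟨α', β, ρ, γ, hadm, ⟨M, hM, hkM⟩, hkc⟩, hzk⟩ := hz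
  obtain ⟨hk0, hk⟩ := cocycle_of_continuousOn hS hkc
    fun r s t hr hrs hst ht => hM.cocycle hS hkM hr hrs hst ht
  have hz1 : ∀ s t, 0 ≤ s → s ≤ t → t ≤ 1 → z t = S (t - s) (z s) + k (s, t) := by
    intro s t h1 h2 h3
    rw [hzk t ⟨h1.trans h2, h3⟩, hzk s ⟨h1, h2.trans h3⟩, hk 0 s t le_rfl h1 h2 h3, map_add,
      ← hS.add_apply (by linarith) h1, sub_add_cancel]
    abel
  obtain ⟨L, hL, hLS⟩ := h.scale.exists_bound
  -- Boundedness up to time 0 is extracted from continuity of the integral on the closed triangle;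
  -- it is the only uniform information available at this point.
  obtain ⟨B, hB⟩ : ∃ B, ∀ t ∈ Icc (0 : ℝ) 1, ‖z t‖ ≤ B := by
    obtain ⟨C, hC⟩ := isCompact_Icc.exists_bound_of_continuousOn (s := Icc (0 : ℝ) 1)
      (f := fun t => k (0, t)) (hkc.comp (by fun_prop) fun t ht => ⟨le_rfl, ht.1, ht.2⟩)
    refine ⟨L * ‖ψ‖ + C, fun t ht => ?_⟩
    rw [hzk t ht]
    exact (norm_add_le _ _).trans (add_le_add (hLS t ht ψ) (hC t ht))
  have hB0 : 0 ≤ B := (norm_nonneg _).trans (hB 0 ⟨le_rfl, zero_le_one⟩)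
  obtain ⟨b, hb⟩ : ∃ b, ∀ t ∈ Icc (0 : ℝ) 1, ‖(σ ∘ z) t‖ ≤ b := by
    obtain ⟨C, hC, hσC⟩ := hσ.exists_lipschitz
    refine ⟨C * B + ‖σ 0‖, fun t ht => ?_⟩
    have h1 := hσC (z t) 0
    rw [sub_zero] at h1
    calc ‖σ (z t)‖ ≤ ‖σ (z t) - σ 0‖ + ‖σ 0‖ := by
          simpa using norm_add_le (σ (z t) - σ 0) (σ 0)
      _ ≤ C * B + ‖σ 0‖ := by
        gcongr
        exact h1.trans (mul_le_mul_of_nonneg_left (hB t ht) hC.le)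
  obtain ⟨K₀, hK₀, hcomp⟩ := h.exists_solClass_comp hσ hσα
  obtain ⟨K₁, hK₁, hmild⟩ := h.exists_mildHolder
  have hconv : ∀ τ ∈ Ioo (0 : ℝ) 1, ∃ c, SolClass ι α τ (fun _ => 1) c z ∧
      ∀ t, τ ≤ t → t ≤ 1 → k (τ, t) = convInt S x (σ ∘ z) τ t := by
    intro τ hτ
    obtain ⟨⟨c, hc⟩, C, hC⟩ := h.exists_interior_solClass hadm.beta_nonneg
      (hadm.beta_le.trans_lt hadm.alpha_lt) (by linarith [hadm.rho_gt]) hM hkM hz1 hB hb hτ.1 hτ.2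
    refine ⟨c, hc, fun t h1 h2 => ?_⟩
    have hφ := hmild τ _ _ _ hτ.1.le isWeight_one
      (hcomp τ c _ z hτ.1.le hτ.2.le isWeight_one hc) 1 hτ.2.le le_rfl
    exact h.eq_convInt (k := fun s t => k (s, t)) hτ.1.le le_rfl hφ
      (by linarith [hadm.rho_gt] : 1 < η + ρ)
      (fun r s t h1 h2 h3 h4 => hk r s t (hτ.1.le.trans h1) h2 h3 h4) hC le_rfl h1 h2
  obtain ⟨K₂, hK₂, hdatum⟩ := h.exists_solClass_datum
  obtain ⟨K₃, hK₃, hint⟩ := h.exists_convInt_comp hσ hσα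
  obtain ⟨δ, hδ, hδ1, hKδ⟩ := h.exists_step K₃
  have hw := isWeight_exp hδ
  -- The constant c at τ may blow up as τ→0. With δ chosen so that the integral contributes at most
  -- (1+c)/2, the equation restarted at τ improves c to K₂B+(1+c)/2, and the halving argument
  -- removes the dependence on τ.
  have huniform : ∀ τ ∈ Ioo (0 : ℝ) 1,
      SolClass ι α τ (fun t => Real.exp (t / δ)) (2 * (K₂ * B) + 1 + B) z := by
    intro τ hτ
    obtain ⟨c, hc, hkτ⟩ := hconv τ hτ
    refine ((hc.of_one hw hτ.1.le hτ.2.le).of_halving (d := 2 * (K₂ * B) + 1) h.injective_ι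
      fun c hc => ?_).mono_const hw hτ.1.le (by linarith)
    have hc0 := hc.nonneg hw hτ.1.le hτ.2.le
    have s1 := (hdatum τ (z τ) hτ.1.le).of_one hw hτ.1.le hτ.2.le
    have s2 := hint τ c δ z hτ.1.le hτ.2.le hδ hδ1 hc
    refine ((s1.add s2).congr fun t h1 h2 => ?_).mono_const hw hτ.1.le ?_
    · rw [hz1 τ t hτ.1.le h1 h2, hkτ t h1 h2]
    · have b1 := mul_le_mul_of_nonneg_left (hB τ ⟨hτ.1.le, hτ.2.le⟩) hK₂.le
      have b2 := mul_le_mul_of_nonneg_right hKδ (by linarith : 0 ≤ 1 + c)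
      linarith
  have hclass := (SolClass.of_forall_pos h.injective_ι hα0 huniform (by
    have := hB 0 ⟨le_rfl, zero_le_one⟩
    have : 0 ≤ K₂ * B := by positivity
    simp only [zero_div, Real.exp_zero, mul_one]
    linarith)).to_one hw le_rfl zero_le_one
  have hφ := hmild 0 _ _ _ le_rfl isWeight_one
    (hcomp 0 _ _ z le_rfl zero_le_one isWeight_one hclass) 1 zero_le_one le_rfl
  refine ⟨_, hclass, fun t ht => ?_⟩
  rw [hzk t ht]
  congr 1
  rcases ht.1.eq_or_lt with rfl | ht0
  · rw [hk0, convInt_self]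
  obtain ⟨K₄, hK₄, hle⟩ := h.exists_convInt_le
  -- For s > 0 both integrals from s to t agree, and the dyadic one from 0 differs from it by S(t-s)
  -- applied to an integral over [0,s], of order s^η.
  refine tendsto_nhds_unique (tendsto_left_of_continuousOn hkc ht0 ht.2) ?_
  rw [tendsto_iff_norm_sub_tendsto_zero]
  set d := K₁ * (K₀ * (1 + (2 * (K₂ * B) + 1 + B) * Real.exp (1 / δ))) * 1
  have hlim : Tendsto (fun s : ℝ => L * (K₄ * d * s ^ η)) (𝓝[>] 0) (𝓝 0) := by
    have : Tendsto (fun s : ℝ => s ^ η) (𝓝[>] 0) (𝓝 (0 ^ η)) :=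
      (tendsto_id.mono_left nhdsWithin_le_nhds).rpow_const (Or.inr h.eta_pos.le)
    rw [Real.zero_rpow h.eta_pos.ne'] at this
    simpa using (this.const_mul (K₄ * d)).const_mul L
  refine squeeze_zero' (Eventually.of_forall fun _ => norm_nonneg _) ?_ hlim
  filter_upwards [Ioo_mem_nhdsGT ht0] with s hs
  obtain ⟨-, -, hks⟩ := hconv s ⟨hs.1, hs.2.trans_le ht.2⟩
  rw [hks t hs.2.le ht.2, h.convInt_add le_rfl le_rfl hφ le_rfl hs.1.le hs.2.le ht.2,
    sub_add_cancel_left, norm_neg]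
  refine (hLS _ ⟨by linarith [hs.2], by linarith [hs.1, ht.2]⟩ _).trans ?_
  have := hle 0 1 _ _ le_rfl le_rfl hφ 0 s le_rfl hs.1.le (hs.2.le.trans ht.2)
  rw [sub_zero] at this
  gcongr

end YoungSetting

end Uniqueness

end YoungEvolution

theorem theorem3p5 {X : Type*} [NormedAddCommGroup X] [NormedSpace ℝ X] [CompleteSpace X]
    {E : ℝ → Type*} [∀ l, NormedAddCommGroup (E l)] [∀ l, NormedSpace ℝ (E l)]
    [∀ l, CompleteSpace (E l)]
    (S : ℝ → X →L[ℝ] X) (A : X →ₗ.[ℝ] X) (ι : ∀ l : ℝ, E l →L[ℝ] X)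
    (hS : IsSmoothingScale S A ι)
    (η : ℝ) (hη : 1 / 2 < η) (hη1 : η < 1)
    (x : ℝ → ℝ)
    (hx : ∃ C : ℝ, ∀ s ∈ Icc (0 : ℝ) 1, ∀ t ∈ Icc (0 : ℝ) 1, |x t - x s| ≤ C * |t - s| ^ η)
    (σ : X → X) (σ' : X → X →L[ℝ] X) (hσ : HasNiceGateauxDeriv σ σ')
    (α : ℝ) (hα : 0 < α) (hα1 : α < 1) (hηα : 1 < η + α)
    (hσα : LipschitzOnSubspace (ι α) σ)
    (θ : ℝ) (hθ : 0 ≤ θ) (hθα : θ ≤ α) (hηθ : 2 * α - θ < η)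
    (ψ : X) (hψ : ψ ∈ range (ι θ)) :
    ∃ y : ℝ → X, IsMildSolution S ι η x σ ψ y ∧ MemY S ι α (α - θ) y ∧
      ∀ z : ℝ → X, IsMildSolution S ι η x σ ψ z → EqOn z y (Icc 0 1) := by
  have h : YoungSetting S A ι x η α := ⟨hS, hx, hη1, hα, by linarith, hηα⟩
  obtain ⟨y, R, hy, hy', hsol, hmem⟩ := h.exists_mildSolution hσ hσα hθ hθα hηθ hψ
  refine ⟨y, hsol, hmem, fun z hz => ?_⟩
  obtain ⟨R', hz', hz''⟩ := h.exists_solClass_of_isMildSolution hσ hσα hz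
  -- Both fixed points are placed in a common ball, since the Lipschitz constant of the nonlinearity
  -- depends on the radius.
  exact h.eqOn_of_fixedPoint hσ hσα (hz'.mono_const isWeight_one le_rfl (le_max_right R R'))
    (hy.mono_const isWeight_one le_rfl (le_max_left R R')) hz'' hy'
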